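/- Let $M=(\mathbb H^s\times\mathbb C^s)/(U\ltimes\mathcal O_{\mathbb K})$ be an Oeljeklaus–Toma manifold of type $(s,s)$, where $\mathbb K$ has real embeddings $\sigma_1,\dots,\sigma_s$ and complex embeddings $\sigma_{s+1},\dots,\sigma_{2s}$ and their conjugates, $\mathcal O_{\mathbb K}$ acts on $\mathbb H^s\times\mathbb C^s$ by $(z_k,w_i)\mapsto(z_k+\sigma_k(a),w_i+\sigma_{s+i}(a))$, and $U$ is a free group of rank $s$ of totally positive units, with $\{(\log\sigma_k(u))_k: u\in U\}$ a lattice in $\mathbb R^s$, acting by $(z_k,w_i)\mapsto(\sigma_k(u)z_k,\sigma_{s+i}(u)w_i)$. Assume that for some real numbers $c_{ki}$ $$\sigma_{s+i}(u)=\sigma_i(u)^{-1/2}\,e^{\sqrt{-1}\sum_k c_{ki}\log\sigma_k(u)}\qquad (u\in U,\ 1\le i\le s)$$ (equivalently, $\sigma_i(u)|\sigma_{s+i}(u)|^2=1$ for all $u\in U$ and all $i$; up to relabelling the $\sigma_{s+i}$ this is the case in which $M$ admits a pluriclosed metric). Let $$\omega^k=\frac{dz_k}{\operatorname{Im}z_k},\qquad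 \gamma^i=(\operatorname{Im}z_i)^{1/2}e^{-\sqrt{-1}\sum_k c_{ki}\log \operatorname{Im}z_k}\,dw_i$$ be the associated left-invariant $(1,0)$-coframe; it satisfies $d\omega^k=\frac{\sqrt{-1}}2\omega^k\wedge\bar\omega^k$ and $d\gamma^i=\sum_k\lambda_{ki}(\omega^k-\bar\omega^k)\wedge\gamma^i$ with $\lambda_{ki}=-\frac12c_{ki}-\frac{\sqrt{-1}}4\delta_{ki}$. Let $p_1,\dots,p_m\in\{1,\dots,s\}$ be distinct indices with $\lambda_{jp_r}=0$ for all $j\ne p_r$ and all $r$, and let $$\omega=\sqrt{-1}\sum_{i=1}^s\left(A_i\,\omega^i\wedge\bar\omega^i+B_i\,\gamma^i\wedge\bar\gamma^i\right)+\sqrt{-1}\sum_{r=1}^m\left(C_r\,\omega^{p_r}\wedge\bar\gamma^{p_r}+\bar C_r\,\gamma^{p_r}\wedge\bar\omega^{p_r}\right)$$ ($A_i,B_i\in\mathbb R$, $C_r\in\mathbb C$) be positive definite. The pluriclosed flow on $M$ is the equation $\partial_t\omega_t=-\rho_B^{1,1}(\omega_t)$ for smooth families of pluriclosed Hermitian metrics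 on $M$, where $\rho_B$ is the Bismut–Ricci form. For every $T\in(0,\infty]$, a family $(\omega_t)_{t\in[0,T)}$ is a solution of it with $\omega_0=\omega$ if and only if $\omega_t$ is of the above form with coefficients $A_i(t),B_j(t),C_r(t)$ that have the given values at $t=0$ and solve on $[0,T)$ the system $$\begin{cases}A_i'=\frac34 & i\notin\{p_1,\dots,p_m\},\\[2pt] A_{p_r}'=\frac34\left(1+\frac{|C_r|^2}{A_{p_r}B_{p_r}-|C_r|^2}\right)& r=1,\dots,m,\\[2pt] B_j'=0 & j=1,\dots,s,\\[2pt] C_r'=-\left(\frac3{16}+\frac{c_{p_rp_r}^2}4+\frac{\sqrt{-1}\,c_{p_rp_r}}4\right)\frac{B_{p_r}C_r}{A_{p_r}B_{p_r}-|C_r|^2}& r=1,\dots,m.\end{cases}$$ Moreover, the solution exists for all $t\in[0,\infty)$, and every solution on an interval $[0,T)$ is its restriction; each $B_j$ is constant and each $|C_r|$ is nonincreasing (hence bounded) on $[0,\infty)$; and $A_i(t)\sim\frac34t$ as $t\to\infty$ for all $i$. In particular $$\frac{\omega_t}{1+t}\longrightarrow 3\,\omega_\infty\quad (t\to\infty),\qquad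 \omega_\infty=\sqrt{-1}\sum_{k=1}^s\frac{dz_k\wedge d\bar z_k}{4(\operatorname{Im}z_k)^2},$$ where the coefficients in the coordinates $(z,w)$ converge on $\mathbb H^s\times\mathbb C^s$ locally uniformly with all their derivatives. -/

import Mathlib

open scoped ComplexConjugate ComplexOrder ContDiff NumberField

noncomputable section

namespace OT

/-- Coordinates `(z, w)` on `ℂˢ × ℂˢ`: `z k = x (Sum.inl k)` and `w i = x (Sum.inr i)`. -/
abbrev Coord (s : ℕ) : Type := Fin s ⊕ Fin s → ℂ

/-- A field of `2s × 2s` complex matrices. The matrix field `h` stands for the form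
`√-1 ∑ i j, h x i j dxⁱ ∧ dx̄ʲ` of type `(1,1)`. Only its values on `ℍˢ × ℂˢ` matter. -/
abbrev FormField (s : ℕ) : Type := Coord s → Matrix (Fin s ⊕ Fin s) (Fin s ⊕ Fin s) ℂ

/-- The domain `ℍˢ × ℂˢ`. -/
def domain (s : ℕ) : Set (Coord s) := {x | ∀ k : Fin s, 0 < (x (Sum.inl k)).im}

/-- The data of an Oeljeklaus-Toma manifold of type `(s, s)`: a number field with `s` real
embeddings `σ k` and `s` pairs of complex embeddings `τ i`, `conj ∘ τ i` (these are all the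
embeddings, without repetition), and a free group `U` of rank `s` of totally positive units whose
image under `u ↦ (log (σ k u))ₖ` spans `ℝˢ` (as `U ≅ ℤˢ`, this says that the image is a lattice
of rank `s`). The manifold is the quotient of `ℍˢ × ℂˢ` by `U ⋉ 𝓞 K`. -/
structure Data (s : ℕ) (K : Type*) [Field K] [NumberField K] where
  σ : Fin s → K →+* ℝ
  τ : Fin s → K →+* ℂ
  embeddings : Function.Bijective
    (Sum.elim (fun k => Complex.ofRealHom.comp (σ k))
      (Sum.elim τ (fun i => (starRingEnd ℂ).comp (τ i))) : Fin s ⊕ Fin s ⊕ Fin s → (K →+* ℂ))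
  U : Subgroup (𝓞 K)ˣ
  pos : ∀ u ∈ U, ∀ k, 0 < σ k ((u : 𝓞 K) : K)
  free : Nonempty (Additive U ≃+ (Fin s → ℤ))
  log_span : Submodule.span ℝ
    {v : Fin s → ℝ | ∃ u ∈ U, v = fun k => Real.log (σ k ((u : 𝓞 K) : K))} = ⊤

variable {s : ℕ} {K : Type*} [Field K] [NumberField K]

/-- `a ↦ (σ₁ a, …, σₛ a, τ₁ a, …, τₛ a)`. -/
def Data.emb (X : Data s K) (a : K) : Coord s :=
  Sum.elim (fun k => (X.σ k a : ℂ)) (fun i => X.τ i a)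

/-- The real numbers `c k i` are admissible for the manifold:
`τᵢ(u) = σᵢ(u)^(-1/2) exp(√-1 ∑ₖ c k i log σₖ(u))` for all `u ∈ U`. (Such `c` exist if and only if
`σᵢ(u) |τᵢ(u)|² = 1` for all `u ∈ U` and all `i`.) -/
def Data.Twist (X : Data s K) (c : Fin s → Fin s → ℝ) : Prop :=
  ∀ u ∈ X.U, ∀ i : Fin s,
    X.τ i ((u : 𝓞 K) : K) =
      (((X.σ i ((u : 𝓞 K) : K)) ^ (-(1 / 2) : ℝ) : ℝ) : ℂ) *
        Complex.exp (Complex.I *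
          ((∑ k : Fin s, c k i * Real.log (X.σ k ((u : 𝓞 K) : K)) : ℝ) : ℂ))

/-- The `(1,1)`-form `h` on `ℍˢ × ℂˢ` is invariant under the translations by `𝓞 K` and under the
dilations by `U`, i.e. it is the pull-back of a form on the quotient by `U ⋉ 𝓞 K`. -/
def Data.Invariant (X : Data s K) (h : FormField s) : Prop :=
  ∀ x ∈ domain s,
    (∀ a : 𝓞 K, h (x + X.emb (a : K)) = h x) ∧
    (∀ u ∈ X.U, ∀ i j,
      h (X.emb ((u : 𝓞 K) : K) * x) i j *
        (X.emb ((u : 𝓞 K) : K) i * conj (X.emb ((u : 𝓞 K) : K) j)) = h x i j)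

/-- `h` is the fundamental form of a smooth Hermitian metric on the Oeljeklaus-Toma manifold. -/
def Data.IsHermitianMetric (X : Data s K) (h : FormField s) : Prop :=
  (∀ i j, ContDiffOn ℝ ∞ (fun x => h x i j) (domain s)) ∧
  (∀ x ∈ domain s, (h x).PosDef) ∧ X.Invariant h

/-- The Wirtinger derivative `∂f/∂xⁱ`. -/
def dz (i : Fin s ⊕ Fin s) (f : Coord s → ℂ) (x : Coord s) : ℂ :=
  (1 / 2) * (fderiv ℝ f x (Pi.single i 1) - Complex.I * fderiv ℝ f x (Pi.single i Complex.I))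

/-- The Wirtinger derivative `∂f/∂x̄ⁱ`. -/
def dzbar (i : Fin s ⊕ Fin s) (f : Coord s → ℂ) (x : Coord s) : ℂ :=
  (1 / 2) * (fderiv ℝ f x (Pi.single i 1) + Complex.I * fderiv ℝ f x (Pi.single i Complex.I))

/-- `∂∂̄ω = 0` on `ℍˢ × ℂˢ`: the coefficients of
`∂∂̄ω = √-1 ∑ (∂ₖ∂̄ₗ hᵢⱼ) dxᵏ ∧ dx̄ˡ ∧ dxⁱ ∧ dx̄ʲ`, antisymmetrized in `(k, i)` and in `(l, j)`. -/
def IsPluriclosed (h : FormField s) : Prop :=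
  ∀ x ∈ domain s, ∀ i j k l,
    dz k (dzbar l (fun y => h y i j)) x - dz i (dzbar l (fun y => h y k j)) x
      - dz k (dzbar j (fun y => h y i l)) x + dz i (dzbar j (fun y => h y k l)) x = 0

/-- The real 2-form `√-1 ∑ h x i j dxⁱ ∧ dx̄ʲ` evaluated on two real tangent vectors (a real
tangent vector is an element of `Coord s`, the complex structure being multiplication by `√-1`). -/
def fundForm (h : FormField s) (x u v : Coord s) : ℝ :=
  -2 * (∑ i, ∑ j, h x i j * u i * conj (v j)).im

/-- The Riemannian metric `g(u, v) = ω(u, J v)`; hence `ω(u, v) = g(J u, v)`. -/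
def metric (h : FormField s) (x u v : Coord s) : ℝ :=
  fundForm h x u (Complex.I • v)

/-- A linear connection on the tangent bundle of `ℍˢ × ℂˢ` given by its Christoffel symbols in
the standard coordinates: `∇_u v = Γ x u v` for constant vector fields `u`, `v`. -/
abbrev Christoffel (s : ℕ) : Type := Coord s → Coord s →L[ℝ] Coord s →L[ℝ] Coord s

/-- The torsion tensor (constant vector fields commute). -/
def torsion (Γ : Christoffel s) (x u v : Coord s) : Coord s := Γ x u v - Γ x v u

/-- The curvature tensor `R(u, v) w = ∇_u ∇_v w - ∇_v ∇_u w - ∇_[u, v] w`, for constant vector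
fields. -/
def curvature (Γ : Christoffel s) (x u v w : Coord s) : Coord s :=
  fderiv ℝ Γ x u v w - fderiv ℝ Γ x v u w + Γ x u (Γ x v w) - Γ x v (Γ x u w)

/-- `Γ` is the Bismut connection of the Hermitian metric `h`: it is smooth, preserves the metric
and the complex structure `J`, and `ω(T(·,·), J·) = g(T(·,·), ·)` is a 3-form (it is always
alternating in the first two arguments). -/
structure IsBismutConnection (h : FormField s) (Γ : Christoffel s) : Prop where
  smooth : ContDiffOn ℝ ∞ Γ (domain s)
  preserves_metric : ∀ x ∈ domain s, ∀ u v w,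
    fderiv ℝ (fun y => metric h y v w) x u = metric h x (Γ x u v) w + metric h x v (Γ x u w)
  preserves_J : ∀ x ∈ domain s, ∀ u v, Γ x u (Complex.I • v) = Complex.I • Γ x u v
  torsion_alternating : ∀ x ∈ domain s, ∀ u v w,
    fundForm h x (torsion Γ x u v) (Complex.I • w) =
      - fundForm h x (torsion Γ x u w) (Complex.I • v)

/-- The Ricci form `ρ(u, v) = √-1 ∑ᵢ R(u, v, Xᵢ, X̄ᵢ)` of a connection that preserves the metric
and `J`, with `Xᵢ` a unitary frame of `T^{1,0}`: the sum is the complex trace of `R(u, v)` on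
`T^{1,0} ≅ (T, J)`, computed here in the standard basis. It is purely imaginary, so that `ρ` is
real. -/
def ricciForm (Γ : Christoffel s) (x u v : Coord s) : ℝ :=
  (Complex.I * ∑ i, curvature Γ x u v (Pi.single i 1) i).re

/-- The `(1,1)`-part of the Ricci form. -/
def ricciForm11 (Γ : Christoffel s) (x u v : Coord s) : ℝ :=
  (1 / 2) * (ricciForm Γ x u v + ricciForm Γ x (Complex.I • u) (Complex.I • v))

/-- The time interval `[0, T)`, with `T = ⊤` for `[0, ∞)`. -/
def timeInterval (T : EReal) : Set ℝ := {t | 0 ≤ t ∧ (t : EReal) < T}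

/-- `h t`, `t ∈ [0, T)`, is a solution of the pluriclosed flow on the Oeljeklaus-Toma manifold that
starts from `h₀`: a smooth family of pluriclosed Hermitian metrics with `∂ₜω = -ρ_B^{1,1}(ω)`. -/
structure Data.IsPluriclosedFlow (X : Data s K) (T : EReal) (h₀ : FormField s)
    (h : ℝ → FormField s) : Prop where
  smooth : ∀ i j, ContDiffOn ℝ ∞ (fun q : ℝ × Coord s => h q.1 q.2 i j)
    (timeInterval T ×ˢ domain s)
  isHermitianMetric : ∀ t ∈ timeInterval T, X.IsHermitianMetric (h t)
  isPluriclosed : ∀ t ∈ timeInterval T, IsPluriclosed (h t)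
  initial : ∀ x ∈ domain s, h 0 x = h₀ x
  equation : ∀ t ∈ timeInterval T, ∃ Γ, IsBismutConnection (h t) Γ ∧
    ∀ x ∈ domain s, ∀ u v,
      HasDerivWithinAt (fun t' => fundForm (h t') x u v) (- ricciForm11 Γ x u v)
        (timeInterval T) t

/-- The coefficients of the left-invariant `(1,0)`-coframe `ω¹, …, ωˢ, γ¹, …, γˢ`:
`ωᵏ = (Im zₖ)⁻¹ dzₖ` and `γⁱ = (Im zᵢ)^(1/2) exp(-√-1 ∑ₖ c k i log (Im zₖ)) dwᵢ`.
It satisfies `dωᵏ = (√-1/2) ωᵏ ∧ ω̄ᵏ` and `dγⁱ = ∑ₖ λₖᵢ (ωᵏ - ω̄ᵏ) ∧ γⁱ` with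
`λₖᵢ = -c k i / 2` for `k ≠ i` and `λᵢᵢ = -c i i / 2 - √-1/4`. -/
def coframe (c : Fin s → Fin s → ℝ) (x : Coord s) : Coord s :=
  Sum.elim (fun k => (((x (Sum.inl k)).im⁻¹ : ℝ) : ℂ))
    (fun i => ((Real.sqrt (x (Sum.inl i)).im : ℝ) : ℂ) *
      Complex.exp (-Complex.I *
        ((∑ k : Fin s, c k i * Real.log (x (Sum.inl k)).im : ℝ) : ℂ)))

/-- The left-invariant `(1,1)`-form `√-1 ∑ H i j θⁱ ∧ θ̄ʲ`, with `θ` the coframe above. -/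
def leftInvariant (c : Fin s → Fin s → ℝ) (H : Matrix (Fin s ⊕ Fin s) (Fin s ⊕ Fin s) ℂ) :
    FormField s :=
  fun x => Matrix.of fun i j => H i j * (coframe c x i * conj (coframe c x j))

/-- The coefficient matrix of
`√-1 ∑ᵢ (Aᵢ ωⁱ ∧ ω̄ⁱ + Bᵢ γⁱ ∧ γ̄ⁱ) + √-1 ∑ᵣ (Cᵣ ω^{pᵣ} ∧ γ̄^{pᵣ} + C̄ᵣ γ^{pᵣ} ∧ ω̄^{pᵣ})`. -/
def coeffs {k : ℕ} (p : Fin k → Fin s) (A B : Fin s → ℝ) (C : Fin k → ℂ) :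
    Matrix (Fin s ⊕ Fin s) (Fin s ⊕ Fin s) ℂ :=
  Matrix.fromBlocks
    (Matrix.diagonal fun i => (A i : ℂ))
    (Matrix.of fun i j => ∑ r, if p r = i ∧ p r = j then C r else 0)
    (Matrix.of fun i j => ∑ r, if p r = i ∧ p r = j then conj (C r) else 0)
    (Matrix.diagonal fun i => (B i : ℂ))

/-- The degenerate form `ω_∞ = √-1 ∑ₖ dzₖ ∧ dz̄ₖ / (4 (Im zₖ)²)`. -/
def omegaInfty (s : ℕ) : FormField s := fun x =>
  Matrix.diagonal (Sum.elim (fun k => (((4 * (x (Sum.inl k)).im ^ 2)⁻¹ : ℝ) : ℂ)) fun _ => 0)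

/-- The system of ordinary differential equations for `A`, `B`, `C` on `[0, T)`. -/
structure SolvesODE {k : ℕ} (c : Fin s → Fin s → ℝ) (p : Fin k → Fin s) (T : EReal)
    (A B : ℝ → Fin s → ℝ) (C : ℝ → Fin k → ℂ) : Prop where
  eq_A : ∀ t ∈ timeInterval T, ∀ i ∉ Set.range p,
    HasDerivWithinAt (fun t' => A t' i) (3 / 4) (timeInterval T) t
  eq_Ap : ∀ t ∈ timeInterval T, ∀ r,
    HasDerivWithinAt (fun t' => A t' (p r))
      (3 / 4 * (1 + ‖C t r‖ ^ 2 / (A t (p r) * B t (p r) - ‖C t r‖ ^ 2))) (timeInterval T) t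
  eq_B : ∀ t ∈ timeInterval T, ∀ j,
    HasDerivWithinAt (fun t' => B t' j) 0 (timeInterval T) t
  eq_C : ∀ t ∈ timeInterval T, ∀ r,
    HasDerivWithinAt (fun t' => C t' r)
      (-(3 / 16 + (c (p r) (p r) : ℂ) ^ 2 / 4 + Complex.I * (c (p r) (p r) : ℂ) / 4) *
        ((B t (p r) : ℂ) * C t r /
          ((A t (p r) * B t (p r) - ‖C t r‖ ^ 2 : ℝ) : ℂ))) (timeInterval T) t

end OT

end

open scoped ComplexConjugate ComplexOrder ContDiff NumberField

namespace OT

open Complex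

variable {s : ℕ}

/-! ### Wirtinger calculus -/

/-! The flow is solved explicitly among left-invariant metrics, and every other solution is excluded
by a maximum principle. No existence theory for parabolic systems enters.

Ricci form. Compatibility with the metric and skew-symmetry of the torsion determine the Bismut
connection by first derivatives of `h` (`hol_mul`, `anti_mul`). The complex trace of its curvature
is the exterior derivative of the trace of the connection, so the (1,1) part has the coefficients
`ricciCoeff` (`ricciForm11_eq`). Pluriclosedness trades the second derivatives that occur there for
`∑ gⁱᵐ ∂ᵢ∂̄ₘ` applied to a single entry (`IsMetric.ricciCoeff_eq`). Along the flow the metric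
therefore solves a strictly parabolic quasilinear system, `evolution`.

Uniqueness. The action of `U ⋉ 𝓞 K` has a compact set meeting every orbit (`Data.exists_compact`).
Multiplying the entries of the difference of two solutions by the weights `1/|θⁱ|` of the coframe
makes their norms invariant, so `distSq` attains its spatial maximum. There the second derivative
test absorbs the first order errors, the time derivative is at most a constant times `distSq`, and
`distSq` stays zero (`Data.IsPluriclosedFlow.unique`).

Explicit solution. Since `c j p = 0` for `j ≠ p`, the metric splits in coordinates into 2 × 2
blocks, the `i`-th one depending only on `Y = Im zᵢ`. Its off-diagonal entry is a multiple of `Y ^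
σ` with `σ = -1/2 + √-1 c`, and `σ² - 1 = -4 κ`, where `κ` is `rate c`; this is the origin of the
constant in the equation for `C` (`ricciCoeff_leftBlocks`). The `dw ∧ dw̄` part of the Ricci form
vanishes, so `B` is constant.

The system. Put `δ = AB - |C|²` and let `l' = (3/4) B/δ` with `l(0) = 0`. Then `A = A₀ eˡ` and `C =
C₀ exp(-(4/3) κ l)`, so that `|C|² = |C₀|² e^(-μ l)` with `μ = (8/3) Re κ`. The equation for `l`
integrates to `potential(l) = potential(0) + (3/4) B t`, that is, `AB + |C|²/μ` grows linearly in
time. The potential is increasing where `δ > 0`, which gives existence for all time, uniqueness and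
smoothness of `l`, monotonicity of `|C|`, and boundedness of `A - (3/4) t`. Each entry of the metric
is a function of time multiplied by a fixed smooth function of the point, so convergence of the
coefficients yields locally uniform convergence of all derivatives. -/

theorem isOpen_domain : IsOpen (domain s) := by
  have : domain s = ⋂ k : Fin s, {x | 0 < (x (Sum.inl k)).im} := by
    ext x; simp [domain]
  rw [this]
  exact isOpen_iInter_of_finite fun k => isOpen_lt continuous_const (by fun_prop)

theorem domain_mem_nhds {x : Coord s} (hx : x ∈ domain s) : domain s ∈ nhds x :=
  isOpen_domain.mem_nhds hx

/-- The `dxᵏ` coefficient of a real-linear functional. -/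
noncomputable def holPart (k : Fin s ⊕ Fin s) (φ : Coord s → ℂ) : ℂ :=
  (1 / 2) * (φ (Pi.single k 1) - I * φ (Pi.single k I))

/-- The `dx̄ᵏ` coefficient of a real-linear functional. -/
noncomputable def antiPart (k : Fin s ⊕ Fin s) (φ : Coord s → ℂ) : ℂ :=
  (1 / 2) * (φ (Pi.single k 1) + I * φ (Pi.single k I))

theorem dz_eq (k : Fin s ⊕ Fin s) (f : Coord s → ℂ) (x : Coord s) :
    dz k f x = holPart k (fderiv ℝ f x) := rfl

theorem dzbar_eq (k : Fin s ⊕ Fin s) (f : Coord s → ℂ) (x : Coord s) :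
    dzbar k f x = antiPart k (fderiv ℝ f x) := rfl

theorem single_one_eq (k : Fin s ⊕ Fin s) (a : ℂ) :
    (Pi.single k a : Coord s) =
      a.re • (Pi.single k 1 : Coord s) + a.im • (Pi.single k I : Coord s) := by
  rw [← Pi.single_smul, ← Pi.single_smul, ← Pi.single_add]
  congr 1
  apply Complex.ext <;> simp

theorem coord_eq_sum (u : Coord s) :
    u = ∑ k, ((u k).re • (Pi.single k 1 : Coord s) + (u k).im • (Pi.single k I : Coord s)) := by
  conv_lhs => rw [← Finset.univ_sum_single u]
  exact Finset.sum_congr rfl fun k _ => single_one_eq k (u k)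

/-- The splitting into types of a real-linear functional; it carries the real derivative `fderiv`
over to Wirtinger derivatives. -/
theorem apply_eq_sum_parts (φ : Coord s →ₗ[ℝ] ℂ) (u : Coord s) :
    φ u = ∑ k, (holPart k φ * u k + antiPart k φ * conj (u k)) := by
  conv_lhs => rw [coord_eq_sum u]
  rw [map_sum]
  refine Finset.sum_congr rfl fun k _ => ?_
  rw [map_add, map_smul, map_smul, holPart, antiPart]
  apply Complex.ext <;> simp <;> ring

theorem holPart_congr {k : Fin s ⊕ Fin s} {φ ψ : Coord s → ℂ} (h : ∀ u, φ u = ψ u) :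
    holPart k φ = holPart k ψ := by
  rw [funext h]

theorem conj_holPart (k : Fin s ⊕ Fin s) (φ : Coord s → ℂ) :
    conj (holPart k φ) = antiPart k fun u => conj (φ u) := by
  simp [holPart, antiPart, conj_ofNat]

theorem conj_antiPart (k : Fin s ⊕ Fin s) (φ : Coord s → ℂ) :
    conj (antiPart k φ) = holPart k fun u => conj (φ u) := by
  simp [holPart, antiPart, sub_eq_add_neg, conj_ofNat]

theorem holPart_add (k : Fin s ⊕ Fin s) (φ ψ : Coord s → ℂ) :
    (holPart k fun u => φ u + ψ u) = holPart k φ + holPart k ψ := by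
  simp only [holPart]; ring

theorem antiPart_add (k : Fin s ⊕ Fin s) (φ ψ : Coord s → ℂ) :
    (antiPart k fun u => φ u + ψ u) = antiPart k φ + antiPart k ψ := by
  simp only [antiPart]; ring

theorem holPart_mul_const (k : Fin s ⊕ Fin s) (φ : Coord s → ℂ) (a : ℂ) :
    (holPart k fun u => φ u * a) = holPart k φ * a := by
  simp only [holPart]; ring

theorem antiPart_mul_const (k : Fin s ⊕ Fin s) (φ : Coord s → ℂ) (a : ℂ) :
    (antiPart k fun u => φ u * a) = antiPart k φ * a := by
  simp only [antiPart]; ring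

theorem holPart_sum {ι : Type*} (t : Finset ι) (k : Fin s ⊕ Fin s) (φ : ι → Coord s → ℂ) :
    (holPart k fun u => ∑ i ∈ t, φ i u) = ∑ i ∈ t, holPart k (φ i) := by
  simp only [holPart, Finset.mul_sum, ← Finset.sum_sub_distrib]

theorem antiPart_sum {ι : Type*} (t : Finset ι) (k : Fin s ⊕ Fin s) (φ : ι → Coord s → ℂ) :
    (antiPart k fun u => ∑ i ∈ t, φ i u) = ∑ i ∈ t, antiPart k (φ i) := by
  simp only [antiPart, Finset.mul_sum, ← Finset.sum_add_distrib]

/-- Smooth functions on `ℍˢ × ℂˢ`. -/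
def Smooth (f : Coord s → ℂ) : Prop := ContDiffOn ℝ ∞ f (domain s)

theorem Smooth.contDiffAt {f : Coord s → ℂ} (hf : Smooth f) {x : Coord s} (hx : x ∈ domain s) :
    ContDiffAt ℝ ∞ f x := ContDiffOn.contDiffAt hf (domain_mem_nhds hx)

theorem Smooth.differentiableAt {f : Coord s → ℂ} (hf : Smooth f) {x : Coord s}
    (hx : x ∈ domain s) : DifferentiableAt ℝ f x :=
  (hf.contDiffAt hx).differentiableAt (by simp)

theorem Smooth.fderiv {f : Coord s → ℂ} (hf : Smooth f) :
    ContDiffOn ℝ ∞ (fderiv ℝ f) (domain s) :=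
  ContDiffOn.fderiv_of_isOpen hf isOpen_domain (by simp)

theorem Smooth.fderiv_apply {f : Coord s → ℂ} (hf : Smooth f) (u : Coord s) :
    Smooth fun y => _root_.fderiv ℝ f y u :=
  hf.fderiv.clm_apply contDiffOn_const

theorem Smooth.add {f g : Coord s → ℂ} (hf : Smooth f) (hg : Smooth g) :
    Smooth fun y => f y + g y := ContDiffOn.add hf hg

theorem Smooth.sub {f g : Coord s → ℂ} (hf : Smooth f) (hg : Smooth g) :
    Smooth fun y => f y - g y := ContDiffOn.sub hf hg

theorem Smooth.mul {f g : Coord s → ℂ} (hf : Smooth f) (hg : Smooth g) :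
    Smooth fun y => f y * g y := ContDiffOn.mul hf hg

theorem Smooth.sum {ι : Type*} {t : Finset ι} {f : ι → Coord s → ℂ}
    (hf : ∀ i ∈ t, Smooth (f i)) : Smooth fun y => ∑ i ∈ t, f i y := ContDiffOn.sum hf

theorem Smooth.const (a : ℂ) : Smooth fun _ : Coord s => a := contDiffOn_const

theorem Smooth.conj {f : Coord s → ℂ} (hf : Smooth f) : Smooth fun y => conj (f y) :=
  conjCLE.contDiff.comp_contDiffOn hf

theorem Smooth.dz {f : Coord s → ℂ} (hf : Smooth f) (k : Fin s ⊕ Fin s) : Smooth (dz k f) :=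
  (Smooth.const _).mul ((hf.fderiv_apply _).sub ((Smooth.const _).mul (hf.fderiv_apply _)))

theorem Smooth.dzbar {f : Coord s → ℂ} (hf : Smooth f) (k : Fin s ⊕ Fin s) : Smooth (dzbar k f) :=
  (Smooth.const _).mul ((hf.fderiv_apply _).add ((Smooth.const _).mul (hf.fderiv_apply _)))

theorem fderiv_congr {f g : Coord s → ℂ} (h : ∀ x ∈ domain s, f x = g x) {x : Coord s}
    (hx : x ∈ domain s) : fderiv ℝ f x = fderiv ℝ g x :=
  Filter.EventuallyEq.fderiv_eq (Filter.eventually_of_mem (domain_mem_nhds hx) h)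

theorem dz_congr {f g : Coord s → ℂ} (h : ∀ x ∈ domain s, f x = g x) {x : Coord s}
    (hx : x ∈ domain s) (k : Fin s ⊕ Fin s) : dz k f x = dz k g x := by
  rw [dz, dz, fderiv_congr h hx]

theorem dzbar_congr {f g : Coord s → ℂ} (h : ∀ x ∈ domain s, f x = g x) {x : Coord s}
    (hx : x ∈ domain s) (k : Fin s ⊕ Fin s) : dzbar k f x = dzbar k g x := by
  rw [dzbar, dzbar, fderiv_congr h hx]

theorem fderiv_conj_apply (f : Coord s → ℂ) (x u : Coord s) :
    fderiv ℝ (fun y => conj (f y)) x u = conj (fderiv ℝ f x u) := by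
  have h : fderiv ℝ (fun y => conj (f y)) x
      = (conjCLE : ℂ →L[ℝ] ℂ).comp (fderiv ℝ f x) := conjCLE.comp_fderiv (f := f) (x := x)
  rw [h]; rfl

theorem conj_dz (k : Fin s ⊕ Fin s) (f : Coord s → ℂ) (x : Coord s) :
    conj (dz k f x) = dzbar k (fun y => conj (f y)) x := by
  rw [dz_eq, conj_holPart, dzbar_eq]
  congr 1; ext u; exact (fderiv_conj_apply f x u).symm

section
variable {f g : Coord s → ℂ} {x : Coord s} (k : Fin s ⊕ Fin s)

theorem dz_sub (hf : DifferentiableAt ℝ f x) (hg : DifferentiableAt ℝ g x) :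
    dz k (fun y => f y - g y) x = dz k f x - dz k g x := by
  simp only [dz, fderiv_fun_sub hf hg, sub_apply]; ring

theorem dz_mul (hf : DifferentiableAt ℝ f x) (hg : DifferentiableAt ℝ g x) :
    dz k (fun y => f y * g y) x = dz k f x * g x + f x * dz k g x := by
  simp only [dz, fderiv_fun_mul hf hg, add_apply,
    smul_apply, smul_eq_mul]; ring

theorem dzbar_mul (hf : DifferentiableAt ℝ f x) (hg : DifferentiableAt ℝ g x) :
    dzbar k (fun y => f y * g y) x = dzbar k f x * g x + f x * dzbar k g x := by
  simp only [dzbar, fderiv_fun_mul hf hg, add_apply,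
    smul_apply, smul_eq_mul]; ring

theorem dz_sum {ι : Type*} {t : Finset ι} {F : ι → Coord s → ℂ}
    (hF : ∀ i ∈ t, DifferentiableAt ℝ (F i) x) :
    dz k (fun y => ∑ i ∈ t, F i y) x = ∑ i ∈ t, dz k (F i) x := by
  simp only [dz_eq, fderiv_fun_sum hF]
  rw [← holPart_sum]; congr 1; ext u; simp

theorem dzbar_sum {ι : Type*} {t : Finset ι} {F : ι → Coord s → ℂ}
    (hF : ∀ i ∈ t, DifferentiableAt ℝ (F i) x) :
    dzbar k (fun y => ∑ i ∈ t, F i y) x = ∑ i ∈ t, dzbar k (F i) x := by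
  simp only [dzbar_eq, fderiv_fun_sum hF]
  rw [← antiPart_sum]; congr 1; ext u; simp

end

/-- The `∂ᵢ∂̄ₘ` component of a real-bilinear form. -/
noncomputable def levi (i m : Fin s ⊕ Fin s) (S : Coord s →L[ℝ] Coord s →L[ℝ] ℂ) : ℂ :=
  holPart i fun u => antiPart m fun v => S u v

theorem fderiv_fderiv_apply {f : Coord s → ℂ} (hf : Smooth f) {x : Coord s} (hx : x ∈ domain s)
    (u v : Coord s) :
    fderiv ℝ (fun y => fderiv ℝ f y v) x u = fderiv ℝ (fderiv ℝ f) x u v := by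
  have h : DifferentiableAt ℝ (fderiv ℝ f) x :=
    (hf.fderiv.contDiffAt (domain_mem_nhds hx)).differentiableAt (by simp)
  rw [fderiv_clm_apply h (differentiableAt_const v)]
  simp

theorem fderiv_fderiv_symm {f : Coord s → ℂ} (hf : Smooth f) {x : Coord s} (hx : x ∈ domain s)
    (u v : Coord s) : fderiv ℝ (fderiv ℝ f) x u v = fderiv ℝ (fderiv ℝ f) x v u :=
  ((hf.contDiffAt hx).isSymmSndFDerivAt (by simp; exact WithTop.coe_le_coe.2 le_top)).eq u v

theorem fderiv_dzbar_apply {f : Coord s → ℂ} (hf : Smooth f) {x : Coord s} (hx : x ∈ domain s)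
    (m : Fin s ⊕ Fin s) (u : Coord s) :
    fderiv ℝ (dzbar m f) x u = antiPart m fun v => fderiv ℝ (fderiv ℝ f) x u v := by
  have h1 := (hf.fderiv_apply (Pi.single m 1)).differentiableAt hx
  have h2 := (hf.fderiv_apply (Pi.single m I)).differentiableAt hx
  have : dzbar m f = fun y => (1 / 2 : ℂ) * (fderiv ℝ f y (Pi.single m 1)
    + I * fderiv ℝ f y (Pi.single m I)) := rfl
  rw [this, fderiv_const_mul (h1.fun_add (h2.const_mul _)), fderiv_fun_add h1 (h2.const_mul _),
    fderiv_const_mul h2]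
  simp [fderiv_fderiv_apply hf hx, antiPart, mul_add]

theorem fderiv_dz_apply {f : Coord s → ℂ} (hf : Smooth f) {x : Coord s} (hx : x ∈ domain s)
    (m : Fin s ⊕ Fin s) (u : Coord s) :
    fderiv ℝ (dz m f) x u = holPart m fun v => fderiv ℝ (fderiv ℝ f) x u v := by
  have h1 := (hf.fderiv_apply (Pi.single m 1)).differentiableAt hx
  have h2 := (hf.fderiv_apply (Pi.single m I)).differentiableAt hx
  have : dz m f = fun y => (1 / 2 : ℂ) * (fderiv ℝ f y (Pi.single m 1)
    - I * fderiv ℝ f y (Pi.single m I)) := rfl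
  rw [this, fderiv_const_mul (h1.fun_sub (h2.const_mul _)), fderiv_fun_sub h1 (h2.const_mul _),
    fderiv_const_mul h2]
  simp [fderiv_fderiv_apply hf hx, holPart]

theorem dz_dzbar {f : Coord s → ℂ} (hf : Smooth f) {x : Coord s} (hx : x ∈ domain s)
    (i m : Fin s ⊕ Fin s) : dz i (dzbar m f) x = levi i m (fderiv ℝ (fderiv ℝ f) x) := by
  rw [dz_eq, levi]
  congr 1; ext u; exact fderiv_dzbar_apply hf hx m u

theorem dzbar_dz {f : Coord s → ℂ} (hf : Smooth f) {x : Coord s} (hx : x ∈ domain s)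
    (i m : Fin s ⊕ Fin s) : dzbar m (dz i f) x = dz i (dzbar m f) x := by
  rw [dz_dzbar hf hx, dzbar_eq, antiPart, fderiv_dz_apply hf hx, fderiv_dz_apply hf hx]
  simp only [levi, holPart, antiPart, fderiv_fderiv_symm hf hx (Pi.single m _)]
  ring

theorem levi_symm_conj {S S' : Coord s →L[ℝ] Coord s →L[ℝ] ℂ} (hS : ∀ u v, S u v = S v u)
    (h : ∀ u v, S' u v = conj (S u v)) (i m : Fin s ⊕ Fin s) :
    conj (levi i m S) = levi m i S' := by
  simp only [levi, holPart, antiPart, h, map_mul, map_add, map_sub, conj_I, hS (Pi.single m _)]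
  simp [conj_ofNat]
  ring

end OT

namespace OT

open Complex

variable {s : ℕ}

/-! ### The Bismut connection and its Ricci form -/

/-- Smooth Hermitian metrics on `ℍˢ × ℂˢ`. -/
structure IsMetric (h : FormField s) : Prop where
  smooth : ∀ i j, Smooth fun x => h x i j
  posDef : ∀ x ∈ domain s, (h x).PosDef

theorem IsMetric.conj_apply {h : FormField s} (hh : IsMetric h) {x : Coord s} (hx : x ∈ domain s)
    (i j : Fin s ⊕ Fin s) : conj (h x i j) = h x j i :=
  (hh.posDef x hx).1.apply j i

theorem IsMetric.isUnit_det {h : FormField s} (hh : IsMetric h) {x : Coord s} (hx : x ∈ domain s) :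
    IsUnit (h x).det := (Matrix.isUnit_iff_isUnit_det _).1 (hh.posDef x hx).isUnit

theorem IsMetric.conj_dz_apply {h : FormField s} (hh : IsMetric h) {x : Coord s}
    (hx : x ∈ domain s) (k i j : Fin s ⊕ Fin s) :
    conj (dz k (fun y => h y i j) x) = dzbar k (fun y => h y j i) x := by
  rw [conj_dz]
  exact dzbar_congr (fun y hy => hh.conj_apply hy i j) hx k

/-- The Hermitian product of two tangent vectors. -/
noncomputable def herm (h : FormField s) (x u v : Coord s) : ℂ :=
  ∑ i, ∑ j, h x i j * u i * conj (v j)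

theorem herm_sub_left (h : FormField s) (x u u' v : Coord s) :
    herm h x (u - u') v = herm h x u v - herm h x u' v := by
  simp only [herm, ← Finset.sum_sub_distrib, Pi.sub_apply]
  exact Finset.sum_congr rfl fun i _ => Finset.sum_congr rfl fun j _ => by ring

theorem herm_smul_left (h : FormField s) (x u v : Coord s) (a : ℂ) :
    herm h x (a • u) v = a * herm h x u v := by
  simp only [herm, Finset.mul_sum, Pi.smul_apply, smul_eq_mul]
  exact Finset.sum_congr rfl fun i _ => Finset.sum_congr rfl fun j _ => by ring

theorem herm_smul_right (h : FormField s) (x u v : Coord s) (a : ℂ) :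
    herm h x u (a • v) = conj a * herm h x u v := by
  simp only [herm, Finset.mul_sum, Pi.smul_apply, smul_eq_mul, map_mul]
  exact Finset.sum_congr rfl fun i _ => Finset.sum_congr rfl fun j _ => by ring

theorem herm_single_right (h : FormField s) (x u : Coord s) (m : Fin s ⊕ Fin s) :
    herm h x u (Pi.single m 1) = ∑ i, u i * h x i m := by
  simp only [herm, Pi.single_apply, apply_ite conj, map_one, map_zero, mul_ite, mul_one, mul_zero,
    Finset.sum_ite_eq', Finset.mem_univ, if_true]
  exact Finset.sum_congr rfl fun i _ => mul_comm _ _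

theorem herm_single_left (h : FormField s) (x v : Coord s) (m : Fin s ⊕ Fin s) :
    herm h x (Pi.single m 1) v = ∑ j, h x m j * conj (v j) := by
  simp [herm, Pi.single_apply, ite_mul]

theorem herm_single (h : FormField s) (x : Coord s) (k l : Fin s ⊕ Fin s) :
    herm h x (Pi.single k 1) (Pi.single l 1) = h x k l := by
  rw [herm_single_right]; simp [Pi.single_apply]

theorem fundForm_eq (h : FormField s) (x u v : Coord s) :
    fundForm h x u v = -2 * (herm h x u v).im := rfl

theorem metric_eq (h : FormField s) (x u v : Coord s) :
    metric h x u v = 2 * (herm h x u v).re := by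
  rw [metric, fundForm_eq, herm_smul_right]
  simp

theorem fundForm_smul_I (h : FormField s) (x u v : Coord s) :
    fundForm h x u (I • v) = 2 * (herm h x u v).re := metric_eq h x u v

theorem fundForm_single (h : FormField s) (x : Coord s) (k l : Fin s ⊕ Fin s) :
    fundForm h x (Pi.single k 1) (Pi.single l 1) = -2 * (h x k l).im := by
  rw [fundForm_eq, herm_single]

theorem fundForm_single_I (h : FormField s) (x : Coord s) (k l : Fin s ⊕ Fin s) :
    fundForm h x (Pi.single k 1) (I • Pi.single l 1) = 2 * (h x k l).re := by
  rw [fundForm_smul_I, herm_single]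

/-- The coefficient of `dxᵏ` in the connection form of the canonical bundle. -/
noncomputable def traceHol (h : FormField s) (k : Fin s ⊕ Fin s) (x : Coord s) : ℂ :=
  ∑ i, ∑ m, (h x)⁻¹ m i * dz i (fun y => h y k m) x

/-- The coefficient of `dx̄ᵏ` in the connection form of the canonical bundle. -/
noncomputable def traceAnti (h : FormField s) (k : Fin s ⊕ Fin s) (x : Coord s) : ℂ :=
  ∑ i, ∑ m, (h x)⁻¹ m i * (dzbar k (fun y => h y i m) x - dzbar m (fun y => h y i k) x)

/-- The component of the Ricci form of the Bismut connection on `dxˡ ∧ dx̄ᵏ`. -/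
noncomputable def ricciCoeff (h : FormField s) (l k : Fin s ⊕ Fin s) (x : Coord s) : ℂ :=
  dz l (traceAnti h k) x - dzbar k (traceHol h l) x

/-- The `dxᵏ` part of the connection matrix. -/
noncomputable def connHol (Γ : Christoffel s) (x : Coord s) (k a i : Fin s ⊕ Fin s) : ℂ :=
  holPart k fun u => Γ x u (Pi.single i 1) a

/-- The `dx̄ᵏ` part of the connection matrix. -/
noncomputable def connAnti (Γ : Christoffel s) (x : Coord s) (k a i : Fin s ⊕ Fin s) : ℂ :=
  antiPart k fun u => Γ x u (Pi.single i 1) a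

/-- A real-trilinear identity in `a, b, c` is tested on the real basis `1, I` of each factor, and
its component of type `a b c̄` is isolated. The coefficient `q3` of `ā c b̄` contributes through its
conjugate, because only real parts are compared. Applied to the torsion, this is the (2,1) part of
skew-symmetry. -/
theorem trilinear_type {p1 q1 p2 q2 p3 q3 p4 q4 : ℂ}
    (H : ∀ a ∈ ({1, I} : Set ℂ), ∀ b ∈ ({1, I} : Set ℂ), ∀ c ∈ ({1, I} : Set ℂ),
      ((a * p1 + conj a * q1) * b * conj c - (b * p2 + conj b * q2) * a * conj c).re
        = -((a * p3 + conj a * q3) * c * conj b - (c * p4 + conj c * q4) * a * conj b).re) :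
    p1 - p2 + conj q3 = 0 := by
  have h1 : (1 : ℂ) ∈ ({1, I} : Set ℂ) := by simp
  have h2 : I ∈ ({1, I} : Set ℂ) := by simp
  have e1 := H 1 h1 1 h1 1 h1
  have e2 := H 1 h1 1 h1 I h2
  have e3 := H 1 h1 I h2 1 h1
  have e4 := H 1 h1 I h2 I h2
  have e5 := H I h2 1 h1 1 h1
  have e6 := H I h2 1 h1 I h2
  have e7 := H I h2 I h2 1 h1
  have e8 := H I h2 I h2 I h2
  simp at e1 e2 e3 e4 e5 e6 e7 e8
  apply Complex.ext <;> simp <;> linarith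

/-! ### The Bismut connection is determined by the metric. -/

section
variable {h : FormField s} {Γ : Christoffel s}

theorem conn_apply (Γ : Christoffel s) (x : Coord s) (k i a : Fin s ⊕ Fin s) (c : ℂ) :
    Γ x (Pi.single k c) (Pi.single i 1) a = c * connHol Γ x k a i + conj c * connAnti Γ x k a i := by
  have h1 : Γ x (Pi.single k c) (Pi.single i 1) a
      = c.re * Γ x (Pi.single k 1) (Pi.single i 1) a + c.im * Γ x (Pi.single k I) (Pi.single i 1) a := by
    rw [single_one_eq k c, map_add, map_smul, map_smul]; simp
  rw [h1, connHol, connAnti, holPart, antiPart]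
  apply Complex.ext <;> simp <;> ring

theorem IsBismutConnection.map_smul (hΓ : IsBismutConnection h Γ) {x : Coord s}
    (hx : x ∈ domain s) (u v : Coord s) (c : ℂ) : Γ x u (c • v) = c • Γ x u v := by
  have h1 : c • v = c.re • v + c.im • (I • v) := by
    ext i
    simp only [Pi.smul_apply, Pi.add_apply, smul_eq_mul, real_smul]
    conv_lhs => rw [← re_add_im c]
    ring
  rw [h1, map_add, _root_.map_smul, _root_.map_smul, hΓ.preserves_J x hx]
  ext i
  simp only [Pi.smul_apply, Pi.add_apply, smul_eq_mul, real_smul]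
  conv_rhs => rw [← re_add_im c]
  ring

theorem single_eq_smul (i : Fin s ⊕ Fin s) (b : ℂ) :
    (Pi.single i b : Coord s) = b • Pi.single i 1 := by
  rw [← Pi.single_smul]; simp

theorem IsBismutConnection.apply_single (hΓ : IsBismutConnection h Γ) {x : Coord s}
    (hx : x ∈ domain s) (k i a : Fin s ⊕ Fin s) (c b : ℂ) :
    Γ x (Pi.single k c) (Pi.single i b) a
      = (c * connHol Γ x k a i + conj c * connAnti Γ x k a i) * b := by
  rw [single_eq_smul i b, hΓ.map_smul hx, Pi.smul_apply, conn_apply, smul_eq_mul, mul_comm]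

theorem IsMetric.fderiv_metric (hh : IsMetric h) {x : Coord s} (hx : x ∈ domain s)
    (u v w : Coord s) : fderiv ℝ (fun y => metric h y v w) x u
      = 2 * (∑ i, ∑ j, fderiv ℝ (fun y => h y i j) x u * v i * conj (w j)).re := by
  have h1 : HasFDerivAt (fun y => ∑ i, ∑ j, h y i j * v i * conj (w j))
      (∑ i, ∑ j, (conj (w j)) • (v i) • fderiv ℝ (fun y => h y i j) x) x := by
    refine HasFDerivAt.fun_sum fun i _ => HasFDerivAt.fun_sum fun j _ => ?_
    exact (((hh.smooth i j).differentiableAt hx).hasFDerivAt.mul_const _).mul_const _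
  have h2 : HasFDerivAt (fun y => metric h y v w) (2 • reCLM.comp
      (∑ i, ∑ j, (conj (w j)) • (v i) • fderiv ℝ (fun y => h y i j) x)) x := by
    have := (reCLM.hasFDerivAt.comp x h1).const_smul 2
    refine this.congr_of_eventuallyEq (Filter.Eventually.of_forall fun y => ?_)
    simp [metric_eq, herm, -Fintype.sum_sum_type]
  have h3 : (∑ i, ∑ j, (conj (w j)) • (v i) • fderiv ℝ (fun y => h y i j) x) u
      = ∑ i, ∑ j, fderiv ℝ (fun y => h y i j) x u * v i * conj (w j) := by
    simp only [sum_apply, smul_apply, smul_eq_mul]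
    exact Finset.sum_congr rfl fun i _ => Finset.sum_congr rfl fun j _ => by ring
  rw [h2.fderiv, ← h3]
  simp only [smul_apply, ContinuousLinearMap.comp_apply, reCLM_apply, nsmul_eq_mul, Nat.cast_ofNat]

theorem IsBismutConnection.fderiv_apply (hΓ : IsBismutConnection h Γ) (hh : IsMetric h)
    {x : Coord s} (hx : x ∈ domain s) (u : Coord s) (i j : Fin s ⊕ Fin s) :
    fderiv ℝ (fun y => h y i j) x u
      = ∑ a, Γ x u (Pi.single i 1) a * h x a j
        + ∑ b, h x i b * conj (Γ x u (Pi.single j 1) b) := by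
  -- Compatibility is a statement about real parts; scaling one argument by `1` and by `I` recovers
  -- the complex identity.
  have key : ∀ c : ℂ, (c * fderiv ℝ (fun y => h y i j) x u).re
      = (c * (∑ a, Γ x u (Pi.single i 1) a * h x a j
        + ∑ b, h x i b * conj (Γ x u (Pi.single j 1) b))).re := by
    intro c
    have h1 := hΓ.preserves_metric x hx u (c • Pi.single i 1) (Pi.single j 1)
    rw [hh.fderiv_metric hx, metric_eq, metric_eq, hΓ.map_smul hx, herm_smul_left,
      herm_smul_left, herm_single_right, herm_single_left] at h1
    rw [mul_add, add_re]
    have h2 : ∑ i', ∑ j', fderiv ℝ (fun y => h y i' j') x u * (c • (Pi.single i 1 : Coord s)) i'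
        * conj ((Pi.single j 1 : Coord s) j') = c * fderiv ℝ (fun y => h y i j) x u := by
      simp [Pi.single_apply, apply_ite conj, mul_comm]
    rw [h2] at h1
    linarith
  have k1 := key 1
  have k2 := key I
  apply Complex.ext
  · rwa [one_mul, one_mul] at k1
  · rwa [I_mul_re, I_mul_re, neg_inj] at k2

/-- Compatibility expresses `∂ₖ h i m` as a (1,0) entry plus the conjugate of a (0,1) entry. The
(2,1) part of the torsion condition says that this sum equals the (1,0) entry with direction and
argument interchanged. -/
theorem IsBismutConnection.hol_mul (hΓ : IsBismutConnection h Γ) (hh : IsMetric h)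
    {x : Coord s} (hx : x ∈ domain s) (i k m : Fin s ⊕ Fin s) :
    ∑ a, connHol Γ x i a k * h x a m = dz k (fun y => h y i m) x := by
  have M : dz k (fun y => h y i m) x = ∑ a, connHol Γ x k a i * h x a m
      + ∑ b, h x i b * conj (connAnti Γ x k b m) := by
    rw [dz_eq, holPart_congr (hΓ.fderiv_apply hh hx · i m), holPart_add, holPart_sum, holPart_sum]
    congr 1
    · exact Finset.sum_congr rfl fun a _ => holPart_mul_const _ _ _
    · refine Finset.sum_congr rfl fun b _ => ?_
      rw [connAnti, conj_antiPart]
      simp only [mul_comm (h x i b)]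
      exact holPart_mul_const _ _ _
  have T := trilinear_type (p1 := ∑ a, connHol Γ x k a i * h x a m)
    (q1 := ∑ a, connAnti Γ x k a i * h x a m)
    (p2 := ∑ a, connHol Γ x i a k * h x a m) (q2 := ∑ a, connAnti Γ x i a k * h x a m)
    (p3 := ∑ a, connHol Γ x k a m * h x a i) (q3 := ∑ a, connAnti Γ x k a m * h x a i)
    (p4 := ∑ a, connHol Γ x m a k * h x a i) (q4 := ∑ a, connAnti Γ x m a k * h x a i) ?_
  · rw [M]
    have : conj (∑ a, connAnti Γ x k a m * h x a i)
        = ∑ b, h x i b * conj (connAnti Γ x k b m) := by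
      rw [map_sum]
      refine Finset.sum_congr rfl fun b _ => ?_
      rw [map_mul, hh.conj_apply hx, mul_comm]
    rw [this] at T
    linear_combination -T
  · intro a _ b _ c _
    have h1 := hΓ.torsion_alternating x hx (Pi.single k a) (Pi.single i b) (Pi.single m c)
    have h2 : ∀ (k i m : Fin s ⊕ Fin s) (a b c : ℂ),
        herm h x (Γ x (Pi.single k a) (Pi.single i b)) (Pi.single m c)
          = (a * ∑ e, connHol Γ x k e i * h x e m + conj a * ∑ e, connAnti Γ x k e i * h x e m)
            * b * conj c := by
      intro k i m a b c
      rw [single_eq_smul m c, herm_smul_right, herm_single_right]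
      simp only [hΓ.apply_single hx, Finset.mul_sum, Finset.sum_mul, ← Finset.sum_add_distrib]
      exact Finset.sum_congr rfl fun e _ => by ring
    rw [fundForm_smul_I, fundForm_smul_I, torsion, torsion, herm_sub_left, herm_sub_left,
      h2, h2, h2, h2] at h1
    linarith

/-- In the compatibility equation for `∂̄ₖ h i m` the other term is the conjugate of a (1,0) entry,
known from `hol_mul`; subtracting it leaves the (0,1) entry. -/
theorem IsBismutConnection.anti_mul (hΓ : IsBismutConnection h Γ) (hh : IsMetric h)
    {x : Coord s} (hx : x ∈ domain s) (k i m : Fin s ⊕ Fin s) :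
    ∑ a, connAnti Γ x k a i * h x a m
      = dzbar k (fun y => h y i m) x - dzbar m (fun y => h y i k) x := by
  have M : dzbar k (fun y => h y i m) x = ∑ a, connAnti Γ x k a i * h x a m
      + ∑ b, h x i b * conj (connHol Γ x k b m) := by
    rw [dzbar_eq, show (fderiv ℝ (fun y => h y i m) x : Coord s → ℂ) = _ from
      funext (hΓ.fderiv_apply hh hx · i m), antiPart_add, antiPart_sum, antiPart_sum]
    congr 1
    · exact Finset.sum_congr rfl fun a _ => antiPart_mul_const _ _ _
    · refine Finset.sum_congr rfl fun b _ => ?_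
      rw [connHol, conj_holPart]
      simp only [mul_comm (h x i b)]
      exact antiPart_mul_const _ _ _
  have : ∑ b, h x i b * conj (connHol Γ x k b m) = dzbar m (fun y => h y i k) x := by
    rw [← hh.conj_dz_apply hx, ← hΓ.hol_mul hh hx, map_sum]
    refine Finset.sum_congr rfl fun b _ => ?_
    rw [map_mul, hh.conj_apply hx, mul_comm]
  rw [M, this]; ring

/-- Recovers a trace from the matrix with lowered index, the form in which the connection is known.
-/
theorem sum_mul_inv {H : Matrix (Fin s ⊕ Fin s) (Fin s ⊕ Fin s) ℂ} (hH : IsUnit H.det)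
    (P : Fin s ⊕ Fin s → Fin s ⊕ Fin s → ℂ) :
    ∑ i, P i i = ∑ i, ∑ m, H⁻¹ m i * ∑ a, P a i * H a m := by
  refine Finset.sum_congr rfl fun i _ => ?_
  have h1 : ∑ m, H⁻¹ m i * ∑ a, P a i * H a m = ∑ a, P a i * (H * H⁻¹) a i := by
    simp only [Matrix.mul_apply, Finset.mul_sum]
    rw [Finset.sum_comm]
    exact Finset.sum_congr rfl fun a _ => Finset.sum_congr rfl fun m _ => by ring
  rw [h1, Matrix.mul_nonsing_inv _ hH]
  simp [Matrix.one_apply]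

theorem IsBismutConnection.trace_eq (hΓ : IsBismutConnection h Γ) (hh : IsMetric h)
    {x : Coord s} (hx : x ∈ domain s) (u : Coord s) :
    ∑ i, Γ x u (Pi.single i 1) i
      = ∑ k, (traceHol h k x * u k + traceAnti h k x * conj (u k)) := by
  have h1 : ∀ i, Γ x u (Pi.single i 1) i
      = ∑ k, (connHol Γ x k i i * u k + connAnti Γ x k i i * conj (u k)) := fun i =>
    apply_eq_sum_parts
      (((ContinuousLinearMap.proj (R := ℝ) (φ := fun _ : Fin s ⊕ Fin s => ℂ) i).comp
        ((Γ x).flip (Pi.single i 1))).toLinearMap) u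
  simp only [h1]
  rw [Finset.sum_comm]
  refine Finset.sum_congr rfl fun k _ => ?_
  rw [Finset.sum_add_distrib, ← Finset.sum_mul, ← Finset.sum_mul,
    sum_mul_inv (hh.isUnit_det hx) (connHol Γ x k), sum_mul_inv (hh.isUnit_det hx) (connAnti Γ x k)]
  simp only [hΓ.hol_mul hh hx, hΓ.anti_mul hh hx, traceHol, traceAnti]

theorem IsBismutConnection.apply_eq_sum (hΓ : IsBismutConnection h Γ) {x : Coord s}
    (hx : x ∈ domain s) (u v : Coord s) (a : Fin s ⊕ Fin s) :
    Γ x u v a = ∑ i, Γ x u (Pi.single i 1) a * v i := by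
  conv_lhs => rw [← Finset.univ_sum_single v, map_sum, Finset.sum_apply]
  refine Finset.sum_congr rfl fun i _ => ?_
  rw [single_eq_smul, hΓ.map_smul hx, Pi.smul_apply, smul_eq_mul, mul_comm]

/-- The quadratic part of the curvature is a commutator of complex-linear maps and has trace zero,
so only the trace of the connection matters. -/
theorem IsBismutConnection.trace_curvature (hΓ : IsBismutConnection h Γ) {x : Coord s}
    (hx : x ∈ domain s) (u v : Coord s) :
    ∑ i, curvature Γ x u v (Pi.single i 1) i
      = fderiv ℝ (fun y => ∑ i, Γ y v (Pi.single i 1) i) x u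
        - fderiv ℝ (fun y => ∑ i, Γ y u (Pi.single i 1) i) x v := by
  have hd : DifferentiableAt ℝ Γ x :=
    (hΓ.smooth.contDiffAt (domain_mem_nhds hx)).differentiableAt (by simp)
  have h1 : ∀ u v : Coord s, fderiv ℝ (fun y => ∑ i, Γ y v (Pi.single i 1) i) x u
      = ∑ i, fderiv ℝ Γ x u v (Pi.single i 1) i := by
    intro u v
    have e : ∀ i, DifferentiableAt ℝ (fun y => Γ y v (Pi.single i 1) i) x ∧
        fderiv ℝ (fun y => Γ y v (Pi.single i 1) i) x u = fderiv ℝ Γ x u v (Pi.single i 1) i := by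
      intro i
      have e1 := hasFDerivAt_pi'.1 ((hd.hasFDerivAt.clm_apply (hasFDerivAt_const v x)).clm_apply
        (hasFDerivAt_const (Pi.single i 1 : Coord s) x)) i
      exact ⟨e1.differentiableAt, by rw [e1.fderiv]; simp⟩
    rw [fderiv_fun_sum fun i _ => (e i).1, sum_apply]
    exact Finset.sum_congr rfl fun i _ => (e i).2
  have h2 : ∑ i, Γ x u (Γ x v (Pi.single i 1)) i = ∑ i, Γ x v (Γ x u (Pi.single i 1)) i := by
    simp only [hΓ.apply_eq_sum hx u (Γ x v _), hΓ.apply_eq_sum hx v (Γ x u _)]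
    rw [Finset.sum_comm]
    exact Finset.sum_congr rfl fun i _ => Finset.sum_congr rfl fun j _ => mul_comm _ _
  rw [h1, h1]
  simp only [curvature, Pi.add_apply, Pi.sub_apply, Finset.sum_add_distrib, Finset.sum_sub_distrib,
    h2]
  ring

end

end OT

namespace OT

open Complex

variable {s : ℕ}

/-! ### Smoothness of the inverse matrix -/

section
variable {ι : Type*} [Fintype ι] [DecidableEq ι]

theorem contDiff_det : ContDiff ℝ ∞ fun H : ι → ι → ℂ => (Matrix.of H).det := by
  simp only [Matrix.det_apply]
  refine ContDiff.sum fun σ _ => ContDiff.const_smul _ ?_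
  refine contDiff_prod fun i _ => ?_
  simp only [Matrix.of_apply]
  fun_prop

theorem contDiff_adjugate (m i : ι) :
    ContDiff ℝ ∞ fun H : ι → ι → ℂ => (Matrix.of H).adjugate m i := by
  simp only [Matrix.adjugate_apply]
  refine (contDiff_det (ι := ι)).comp (g := fun H : ι → ι → ℂ => (Matrix.of H).det)
    (f := fun H : ι → ι → ℂ => (Matrix.of H).updateRow i (Pi.single m 1)) ?_
  refine contDiff_pi.2 fun a => contDiff_pi.2 fun b => ?_
  by_cases h : a = i
  · subst h; simp only [Matrix.updateRow_self]; exact contDiff_const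
  · simp only [Matrix.updateRow_ne h, Matrix.of_apply]; fun_prop

/-- The entries of the inverse of a matrix. -/
noncomputable def invEntry (m i : ι) (H : ι → ι → ℂ) : ℂ := (Matrix.of H)⁻¹ m i

theorem contDiffOn_invEntry (m i : ι) :
    ContDiffOn ℝ ∞ (invEntry m i) {H : ι → ι → ℂ | (Matrix.of H).det ≠ 0} := by
  have : ∀ H : ι → ι → ℂ, invEntry m i H
      = ((Matrix.of H).det)⁻¹ * (Matrix.of H).adjugate m i := fun H => by
    simp [invEntry, Matrix.inv_def]
  rw [show (invEntry m i : (ι → ι → ℂ) → ℂ) = _ from funext this]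
  exact (contDiff_det.contDiffOn.inv fun H hH => hH).mul (contDiff_adjugate m i).contDiffOn

theorem isOpen_det_ne_zero : IsOpen {H : ι → ι → ℂ | (Matrix.of H).det ≠ 0} :=
  isOpen_ne_fun contDiff_det.continuous continuous_const

end

/-! ### The (1,1) part of the Ricci form in terms of the metric. -/

section
variable {h : FormField s} {Γ : Christoffel s}

theorem IsMetric.det_ne_zero (hh : IsMetric h) {x : Coord s} (hx : x ∈ domain s) :
    (h x).det ≠ 0 := (hh.isUnit_det hx).ne_zero

theorem IsMetric.smooth_inv (hh : IsMetric h) (m i : Fin s ⊕ Fin s) :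
    Smooth fun x => (h x)⁻¹ m i :=
  (contDiffOn_invEntry m i).comp (f := fun x a b => h x a b)
    (contDiffOn_pi.2 fun a => contDiffOn_pi.2 fun b => hh.smooth a b)
    fun _ hx => hh.det_ne_zero hx

theorem IsMetric.smooth_traceHol (hh : IsMetric h) (k : Fin s ⊕ Fin s) : Smooth (traceHol h k) :=
  Smooth.sum fun i _ => Smooth.sum fun m _ => (hh.smooth_inv m i).mul ((hh.smooth k m).dz i)

theorem IsMetric.smooth_traceAnti (hh : IsMetric h) (k : Fin s ⊕ Fin s) :
    Smooth (traceAnti h k) :=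
  Smooth.sum fun i _ => Smooth.sum fun m _ => (hh.smooth_inv m i).mul
    (((hh.smooth i m).dzbar k).sub ((hh.smooth i k).dzbar m))

/-- Averaging with `J` removes the (2,0) and (0,2) parts of the exterior derivative of the trace
form. What remains is `∂` of its (0,1) part and `∂̄` of its (1,0) part. -/
theorem IsBismutConnection.ricciForm11_eq (hΓ : IsBismutConnection h Γ) (hh : IsMetric h)
    {x : Coord s} (hx : x ∈ domain s) (u v : Coord s) :
    ricciForm11 Γ x u v
      = (I * ∑ l, ∑ k, ricciCoeff h l k x * (u l * conj (v k) - v l * conj (u k))).re := by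
  have h1 : ∀ u v : Coord s, fderiv ℝ (fun y => ∑ i, Γ y v (Pi.single i 1) i) x u
      = ∑ k, ∑ l, ((dz l (traceHol h k) x * u l + dzbar l (traceHol h k) x * conj (u l)) * v k
        + (dz l (traceAnti h k) x * u l + dzbar l (traceAnti h k) x * conj (u l))
          * conj (v k)) := by
    intro u v
    have d1 := fun k => (hh.smooth_traceHol k).differentiableAt hx
    have d2 := fun k => (hh.smooth_traceAnti k).differentiableAt hx
    rw [fderiv_congr (fun y hy => hΓ.trace_eq hh hy v) hx,
      fderiv_fun_sum fun k _ => ((d1 k).mul_const _).fun_add ((d2 k).mul_const _), sum_apply]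
    refine Finset.sum_congr rfl fun k _ => ?_
    rw [fderiv_fun_add ((d1 k).mul_const _) ((d2 k).mul_const _), fderiv_mul_const (d1 k),
      fderiv_mul_const (d2 k)]
    simp only [add_apply, smul_apply, smul_eq_mul]
    have a1 := apply_eq_sum_parts (fderiv ℝ (traceHol h k) x).toLinearMap u
    have a2 := apply_eq_sum_parts (fderiv ℝ (traceAnti h k) x).toLinearMap u
    simp only [ContinuousLinearMap.coe_coe] at a1 a2
    rw [a1, a2, Finset.mul_sum, Finset.mul_sum, ← Finset.sum_add_distrib]
    refine Finset.sum_congr rfl fun l _ => ?_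
    simp only [dz_eq, dzbar_eq]
    ring
  have h2 : ∑ l, ∑ k, ricciCoeff h l k x * (u l * conj (v k) - v l * conj (u k))
      = (1 / 2 : ℂ) * ((∑ i, curvature Γ x u v (Pi.single i 1) i)
        + ∑ i, curvature Γ x (I • u) (I • v) (Pi.single i 1) i) := by
    simp only [hΓ.trace_curvature hx, h1, ricciCoeff, Pi.smul_apply, smul_eq_mul, map_mul, conj_I]
    have e : ∑ l, ∑ k, (dz l (traceAnti h k) x - dzbar k (traceHol h l) x)
          * (u l * conj (v k) - v l * conj (u k))
        = ∑ k, ∑ l, (dz l (traceAnti h k) x * (u l * conj (v k) - v l * conj (u k))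
          - dzbar l (traceHol h k) x * (u k * conj (v l) - v k * conj (u l))) := by
      simp only [sub_mul, Finset.sum_sub_distrib]
      rw [Finset.sum_comm]
    rw [e]
    simp only [← Finset.sum_sub_distrib, ← Finset.sum_add_distrib, Finset.mul_sum]
    refine Finset.sum_congr rfl fun k _ => Finset.sum_congr rfl fun l _ => ?_
    ring_nf
    simp only [I_sq]
    ring
  rw [h2, ricciForm11, ricciForm, ricciForm, ← mul_left_comm, mul_add I]
  simp [-Fintype.sum_sum_type]

/-! ### Existence of the Bismut connection -/

/-- The `dxᵏ` part of the connection matrix of the Bismut connection. -/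
noncomputable def bismutHol (h : FormField s) (x : Coord s) (k a i : Fin s ⊕ Fin s) : ℂ :=
  ∑ m, (h x)⁻¹ m a * dz i (fun y => h y k m) x

/-- The `dx̄ᵏ` part of the connection matrix of the Bismut connection. -/
noncomputable def bismutAnti (h : FormField s) (x : Coord s) (k a i : Fin s ⊕ Fin s) : ℂ :=
  ∑ m, (h x)⁻¹ m a * (dzbar k (fun y => h y i m) x - dzbar m (fun y => h y i k) x)

/-- The covariant derivative of the Bismut connection on constant vector fields. -/
noncomputable def bismutFun (h : FormField s) (x u v : Coord s) : Coord s := fun a =>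
  ∑ k, ∑ i, (bismutHol h x k a i * u k + bismutAnti h x k a i * conj (u k)) * v i

/-- The Bismut connection of a Hermitian metric. -/
noncomputable def bismut (h : FormField s) : Christoffel s := fun x =>
  LinearMap.toContinuousBilinearMap <| LinearMap.mk₂ ℝ (bismutFun h x)
      (fun u u' v => by
        ext a
        simp only [bismutFun, Pi.add_apply, map_add, ← Finset.sum_add_distrib]
        exact Finset.sum_congr rfl fun i _ => Finset.sum_congr rfl fun j _ => by ring)
      (fun r u v => by
        ext a
        simp only [bismutFun, Pi.smul_apply, real_smul, map_mul, conj_ofReal, Finset.mul_sum]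
        exact Finset.sum_congr rfl fun i _ => Finset.sum_congr rfl fun j _ => by ring)
      (fun u v v' => by
        ext a
        simp only [bismutFun, Pi.add_apply, ← Finset.sum_add_distrib]
        exact Finset.sum_congr rfl fun i _ => Finset.sum_congr rfl fun j _ => by ring)
      (fun r u v => by
        ext a
        simp only [bismutFun, Pi.smul_apply, real_smul, Finset.mul_sum]
        exact Finset.sum_congr rfl fun i _ => Finset.sum_congr rfl fun j _ => by ring)

theorem bismut_apply (h : FormField s) (x u v : Coord s) :
    bismut h x u v = bismutFun h x u v := rfl

theorem mul_sum_inv {H : Matrix (Fin s ⊕ Fin s) (Fin s ⊕ Fin s) ℂ} (hH : IsUnit H.det)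
    (X : Fin s ⊕ Fin s → ℂ) (j : Fin s ⊕ Fin s) :
    ∑ a, (∑ m, H⁻¹ m a * X m) * H a j = X j := by
  have : ∑ a, (∑ m, H⁻¹ m a * X m) * H a j = ∑ m, X m * (H⁻¹ * H) m j := by
    simp only [Matrix.mul_apply, Finset.mul_sum, Finset.sum_mul]
    rw [Finset.sum_comm]
    exact Finset.sum_congr rfl fun a _ => Finset.sum_congr rfl fun m _ => by ring
  rw [this, Matrix.nonsing_inv_mul _ hH]
  simp [Matrix.one_apply]

/-- The derivative of the metric in the direction `v`, evaluated on `u` and `w`, of type `(1,0)`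
in the direction. -/
noncomputable def dzMetric (h : FormField s) (x u v w : Coord s) : ℂ :=
  ∑ k, ∑ i, ∑ j, dz i (fun y => h y k j) x * u k * v i * conj (w j)

/-- The derivative of the metric in the direction `u`, evaluated on `v` and `w`, of type `(0,1)`
in the direction. -/
noncomputable def dzbarMetric (h : FormField s) (x u v w : Coord s) : ℂ :=
  ∑ k, ∑ i, ∑ j, dzbar k (fun y => h y i j) x * conj (u k) * v i * conj (w j)

/-- Conjugation exchanges `∂` and `∂̄` of a Hermitian form. On real parts, compatibility with the
metric and skew-symmetry of the torsion thereby become linear identities between values of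
`dzMetric`. -/
theorem IsMetric.re_dzbarMetric (hh : IsMetric h) {x : Coord s} (hx : x ∈ domain s)
    (u v w : Coord s) : (dzbarMetric h x u v w).re = (dzMetric h x w u v).re := by
  have : dzbarMetric h x u v w = conj (dzMetric h x w u v) := by
    simp only [dzMetric, dzbarMetric, map_sum, map_mul, conj_conj, hh.conj_dz_apply hx]
    conv_rhs =>
      rw [Finset.sum_comm]
      enter [2, k]
      rw [Finset.sum_comm]
    exact Finset.sum_congr rfl fun i _ => Finset.sum_congr rfl fun j _ =>
      Finset.sum_congr rfl fun k _ => by ring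
  rw [this, conj_re]

/-- Lowering the index cancels the inverse metric in the definition of the connection, so that only
first derivatives of `h` are left. -/
theorem IsMetric.herm_bismut (hh : IsMetric h) {x : Coord s} (hx : x ∈ domain s)
    (u v w : Coord s) : herm h x (bismut h x u v) w
      = dzMetric h x u v w + dzbarMetric h x u v w - dzbarMetric h x w v u := by
  have e : herm h x (bismut h x u v) w = ∑ k, ∑ i, ∑ j,
      ((∑ a, bismutHol h x k a i * h x a j) * u k
        + (∑ a, bismutAnti h x k a i * h x a j) * conj (u k)) * v i * conj (w j) := by
    simp only [herm, bismut_apply, bismutFun, Finset.mul_sum, Finset.sum_mul,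
      ← Finset.sum_add_distrib]
    rw [Finset.sum_comm]
    conv_lhs =>
      enter [2, j]
      rw [Finset.sum_comm]
      enter [2, k]
      rw [Finset.sum_comm]
    rw [Finset.sum_comm]
    conv_lhs =>
      enter [2, k]
      rw [Finset.sum_comm]
    exact Finset.sum_congr rfl fun i _ => Finset.sum_congr rfl fun j _ =>
      Finset.sum_congr rfl fun k _ => Finset.sum_congr rfl fun a _ => by ring
  have e3 : dzbarMetric h x w v u = ∑ k, ∑ i, ∑ j,
      dzbar j (fun y => h y i k) x * conj (u k) * v i * conj (w j) := by
    rw [dzbarMetric]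
    conv_lhs =>
      enter [2, j]
      rw [Finset.sum_comm]
    rw [Finset.sum_comm]
    conv_lhs =>
      enter [2, k]
      rw [Finset.sum_comm]
    exact Finset.sum_congr rfl fun i _ => Finset.sum_congr rfl fun j _ =>
      Finset.sum_congr rfl fun k _ => by ring
  rw [e, e3]
  simp only [bismutHol, bismutAnti, mul_sum_inv (hh.isUnit_det hx), dzMetric, dzbarMetric,
    ← Finset.sum_add_distrib, ← Finset.sum_sub_distrib]
  exact Finset.sum_congr rfl fun i _ => Finset.sum_congr rfl fun j _ =>
    Finset.sum_congr rfl fun k _ => by ring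

theorem IsMetric.fderiv_metric_eq (hh : IsMetric h) {x : Coord s} (hx : x ∈ domain s)
    (u v w : Coord s) : fderiv ℝ (fun y => metric h y v w) x u
      = 2 * (dzMetric h x v u w + dzbarMetric h x u v w).re := by
  rw [hh.fderiv_metric hx]
  congr 2
  have e2 : dzMetric h x v u w = ∑ k, ∑ i, ∑ j,
      dz k (fun y => h y i j) x * v i * u k * conj (w j) := by
    rw [dzMetric, Finset.sum_comm]
  rw [e2, dzbarMetric]
  simp only [← Finset.sum_add_distrib]
  conv_rhs =>
    rw [Finset.sum_comm]
    enter [2, i]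
    rw [Finset.sum_comm]
  refine Finset.sum_congr rfl fun i _ => Finset.sum_congr rfl fun j _ => ?_
  have a1 := apply_eq_sum_parts (fderiv ℝ (fun y => h y i j) x).toLinearMap u
  simp only [ContinuousLinearMap.coe_coe] at a1
  rw [a1, Finset.sum_mul, Finset.sum_mul]
  refine Finset.sum_congr rfl fun k _ => ?_
  simp only [dz_eq, dzbar_eq]
  ring

theorem herm_conj (hh : IsMetric h) {x : Coord s} (hx : x ∈ domain s) (u v : Coord s) :
    herm h x v u = conj (herm h x u v) := by
  simp only [herm, map_sum, map_mul, conj_conj, hh.conj_apply hx]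
  rw [Finset.sum_comm]
  exact Finset.sum_congr rfl fun i _ => Finset.sum_congr rfl fun j _ => by ring

theorem IsMetric.isBismutConnection (hh : IsMetric h) : IsBismutConnection h (bismut h) where
  smooth := by
    refine contDiffOn_clm_apply.2 fun u => contDiffOn_clm_apply.2 fun v =>
      contDiffOn_pi.2 fun a => ?_
    change Smooth fun x => bismutFun h x u v a
    refine Smooth.sum fun k _ => Smooth.sum fun i _ => Smooth.mul (Smooth.add
      (Smooth.mul ?_ (Smooth.const _)) (Smooth.mul ?_ (Smooth.const _))) (Smooth.const _)
    · exact Smooth.sum fun m _ => (hh.smooth_inv m a).mul ((hh.smooth k m).dz i)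
    · exact Smooth.sum fun m _ => (hh.smooth_inv m a).mul
        (((hh.smooth i m).dzbar k).sub ((hh.smooth i k).dzbar m))
  preserves_metric x hx u v w := by
    rw [hh.fderiv_metric_eq hx, metric_eq, metric_eq, herm_conj hh hx (bismut h x u w), conj_re,
      hh.herm_bismut hx, hh.herm_bismut hx]
    simp only [add_re, sub_re, hh.re_dzbarMetric hx]
    ring
  preserves_J x _ u v := by
    ext a
    simp only [bismut_apply, bismutFun, Pi.smul_apply, smul_eq_mul, Finset.mul_sum]
    exact Finset.sum_congr rfl fun i _ => Finset.sum_congr rfl fun j _ => by ring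
  torsion_alternating x hx u v w := by
    rw [fundForm_smul_I, fundForm_smul_I, torsion, torsion, herm_sub_left, herm_sub_left,
      hh.herm_bismut hx, hh.herm_bismut hx, hh.herm_bismut hx, hh.herm_bismut hx]
    simp only [add_re, sub_re, hh.re_dzbarMetric hx]
    ring

end

end OT

namespace OT

open Complex

variable {s : ℕ}

/-! ### The flow as a parabolic system -/

section
variable {h : FormField s}

/-- The terms of the Ricci form of the Bismut connection that depend on the metric and its first
derivatives. -/
noncomputable def lowerOrder (l k : Fin s ⊕ Fin s) (H : Fin s ⊕ Fin s → Fin s ⊕ Fin s → ℂ)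
    (p : Fin s ⊕ Fin s → Fin s ⊕ Fin s → Coord s →L[ℝ] ℂ) : ℂ :=
  ∑ i, ∑ m, (holPart l (fun u => fderiv ℝ (invEntry m i) H fun a b => p a b u)
      * (antiPart k (p i m) - antiPart m (p i k))
    - antiPart k (fun u => fderiv ℝ (invEntry m i) H fun a b => p a b u) * holPart i (p l m))

/-- The second order operator `∑ gⁱᵐ ∂ᵢ∂̄ₘ`. -/
noncomputable def leviTrace (H : Matrix (Fin s ⊕ Fin s) (Fin s ⊕ Fin s) ℂ)
    (S : Coord s →L[ℝ] Coord s →L[ℝ] ℂ) : ℂ :=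
  ∑ i, ∑ m, H⁻¹ m i * levi i m S

theorem IsMetric.fderiv_inv (hh : IsMetric h) {x : Coord s} (hx : x ∈ domain s)
    (m i : Fin s ⊕ Fin s) (u : Coord s) :
    fderiv ℝ (fun y => (h y)⁻¹ m i) x u
      = fderiv ℝ (invEntry m i) (h x) fun a b => fderiv ℝ (fun y => h y a b) x u := by
  have h1 : HasFDerivAt (fun y a b => h y a b)
      (ContinuousLinearMap.pi fun a => ContinuousLinearMap.pi fun b =>
        fderiv ℝ (fun y => h y a b) x) x :=
    hasFDerivAt_pi.2 fun a => hasFDerivAt_pi.2 fun b =>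
      ((hh.smooth a b).differentiableAt hx).hasFDerivAt
  have h2 : DifferentiableAt ℝ (invEntry m i) (fun a b => h x a b) :=
    ((contDiffOn_invEntry m i).contDiffAt
      (isOpen_det_ne_zero.mem_nhds (hh.det_ne_zero hx))).differentiableAt (by simp)
  have h3 := h2.hasFDerivAt.comp x h1
  have h4 : fderiv ℝ (fun y => (h y)⁻¹ m i) x = _ := h3.fderiv
  rw [h4]
  rfl

/-- Ellipticity comes from pluriclosedness: the three kinds of second derivatives in `ricciCoeff`
are, after contraction with the inverse metric, three of the four terms of `∂∂̄ω = 0`, and the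
fourth is the Levi trace of one entry. -/
theorem IsMetric.ricciCoeff_eq (hh : IsMetric h) (hp : IsPluriclosed h) {x : Coord s}
    (hx : x ∈ domain s) (l k : Fin s ⊕ Fin s) :
    ricciCoeff h l k x = lowerOrder l k (h x) (fun a b => fderiv ℝ (fun y => h y a b) x)
      - leviTrace (h x) (fderiv ℝ (fderiv ℝ fun y => h y l k) x) := by
  have hG := fun m i => (hh.smooth_inv m i).differentiableAt hx
  have e1 : dz l (traceAnti h k) x = ∑ i, ∑ m, (dz l (fun y => (h y)⁻¹ m i) x
      * (dzbar k (fun y => h y i m) x - dzbar m (fun y => h y i k) x)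
      + (h x)⁻¹ m i * (dz l (dzbar k (fun y => h y i m)) x
        - dz l (dzbar m (fun y => h y i k)) x)) := by
    have d := fun i m => ((hh.smooth i m).dzbar k).differentiableAt hx
    have d' := fun i m => ((hh.smooth i k).dzbar m).differentiableAt hx
    rw [show traceAnti h k = fun y => ∑ i, ∑ m, (h y)⁻¹ m i
      * (dzbar k (fun y => h y i m) y - dzbar m (fun y => h y i k) y) from rfl,
      dz_sum l fun i _ => DifferentiableAt.fun_sum fun m _ =>
        (hG m i).fun_mul ((d i m).fun_sub (d' i m))]
    refine Finset.sum_congr rfl fun i _ => ?_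
    rw [dz_sum l fun m _ => (hG m i).fun_mul ((d i m).fun_sub (d' i m))]
    refine Finset.sum_congr rfl fun m _ => ?_
    rw [dz_mul l (hG m i) ((d i m).fun_sub (d' i m)), dz_sub l (d i m) (d' i m)]
  have e2 : dzbar k (traceHol h l) x = ∑ i, ∑ m, (dzbar k (fun y => (h y)⁻¹ m i) x
      * dz i (fun y => h y l m) x + (h x)⁻¹ m i * dz i (dzbar k (fun y => h y l m)) x) := by
    have d := fun i m => ((hh.smooth l m).dz i).differentiableAt hx
    rw [show traceHol h l = fun y => ∑ i, ∑ m, (h y)⁻¹ m i * dz i (fun y => h y l m) y from rfl,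
      dzbar_sum k fun i _ => DifferentiableAt.fun_sum fun m _ => (hG m i).fun_mul (d i m)]
    refine Finset.sum_congr rfl fun i _ => ?_
    rw [dzbar_sum k fun m _ => (hG m i).fun_mul (d i m)]
    refine Finset.sum_congr rfl fun m _ => ?_
    rw [dzbar_mul k (hG m i) (d i m), dzbar_dz (hh.smooth l m) hx]
  rw [ricciCoeff, e1, e2]
  unfold lowerOrder leviTrace
  simp only [← Finset.sum_sub_distrib]
  refine Finset.sum_congr rfl fun i _ => Finset.sum_congr rfl fun m _ => ?_
  -- The indices are chosen so that the fourth term is `∂ᵢ∂̄ₘ h l k`, to be contracted with `h⁻¹ m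
  -- i`.
  have e3 := hp x hx i m l k
  rw [dz_eq l (fun y => (h y)⁻¹ m i), dzbar_eq k (fun y => (h y)⁻¹ m i),
    show (fderiv ℝ (fun y => (h y)⁻¹ m i) x : Coord s → ℂ) = _ from
      funext (hh.fderiv_inv hx m i), ← dz_dzbar (hh.smooth l k) hx]
  simp only [dz_eq _ (fun y => h y _ _), dzbar_eq _ (fun y => h y _ _)] at *
  linear_combination (h x)⁻¹ m i * e3

theorem sum_single_mul (R : Fin s ⊕ Fin s → Fin s ⊕ Fin s → ℂ) (k l : Fin s ⊕ Fin s) (a : ℂ) :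
    ∑ l', ∑ k', R l' k' * ((Pi.single k 1 : Coord s) l' * conj ((Pi.single l a : Coord s) k')
      - (Pi.single l a : Coord s) l' * conj ((Pi.single k 1 : Coord s) k'))
      = R k l * conj a - R l k * a := by
  simp [Pi.single_apply, mul_sub, Finset.sum_sub_distrib, apply_ite conj, -Fintype.sum_sum_type]

theorem re_im_hasDerivWithinAt {f : ℝ → ℂ} {f' : ℂ} {I : Set ℝ} {t : ℝ}
    (h1 : HasDerivWithinAt (fun t => (f t).re) f'.re I t)
    (h2 : HasDerivWithinAt (fun t => (f t).im) f'.im I t) : HasDerivWithinAt f f' I t := by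
  have := h1.ofReal_comp.add (h2.ofReal_comp.mul_const Complex.I)
  rw [re_add_im] at this
  exact this.congr_of_eventuallyEq (Filter.Eventually.of_forall fun t => (re_add_im _).symm)
    (re_add_im _).symm

/-- The pairs `(eₖ, eₗ)` and `(eₖ, √-1 eₗ)` read off the imaginary and real parts of an entry. A
real form detects only the Hermitian part of `ricciCoeff`, hence the symmetrization. -/
theorem hasDerivWithinAt_of_fundForm {h : ℝ → FormField s} {I : Set ℝ} {t : ℝ}
    {Γ : Christoffel s} (hh : IsMetric (h t)) (hΓ : IsBismutConnection (h t) Γ) {x : Coord s}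
    (hx : x ∈ domain s)
    (hd : ∀ u v, HasDerivWithinAt (fun t' => fundForm (h t') x u v) (-ricciForm11 Γ x u v) I t)
    (k l : Fin s ⊕ Fin s) :
    HasDerivWithinAt (fun t' => h t' x k l)
      (-(1 / 2) * (ricciCoeff (h t) k l x + conj (ricciCoeff (h t) l k x))) I t := by
  have d1 := hd (Pi.single k 1) (Complex.I • Pi.single l 1)
  have d2 := hd (Pi.single k 1) (Pi.single l 1)
  simp only [fundForm_single_I] at d1
  simp only [fundForm_single] at d2
  rw [hΓ.ricciForm11_eq hh hx, ← single_eq_smul, sum_single_mul] at d1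
  rw [hΓ.ricciForm11_eq hh hx, sum_single_mul] at d2
  refine re_im_hasDerivWithinAt ?_ ?_
  · have := d1.const_mul (1 / 2)
    refine (this.congr_deriv ?_).congr_of_eventuallyEq (Filter.Eventually.of_forall fun t => ?_) ?_
    · simp; ring
    · simp
    · simp
  · have := d2.const_mul (-1 / 2)
    refine (this.congr_deriv ?_).congr_of_eventuallyEq (Filter.Eventually.of_forall fun t => ?_) ?_
    · simp; ring
    · ring
    · ring

/-- The converse passage, for coefficients already known to be Hermitian; it serves to verify the
explicit solution. -/
theorem fundForm_hasDerivWithinAt {h : ℝ → FormField s} {I : Set ℝ} {t : ℝ}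
    {Γ : Christoffel s} (hh : IsMetric (h t)) (hΓ : IsBismutConnection (h t) Γ) {x : Coord s}
    (hx : x ∈ domain s) (hR : ∀ k l, conj (ricciCoeff (h t) k l x) = ricciCoeff (h t) l k x)
    (hd : ∀ k l, HasDerivWithinAt (fun t' => h t' x k l) (-ricciCoeff (h t) k l x) I t)
    (u v : Coord s) :
    HasDerivWithinAt (fun t' => fundForm (h t') x u v) (-ricciForm11 Γ x u v) I t := by
  have h1 : HasDerivWithinAt (fun t' => herm (h t') x u v)
      (-∑ i, ∑ j, ricciCoeff (h t) i j x * u i * conj (v j)) I t := by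
    simp only [← Finset.sum_neg_distrib, ← neg_mul]
    exact HasDerivWithinAt.fun_sum fun i _ => HasDerivWithinAt.fun_sum fun j _ =>
      ((hd i j).mul_const _).mul_const _
  have h2 : HasDerivWithinAt (fun t' => (herm (h t') x u v).im)
      (-∑ i, ∑ j, ricciCoeff (h t) i j x * u i * conj (v j)).im I t :=
    (imCLM.hasFDerivAt.comp_hasDerivWithinAt t h1)
  have h3 := h2.const_mul (-2)
  refine h3.congr_deriv ?_
  have e : ∑ l, ∑ k, ricciCoeff (h t) l k x * (u l * conj (v k) - v l * conj (u k))
      = (∑ i, ∑ j, ricciCoeff (h t) i j x * u i * conj (v j))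
        - conj (∑ i, ∑ j, ricciCoeff (h t) i j x * u i * conj (v j)) := by
    simp only [map_sum, map_mul, conj_conj, hR]
    rw [Finset.sum_comm (f := fun i j => ricciCoeff (h t) j i x * conj (u i) * v j)]
    simp only [← Finset.sum_sub_distrib]
    exact Finset.sum_congr rfl fun i _ => Finset.sum_congr rfl fun j _ => by ring
  rw [hΓ.ricciForm11_eq hh hx, e, I_mul_re, sub_im, conj_im, neg_im]
  ring

end

/-! ### Parabolic maximum principle -/

/-- A positive maximum of `e^(-(C+1)t) f` over `[0, t₀] × D` occurs at some `t > 0` and forces `f' ≥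
(C+1) f` there, against `f' ≤ C f`. Because every value on `Ω` is taken on `D`, the point is also a
spatial maximum over all of `Ω`. -/
theorem le_zero_of_deriv_le_at_max {α : Type*} [TopologicalSpace α] {D Ω : Set α}
    (hD : IsCompact D) {f : ℝ → α → ℝ} {t₀ : ℝ}
    (horb : ∀ t ∈ Set.Icc 0 t₀, ∀ x ∈ Ω, ∃ y ∈ D, f t y = f t x)
    (hcont : ContinuousOn (fun q : ℝ × α => f q.1 q.2) (Set.Icc 0 t₀ ×ˢ D))
    (h0 : ∀ x ∈ D, f 0 x = 0) (C : ℝ)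
    (hder : ∀ t ∈ Set.Ioc 0 t₀, ∀ x ∈ D, (∀ y ∈ Ω, f t y ≤ f t x) →
      ∃ f', HasDerivWithinAt (fun t => f t x) f' (Set.Icc 0 t₀) t ∧ f' ≤ C * f t x) :
    ∀ t ∈ Set.Icc 0 t₀, ∀ x ∈ Ω, f t x ≤ 0 := by
  by_contra! hcon
  obtain ⟨t₂, ht₂, x₂', hx₂', hpos'⟩ := hcon
  obtain ⟨x₂, hx₂, hxx⟩ := horb t₂ ht₂ x₂' hx₂'
  have hpos : 0 < f t₂ x₂ := hxx ▸ hpos'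
  obtain ⟨⟨t, x⟩, ⟨ht, hx⟩, hmax⟩ := (isCompact_Icc.prod hD).exists_isMaxOn
    (f := fun q : ℝ × α => Real.exp (-(C + 1) * q.1) * f q.1 q.2) ⟨(t₂, x₂), ht₂, hx₂⟩
    ((by fun_prop : Continuous fun q : ℝ × α =>
      Real.exp (-(C + 1) * q.1)).continuousOn.mul hcont)
  simp only [] at ht hx
  have hm : ∀ t' ∈ Set.Icc 0 t₀, ∀ x' ∈ D,
      Real.exp (-(C + 1) * t') * f t' x' ≤ Real.exp (-(C + 1) * t) * f t x :=
    fun t' ht' x' hx' => hmax (Set.mk_mem_prod ht' hx')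
  have hft : 0 < f t x := by
    have := (mul_pos (Real.exp_pos (-(C + 1) * t₂)) hpos).trans_le (hm t₂ ht₂ x₂ hx₂)
    exact (mul_pos_iff_of_pos_left (Real.exp_pos _)).1 this
  have ht0 : 0 < t := by
    rcases ht.1.lt_or_eq with h | h
    · exact h
    · rw [← h, h0 x hx] at hft; exact absurd hft (lt_irrefl _)
  obtain ⟨f', hf', hle⟩ := hder t ⟨ht0, ht.2⟩ x hx fun y hy => by
    obtain ⟨y', hy', e⟩ := horb t ht y hy
    rw [← e]
    exact le_of_mul_le_mul_left (hm t ht y' hy') (Real.exp_pos _)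
  have hexp : HasDerivWithinAt (fun t => Real.exp (-(C + 1) * t))
      (Real.exp (-(C + 1) * t) * (-(C + 1) * 1)) (Set.Icc 0 t₀) t :=
    (((hasDerivAt_id t).const_mul (-(C + 1))).exp).hasDerivWithinAt
  have hg := hexp.mul hf'
  -- The direction `0 - t` points back into the interval, so the one-sided condition is available
  -- also at the endpoint `t = t₀`.
  have hneg := IsLocalMaxOn.hasFDerivWithinAt_nonpos
    (f := fun t => Real.exp (-(C + 1) * t) * f t x) (s := Set.Icc 0 t₀) (a := t)
    (Filter.eventually_of_mem self_mem_nhdsWithin fun t' ht' => hm t' ht' x hx)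
    hg.hasFDerivWithinAt (y := 0 - t) (sub_mem_posTangentConeAt_of_segment_subset
      ((convex_Icc 0 t₀).segment_subset ht ⟨le_rfl, ht.1.trans ht.2⟩))
  simp only [ContinuousLinearMap.toSpanSingleton_apply, smul_eq_mul] at hneg
  have e := Real.exp_pos (-(C + 1) * t)
  nlinarith [mul_pos e ht0, mul_pos (mul_pos e ht0) hft,
    mul_le_mul_of_nonneg_left hle (mul_pos e ht0).le]

/-- At a maximum of `∑ ‖γⱼ‖²`, the second derivative test. -/
theorem sum_inner_le_of_isLocalMax {J : Type*} [Fintype J] {γ γ₁ : J → ℝ → ℂ} {γ₂ : J → ℂ}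
    (h1 : ∀ j, ∀ᶠ r in nhds 0, HasDerivAt (γ j) (γ₁ j r) r)
    (h2 : ∀ j, HasDerivAt (γ₁ j) (γ₂ j) 0)
    (hmax : IsLocalMax (fun r => ∑ j, ‖γ j r‖ ^ 2) 0) :
    ∑ j, inner ℝ (γ j 0) (γ₂ j) ≤ -∑ j, ‖γ₁ j 0‖ ^ 2 := by
  have d1 : ∀ᶠ r in nhds (0 : ℝ), HasDerivAt (fun r => ∑ j, ‖γ j r‖ ^ 2)
      (∑ j, 2 * inner ℝ (γ j r) (γ₁ j r)) r := by
    filter_upwards [Filter.eventually_all.2 h1] with r hr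
    exact HasDerivAt.fun_sum fun j _ => (hr j).norm_sq
  have d2 : HasDerivAt (fun r => ∑ j, 2 * inner ℝ (γ j r) (γ₁ j r))
      (∑ j, 2 * (inner ℝ (γ j 0) (γ₂ j) + inner ℝ (γ₁ j 0) (γ₁ j 0))) 0 :=
    HasDerivAt.fun_sum fun j _ => ((((h1 j).self_of_nhds).inner ℝ (h2 j)).const_mul 2)
  have d3 : deriv (deriv fun r => ∑ j, ‖γ j r‖ ^ 2) 0
      = ∑ j, 2 * (inner ℝ (γ j 0) (γ₂ j) + inner ℝ (γ₁ j 0) (γ₁ j 0)) := by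
    rw [← d2.deriv]
    exact Filter.EventuallyEq.deriv_eq (d1.mono fun r hr => hr.deriv)
  have d4 : deriv (fun r => ∑ j, ‖γ j r‖ ^ 2) 0 = 0 := hmax.deriv_eq_zero
  have d5 : deriv (deriv fun r => ∑ j, ‖γ j r‖ ^ 2) 0 ≤ 0 := by
    by_contra! hlt
    -- A positive second derivative would make the maximum a local minimum as well; the function
    -- would be locally constant and its second derivative zero.
    have hmin := isLocalMin_of_deriv_deriv_pos hlt d4 d1.self_of_nhds.continuousAt
    have hc : (fun r => ∑ j, ‖γ j r‖ ^ 2) =ᶠ[nhds 0] fun _ => ∑ j, ‖γ j 0‖ ^ 2 := by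
      filter_upwards [hmax, hmin] with r a b using le_antisymm a b
    have : deriv (fun r => ∑ j, ‖γ j r‖ ^ 2) =ᶠ[nhds 0] fun _ => 0 := by
      have := hc.deriv
      simpa using this
    rw [this.deriv_eq] at hlt
    simp at hlt
  rw [d3] at d5
  simp only [real_inner_self_eq_norm_sq, ← Finset.mul_sum, Finset.sum_add_distrib] at d5
  linarith

end OT

namespace OT

open Complex

variable {s : ℕ}

/-! ### Frames adapted to a metric -/

theorem sum_mul_holPart (φ : Coord s →ₗ[ℝ] ℂ) (w : Coord s) :
    ∑ i, w i * holPart i φ = (1 / 2) * (φ w - I * φ (I • w)) := by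
  rw [apply_eq_sum_parts φ w, apply_eq_sum_parts φ (I • w), Finset.mul_sum,
    ← Finset.sum_sub_distrib, Finset.mul_sum]
  refine Finset.sum_congr rfl fun i _ => ?_
  simp only [Pi.smul_apply, smul_eq_mul, map_mul, conj_I]
  ring_nf
  simp only [I_sq]
  ring

theorem sum_conj_mul_antiPart (φ : Coord s →ₗ[ℝ] ℂ) (w : Coord s) :
    ∑ i, conj (w i) * antiPart i φ = (1 / 2) * (φ w + I * φ (I • w)) := by
  rw [apply_eq_sum_parts φ w, apply_eq_sum_parts φ (I • w), Finset.mul_sum,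
    ← Finset.sum_add_distrib, Finset.mul_sum]
  refine Finset.sum_congr rfl fun i _ => ?_
  simp only [Pi.smul_apply, smul_eq_mul, map_mul, conj_I]
  ring_nf
  simp only [I_sq]
  ring

/-- On the complex line spanned by `w`, `∂∂̄` is a quarter of the Laplacian. This turns the Levi
trace into pure second derivatives, to which the second derivative test applies. -/
theorem sum_levi {S : Coord s →L[ℝ] Coord s →L[ℝ] ℂ} (hS : ∀ u v, S u v = S v u) (w : Coord s) :
    ∑ i, ∑ m, w i * conj (w m) * levi i m S = (1 / 4) * (S w w + S (I • w) (I • w)) := by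
  have h1 : ∀ u, ∑ m, conj (w m) * antiPart m (fun v => S u v)
      = (1 / 2) * (S u w + I * S u (I • w)) := fun u =>
    sum_conj_mul_antiPart (S u).toLinearMap w
  have h2 : ∀ v, ∑ i, w i * holPart i (fun u => S u v)
      = (1 / 2) * (S w v - I * S (I • w) v) := fun v => sum_mul_holPart (S.flip v).toLinearMap w
  have h3 : ∀ i, ∑ m, w i * conj (w m) * levi i m S
      = (1 / 2) * (w i * holPart i (fun u => S u w))
        + (1 / 2) * I * (w i * holPart i (fun u => S u (I • w))) := by
    intro i
    have : ∑ m, w i * conj (w m) * levi i m S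
        = w i * holPart i (fun u => ∑ m, conj (w m) * antiPart m (fun v => S u v)) := by
      rw [holPart_sum, Finset.mul_sum]
      refine Finset.sum_congr rfl fun m _ => ?_
      simp only [levi, holPart]; ring
    rw [this]
    simp only [h1, holPart]; ring
  simp only [h3, Finset.sum_add_distrib, ← Finset.mul_sum, h2]
  rw [hS (I • w) w]
  ring_nf
  simp only [I_sq]
  ring

theorem map_complex_smul (φ : Coord s →L[ℝ] ℂ) (c : ℂ) (w : Coord s) :
    φ (c • w) = c.re * φ w + c.im * φ (I • w) := by
  have : c • w = c.re • w + c.im • (I • w) := by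
    ext i
    simp only [Pi.smul_apply, Pi.add_apply, smul_eq_mul, real_smul]
    conv_lhs => rw [← re_add_im c]
    ring
  rw [this, map_add, map_smul, map_smul, real_smul, real_smul]

section
open scoped MatrixOrder

theorem exists_eq_conjTranspose_mul_self {n : Type*} [Fintype n] [DecidableEq n]
    {H : Matrix n n ℂ} (h : H.PosDef) : ∃ B : Matrix n n ℂ, H = B.conjTranspose * B :=
  CStarAlgebra.nonneg_iff_eq_star_mul_self.mp h.posSemidef.nonneg

end

/-- The bound `M + 1` avoids square roots: `2 y ≤ y² + 1`. -/
theorem norm_le_of_sum_sq {n : Type*} [Fintype n] {M : ℝ} {v : n → ℂ}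
    (h : ‖∑ a, conj (v a) * v a‖ ≤ M) (a : n) : ‖v a‖ ≤ M + 1 := by
  have e : ∑ a, conj (v a) * v a = ((∑ a, ‖v a‖ ^ 2 : ℝ) : ℂ) := by
    push_cast
    exact Finset.sum_congr rfl fun a _ => by rw [conj_mul']
  rw [e, norm_real, Real.norm_of_nonneg (Finset.sum_nonneg fun _ _ => sq_nonneg _)] at h
  have := (Finset.single_le_sum (f := fun a => ‖v a‖ ^ 2) (fun _ _ => sq_nonneg _)
    (Finset.mem_univ a)).trans h
  nlinarith [sq_nonneg (‖v a‖ - 1), norm_nonneg (v a)]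

/-- With `H⁻¹ = B* B`, the frame consists of the rows of `B` and their multiples by `√-1`. Bounds
for `H` and `H⁻¹` make it uniform: its vectors are bounded, and a functional is controlled by its
values on them. -/
theorem exists_frame {H : Matrix (Fin s ⊕ Fin s) (Fin s ⊕ Fin s) ℂ} (hH : H.PosDef) {M : ℝ}
    (hM : ∀ i, ‖H i i‖ ≤ M) (hM' : ∀ i, ‖H⁻¹ i i‖ ≤ M) (hM0 : 0 ≤ M) :
    ∃ b : (Fin s ⊕ Fin s) ⊕ (Fin s ⊕ Fin s) → Coord s,
      (∀ S : Coord s →L[ℝ] Coord s →L[ℝ] ℂ, (∀ u v, S u v = S v u) →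
        leviTrace H S = (1 / 4) * ∑ a, S (b a) (b a)) ∧
      (∀ a, ‖b a‖ ≤ M + 1) ∧
      ∀ φ : Coord s →L[ℝ] ℂ, ‖φ‖ ≤ (s + s) * (M + 1) * ∑ a, ‖φ (b a)‖ := by
  have hdet : IsUnit H.det := (Matrix.isUnit_iff_isUnit_det _).1 hH.isUnit
  obtain ⟨B, hB⟩ := exists_eq_conjTranspose_mul_self hH.inv
  -- `A` inverts `B` and satisfies `A A* = H`, so its entries are bounded by the diagonal of `H`; it
  -- expresses any vector in the frame.
  set A := H * B.conjTranspose with hA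
  have hAB : A * B = 1 := by
    rw [hA, Matrix.mul_assoc, ← hB, Matrix.mul_nonsing_inv _ hdet]
  have hAA : A * A.conjTranspose = H := by
    rw [hA, Matrix.conjTranspose_mul, Matrix.conjTranspose_conjTranspose, hH.1.eq,
      Matrix.mul_assoc, ← Matrix.mul_assoc B.conjTranspose, ← hB, Matrix.nonsing_inv_mul _ hdet,
      Matrix.mul_one]
  have hAe : ∀ j a, ‖A j a‖ ≤ M + 1 := fun j a => by
    refine norm_le_of_sum_sq (v := A j) ?_ a
    convert hM j using 2
    rw [← hAA, Matrix.mul_apply]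
    exact Finset.sum_congr rfl fun a _ => mul_comm _ _
  have hBe : ∀ a i, ‖B a i‖ ≤ M + 1 := fun a i => by
    refine norm_le_of_sum_sq (v := fun a => B a i) ?_ a
    convert hM' i using 2
    rw [hB, Matrix.mul_apply]
    rfl
  refine ⟨Sum.elim (fun a i => B a i) (fun a => I • fun i => B a i), fun S hS => ?_, ?_, ?_⟩
  · have h1 : leviTrace H S = ∑ a, ∑ i, ∑ m, B a i * conj (B a m) * levi i m S := by
      rw [leviTrace, hB, Finset.sum_comm]
      simp only [Matrix.mul_apply, Finset.sum_mul]
      conv_rhs =>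
        enter [2, a]
        rw [Finset.sum_comm]
      conv_rhs => rw [Finset.sum_comm]
      refine Finset.sum_congr rfl fun m _ => ?_
      rw [Finset.sum_comm]
      exact Finset.sum_congr rfl fun a _ => Finset.sum_congr rfl fun i _ => by
        rw [Matrix.conjTranspose_apply, mul_comm (B a i)]; rfl
    rw [h1]
    simp only [fun a => sum_levi hS (fun i => B a i)]
    rw [← Finset.mul_sum, Fintype.sum_sum_type (f := fun x => S _ _), Finset.sum_add_distrib]
    rfl
  · rintro (a | a)
    · exact (pi_norm_le_iff_of_nonneg (by positivity)).2 fun i => hBe a i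
    · simp only [Sum.elim_inr, norm_smul, norm_I, one_mul]
      exact (pi_norm_le_iff_of_nonneg (by positivity)).2 fun i => hBe a i
  · intro φ
    set T := ∑ a, ‖φ (Sum.elim (fun a i => B a i) (fun a => I • fun i => B a i) a)‖ with hT
    have hTe : T = ∑ a, (‖φ fun i => B a i‖ + ‖φ (I • fun i => B a i)‖) := by
      rw [hT, Fintype.sum_sum_type (f := fun x => ‖φ _‖), Finset.sum_add_distrib]
      rfl
    have hT0 : 0 ≤ T := Finset.sum_nonneg fun _ _ => norm_nonneg _
    refine ContinuousLinearMap.opNorm_le_bound _ (by positivity) fun u => ?_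
    have h1 : u = ∑ j, ∑ a, (u j * A j a) • (fun i => B a i : Coord s) := by
      ext i
      simp only [Finset.sum_apply, Pi.smul_apply, smul_eq_mul]
      have : ∀ j, ∑ a, u j * A j a * B a i = u j * (A * B) j i := fun j => by
        rw [Matrix.mul_apply, Finset.mul_sum]
        exact Finset.sum_congr rfl fun a _ => by ring
      simp only [this, hAB, Matrix.one_apply, mul_ite, mul_one, mul_zero, Finset.sum_ite_eq',
        Finset.mem_univ, if_true]
    have h2 : ∀ j, ‖φ (∑ a, (u j * A j a) • (fun i => B a i : Coord s))‖
        ≤ (M + 1) * T * ‖u‖ := by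
      intro j
      rw [map_sum, hTe, Finset.mul_sum, Finset.sum_mul]
      refine (norm_sum_le _ _).trans (Finset.sum_le_sum fun a _ => ?_)
      rw [map_complex_smul]
      refine (norm_add_le _ _).trans ?_
      rw [norm_mul, norm_mul, norm_real, norm_real]
      have e1 : ‖u j * A j a‖ ≤ ‖u‖ * (M + 1) := by
        rw [norm_mul]
        exact mul_le_mul (norm_le_pi_norm u j) (hAe j a) (norm_nonneg _) (norm_nonneg _)
      have e2 := (abs_re_le_norm (u j * A j a)).trans e1
      have e3 := (abs_im_le_norm (u j * A j a)).trans e1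
      rw [← Real.norm_eq_abs] at e2 e3
      have := mul_le_mul_of_nonneg_right e2 (norm_nonneg (φ fun i => B a i))
      have := mul_le_mul_of_nonneg_right e3 (norm_nonneg (φ (I • fun i => B a i)))
      linarith
    conv_lhs => rw [h1, map_sum]
    refine (norm_sum_le _ _).trans ((Finset.sum_le_sum fun j _ => h2 j).trans ?_)
    simp
    exact le_of_eq (by ring)

end OT

namespace OT

open Complex

variable {s : ℕ}

/-! ### Estimates for the difference of two solutions -/

/-- Here `n` stands for the weights, `d` for the difference of two solutions and `E` for the lower
order terms of its equation. The product `k = n d` satisfies the heat equation up to an error linear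
in `k` and its frame derivatives; since `n` is bounded away from zero, `d` and its derivatives are
controlled by those of `k`. -/
theorem exists_bound_of_frame (s : ℕ) {C₀ : ℝ} (hC₀ : 1 ≤ C₀) {J : Type*} [Fintype J] :
    ∃ C, 0 ≤ C ∧ ∀ (b : (Fin s ⊕ Fin s) ⊕ (Fin s ⊕ Fin s) → Coord s)
      (n d E : J → ℂ) (n₁ d₁ : J → Coord s →L[ℝ] ℂ) (n₂ d₂ : J → Coord s →L[ℝ] Coord s →L[ℝ] ℂ),
      (∀ a, ‖b a‖ ≤ C₀ + 1) →
      (∀ φ : Coord s →L[ℝ] ℂ, ‖φ‖ ≤ (s + s) * (C₀ + 1) * ∑ a, ‖φ (b a)‖) →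
      (∀ j, n j ≠ 0) → (∀ j, ‖n j‖ ≤ C₀) → (∀ j, ‖(n j)⁻¹‖ ≤ C₀) → (∀ j, ‖n₁ j‖ ≤ C₀) →
      (∀ j, ‖n₂ j‖ ≤ C₀) → (∀ j, ‖E j‖ ≤ C₀ * ∑ i, (‖d i‖ + ‖d₁ i‖)) →
      ∀ j, ‖n j * (E j + (1 / 4) * ∑ a, d₂ j (b a) (b a))
        - (1 / 4) * ∑ a, (n₂ j (b a) (b a) * d j + 2 * (n₁ j (b a) * d₁ j (b a))
          + n j * d₂ j (b a) (b a))‖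
        ≤ C * ((∑ i, ‖n i * d i‖) + ∑ a, ∑ i, ‖n₁ i (b a) * d i + n i * d₁ i (b a)‖) := by
  set c₂ : ℝ := C₀ + C₀ * (C₀ * (C₀ + 1) * C₀) with hc₂
  set c₃ : ℝ := (s + s) * (C₀ + 1) * (Fintype.card ((Fin s ⊕ Fin s) ⊕ (Fin s ⊕ Fin s)) * c₂)
    with hc₃
  refine ⟨C₀ * (C₀ * (Fintype.card J * (C₀ + c₃))) + (1 / 4) *
    (Fintype.card ((Fin s ⊕ Fin s) ⊕ (Fin s ⊕ Fin s)) *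
      (C₀ * (C₀ + 1) * (C₀ + 1) * C₀ + 2 * (C₀ * (C₀ + 1) * c₂))), by positivity, ?_⟩
  intro b n d E n₁ d₁ n₂ d₂ hb hφ hn0 hn hni hn₁ hn₂ hE j
  set X := ∑ i, ‖n i * d i‖ with hX
  set Y := ∑ a, ∑ i, ‖n₁ i (b a) * d i + n i * d₁ i (b a)‖ with hY
  have hX0 : 0 ≤ X := Finset.sum_nonneg fun _ _ => norm_nonneg _
  have hY0 : 0 ≤ Y := Finset.sum_nonneg fun _ _ => Finset.sum_nonneg fun _ _ => norm_nonneg _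
  have hd : ∀ i, ‖d i‖ ≤ C₀ * (X + Y) := fun i => by
    have e : d i = (n i)⁻¹ * (n i * d i) := by rw [inv_mul_cancel_left₀ (hn0 i)]
    rw [e, norm_mul]
    refine mul_le_mul (hni i) ?_ (norm_nonneg _) (by linarith)
    have := Finset.single_le_sum (f := fun i => ‖n i * d i‖) (fun _ _ => norm_nonneg _)
      (Finset.mem_univ i)
    linarith
  have hn₁b : ∀ i a, ‖n₁ i (b a)‖ ≤ C₀ * (C₀ + 1) := fun i a =>
    ((n₁ i).le_opNorm _).trans (mul_le_mul (hn₁ i) (hb a) (norm_nonneg _) (by linarith))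
  have hn₂b : ∀ i a, ‖n₂ i (b a) (b a)‖ ≤ C₀ * (C₀ + 1) * (C₀ + 1) := fun i a =>
    ((n₂ i).le_opNorm₂ _ _).trans (mul_le_mul (mul_le_mul (hn₂ i) (hb a) (norm_nonneg _)
      (by linarith)) (hb a) (norm_nonneg _) (by positivity))
  have hd₁b : ∀ i a, ‖d₁ i (b a)‖ ≤ c₂ * (X + Y) := fun i a => by
    have e : d₁ i (b a) = (n i)⁻¹ * ((n₁ i (b a) * d i + n i * d₁ i (b a)) - n₁ i (b a) * d i) := by
      rw [add_sub_cancel_left, inv_mul_cancel_left₀ (hn0 i)]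
    have h1 : ‖n₁ i (b a) * d i + n i * d₁ i (b a)‖ ≤ X + Y := by
      have e1 := Finset.single_le_sum (f := fun i => ‖n₁ i (b a) * d i + n i * d₁ i (b a)‖)
        (fun _ _ => norm_nonneg _) (Finset.mem_univ i)
      have e2 := Finset.single_le_sum
        (f := fun a => ∑ i, ‖n₁ i (b a) * d i + n i * d₁ i (b a)‖)
        (fun _ _ => Finset.sum_nonneg fun _ _ => norm_nonneg _) (Finset.mem_univ a)
      linarith
    have h2 : ‖n₁ i (b a) * d i‖ ≤ C₀ * (C₀ + 1) * (C₀ * (X + Y)) := by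
      rw [norm_mul]
      exact mul_le_mul (hn₁b i a) (hd i) (norm_nonneg _) (by positivity)
    rw [e, norm_mul]
    calc _ ≤ C₀ * ((X + Y) + C₀ * (C₀ + 1) * (C₀ * (X + Y))) :=
          mul_le_mul (hni i) ((norm_sub_le _ _).trans (add_le_add h1 h2)) (norm_nonneg _)
            (by linarith)
      _ = _ := by rw [hc₂]; ring
  have hd₁ : ∀ i, ‖d₁ i‖ ≤ c₃ * (X + Y) := fun i => by
    refine (hφ (d₁ i)).trans ?_
    rw [hc₃, mul_assoc ((s + s : ℝ) * (C₀ + 1))]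
    refine mul_le_mul_of_nonneg_left ?_ (by positivity)
    refine (Finset.sum_le_card_nsmul _ _ _ fun a _ => hd₁b i a).trans ?_
    rw [nsmul_eq_mul, Finset.card_univ, mul_assoc]
  have hE' : ‖E j‖ ≤ C₀ * (Fintype.card J * (C₀ + c₃)) * (X + Y) := by
    refine (hE j).trans ?_
    rw [mul_assoc C₀]
    refine mul_le_mul_of_nonneg_left ?_ (by linarith)
    refine (Finset.sum_le_card_nsmul _ _ _ fun i _ => add_le_add (hd i) (hd₁ i)).trans ?_
    rw [nsmul_eq_mul, Finset.card_univ]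
    exact le_of_eq (by ring)
  -- The second derivatives of `d` cancel, so only terms of order at most one remain to be
  -- estimated.
  have e : n j * (E j + (1 / 4) * ∑ a, d₂ j (b a) (b a))
        - (1 / 4) * ∑ a, (n₂ j (b a) (b a) * d j + 2 * (n₁ j (b a) * d₁ j (b a))
          + n j * d₂ j (b a) (b a))
      = n j * E j - (1 / 4) * ∑ a, (n₂ j (b a) (b a) * d j + 2 * (n₁ j (b a) * d₁ j (b a))) := by
    rw [Finset.sum_add_distrib (g := fun a => n j * d₂ j (b a) (b a)), ← Finset.mul_sum]
    ring
  rw [e, add_mul]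
  refine (norm_sub_le _ _).trans (add_le_add ?_ ?_)
  · rw [norm_mul, mul_assoc]
    exact mul_le_mul (hn j) (hE'.trans (le_of_eq (by ring))) (norm_nonneg _) (by linarith)
  · rw [norm_mul, mul_assoc (1 / 4 : ℝ)]
    have : ‖(1 / 4 : ℂ)‖ = 1 / 4 := by norm_num
    rw [this]
    refine mul_le_mul_of_nonneg_left ?_ (by norm_num)
    have h1 : ∀ a, ‖n₂ j (b a) (b a) * d j + 2 * (n₁ j (b a) * d₁ j (b a))‖
        ≤ (C₀ * (C₀ + 1) * (C₀ + 1) * C₀ + 2 * (C₀ * (C₀ + 1) * c₂)) * (X + Y) := fun a => by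
      refine (norm_add_le _ _).trans ?_
      rw [norm_mul, norm_mul, norm_mul, norm_ofNat, add_mul]
      refine add_le_add ?_ ?_
      · rw [mul_assoc]
        exact mul_le_mul (hn₂b j a) (hd j) (norm_nonneg _) (by positivity)
      · rw [mul_assoc, mul_assoc]
        refine mul_le_mul_of_nonneg_left ?_ (by norm_num)
        refine (mul_le_mul (hn₁b j a) (hd₁b j a) (norm_nonneg _) (by positivity)).trans ?_
        exact le_of_eq (by ring)
    refine (norm_sum_le _ _).trans ((Finset.sum_le_card_nsmul _ _ _ fun a _ => h1 a).trans ?_)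
    rw [nsmul_eq_mul, Finset.card_univ]
    exact le_of_eq (by ring)

/-- The test supplies a negative multiple of the squared gradient `Z`, and the error contains the
gradient only to first power, multiplied by `X`. Young's inequality absorbs it. -/
theorem deriv_le_of_second_derivative_test {J B : Type*} [Fintype J] [Fintype B] {C : ℝ}
    (hC : 0 ≤ C) {k kt : J → ℂ} {k₁ k₂ : B → J → ℂ}
    (htest : ∀ a, ∑ j, inner ℝ (k j) (k₂ a j) ≤ -∑ j, ‖k₁ a j‖ ^ 2)
    (hR : ∀ j, ‖kt j - (1 / 4) * ∑ a, k₂ a j‖ ≤ C * ((∑ i, ‖k i‖) + ∑ a, ∑ i, ‖k₁ a i‖)) :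
    ∑ j, 2 * inner ℝ (k j) (kt j)
      ≤ (2 * C + 2 * C ^ 2 * (Fintype.card (B × J) + 1)) * Fintype.card J * ∑ j, ‖k j‖ ^ 2 := by
  set X := ∑ i, ‖k i‖ with hX
  set Y := ∑ a, ∑ i, ‖k₁ a i‖ with hY
  set Z := ∑ a, ∑ i, ‖k₁ a i‖ ^ 2 with hZ
  have hX0 : 0 ≤ X := Finset.sum_nonneg fun _ _ => norm_nonneg _
  have hY0 : 0 ≤ Y := Finset.sum_nonneg fun _ _ => Finset.sum_nonneg fun _ _ => norm_nonneg _
  have hX2 : X ^ 2 ≤ Fintype.card J * ∑ j, ‖k j‖ ^ 2 := by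
    simpa using sq_sum_le_card_mul_sum_sq (s := Finset.univ) (f := fun i => ‖k i‖)
  have hZ0 : 0 ≤ Z := Finset.sum_nonneg fun _ _ => Finset.sum_nonneg fun _ _ => sq_nonneg _
  have hY2 : Y ^ 2 ≤ (Fintype.card (B × J) + 1) * Z := by
    have := sq_sum_le_card_mul_sum_sq (s := (Finset.univ : Finset (B × J)))
      (f := fun q => ‖k₁ q.1 q.2‖)
    rw [Fintype.sum_prod_type, Fintype.sum_prod_type, Finset.card_univ] at this
    simp only at this
    rw [← hY, ← hZ] at this
    linarith
  have h1 : ∀ j, 2 * inner ℝ (k j) (kt j)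
      ≤ (1 / 2) * (∑ a, inner ℝ (k j) (k₂ a j)) + 2 * (‖k j‖ * (C * (X + Y))) := fun j => by
    have e : kt j = (1 / 4 : ℝ) • (∑ a, k₂ a j) + (kt j - (1 / 4) * ∑ a, k₂ a j) := by
      rw [real_smul]; push_cast; ring
    have e2 := (real_inner_le_norm (k j) (kt j - (1 / 4) * ∑ a, k₂ a j)).trans
      (mul_le_mul_of_nonneg_left (hR j) (norm_nonneg _))
    rw [e, inner_add_right, inner_smul_right, inner_sum]
    linarith
  have h2 : ∑ j, 2 * inner ℝ (k j) (kt j) ≤ -(1 / 2) * Z + 2 * (X * (C * (X + Y))) := by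
    refine (Finset.sum_le_sum fun j _ => h1 j).trans ?_
    rw [Finset.sum_add_distrib, ← Finset.mul_sum, ← Finset.mul_sum, ← Finset.sum_mul,
      Finset.sum_comm]
    have := Finset.sum_le_sum fun a (_ : a ∈ Finset.univ) => htest a
    rw [Finset.sum_neg_distrib] at this
    linarith
  -- The constant from Cauchy-Schwarz, `Y² ≤ m Z`, increased by one so that it is positive even for
  -- empty index sets.
  set m : ℝ := Fintype.card (B × J) + 1 with hm
  have hm0 : 0 < m := by positivity
  have h3 : 2 * C * X * Y ≤ (1 / 2) * Z + 2 * C ^ 2 * m * X ^ 2 := by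
    have h4 : 0 ≤ (Y - 2 * C * m * X) ^ 2 := sq_nonneg _
    have h5 : m * (2 * C * X * Y) ≤ m * ((1 / 2) * Z + 2 * C ^ 2 * m * X ^ 2) := by nlinarith
    exact le_of_mul_le_mul_left h5 hm0
  have h6 : (2 * C + 2 * C ^ 2 * m) * X ^ 2
      ≤ (2 * C + 2 * C ^ 2 * m) * (Fintype.card J * ∑ j, ‖k j‖ ^ 2) :=
    mul_le_mul_of_nonneg_left hX2 (by positivity)
  nlinarith

/-- Spatial derivatives of a smooth family are smooth. -/
theorem contDiffOn_fderiv_snd {E F : Type*} [NormedAddCommGroup E] [NormedSpace ℝ E]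
    [NormedAddCommGroup F] [NormedSpace ℝ F] {f : ℝ → E → F} {I : Set ℝ} {Ω : Set E}
    (hI : UniqueDiffOn ℝ I) (hΩ : IsOpen Ω)
    (hf : ContDiffOn ℝ ∞ (fun q : ℝ × E => f q.1 q.2) (I ×ˢ Ω)) :
    ContDiffOn ℝ ∞ (fun q : ℝ × E => fderiv ℝ (f q.1) q.2) (I ×ˢ Ω) := by
  -- The spatial derivative is the total derivative within the product, restricted to the second
  -- factor; as `Ω` is open, it is an unrestricted derivative in space.
  have h1 : ContDiffOn ℝ ∞ (fderivWithin ℝ (fun q : ℝ × E => f q.1 q.2) (I ×ˢ Ω)) (I ×ˢ Ω) :=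
    hf.fderivWithin (hI.prod hΩ.uniqueDiffOn) (by simp)
  have h2 : ContDiffOn ℝ ∞ (fun q : ℝ × E =>
      (fderivWithin ℝ (fun q : ℝ × E => f q.1 q.2) (I ×ˢ Ω) q).comp
        (ContinuousLinearMap.inr ℝ ℝ E)) (I ×ˢ Ω) := h1.clm_comp contDiffOn_const
  refine h2.congr fun q hq => ?_
  have h3 := ((hf.differentiableOn (by simp)) q hq).hasFDerivWithinAt
  have h4 : HasFDerivWithinAt (fun y : E => ((q.1, y) : ℝ × E)) (ContinuousLinearMap.inr ℝ ℝ E)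
      Ω q.2 := (hasFDerivAt_prodMk_right q.1 q.2).hasFDerivWithinAt
  have h5 := h3.comp (f := fun y : E => ((q.1, y) : ℝ × E)) q.2 h4 fun y hy => ⟨hq.1, hy⟩
  exact (h5.hasFDerivAt (hΩ.mem_nhds hq.2)).fderiv

theorem fderiv_mul_apply_apply {f g : Coord s → ℂ} (hf : Smooth f) (hg : Smooth g) {x : Coord s}
    (hx : x ∈ domain s) (w : Coord s) :
    fderiv ℝ (fderiv ℝ fun y => f y * g y) x w w
      = fderiv ℝ (fderiv ℝ f) x w w * g x + 2 * (fderiv ℝ f x w * fderiv ℝ g x w)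
        + f x * fderiv ℝ (fderiv ℝ g) x w w := by
  have h0 : ∀ y ∈ domain s, fderiv ℝ (fun y => f y * g y) y w
      = fderiv ℝ f y w * g y + f y * fderiv ℝ g y w := fun y hy => by
    rw [fderiv_fun_mul (hf.differentiableAt hy) (hg.differentiableAt hy)]
    simp only [add_apply, smul_apply, smul_eq_mul]
    ring
  have a1 := (hf.fderiv_apply w).differentiableAt hx
  have a2 := (hg.fderiv_apply w).differentiableAt hx
  have a3 := hf.differentiableAt hx
  have a4 := hg.differentiableAt hx
  rw [← fderiv_fderiv_apply (hf.mul hg) hx, fderiv_congr h0 hx,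
    fderiv_fun_add (a1.fun_mul a4) (a3.fun_mul a2), fderiv_fun_mul a1 a4, fderiv_fun_mul a3 a2]
  simp only [add_apply, smul_apply, smul_eq_mul, fderiv_fderiv_apply hf hx,
    fderiv_fderiv_apply hg hx]
  ring

/-- The second derivative test along a line. -/
theorem sum_inner_fderiv_le {J : Type*} [Fintype J] {K : J → Coord s → ℂ}
    (hK : ∀ j, Smooth (K j)) {x : Coord s} (hx : x ∈ domain s)
    (hmax : ∀ y ∈ domain s, ∑ j, ‖K j y‖ ^ 2 ≤ ∑ j, ‖K j x‖ ^ 2) (w : Coord s) :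
    ∑ j, inner ℝ (K j x) (fderiv ℝ (fderiv ℝ (K j)) x w w) ≤ -∑ j, ‖fderiv ℝ (K j) x w‖ ^ 2 := by
  have hline : ∀ r : ℝ, HasDerivAt (fun r : ℝ => x + r • w) w r := fun r => by
    simpa using ((hasDerivAt_id r).smul_const w).const_add x
  have hev : ∀ᶠ r in nhds (0 : ℝ), x + r • w ∈ domain s := by
    have : Filter.Tendsto (fun r : ℝ => x + r • w) (nhds 0) (nhds (x + (0 : ℝ) • w)) :=
      (hline 0).continuousAt
    rw [zero_smul, add_zero] at this
    exact this (domain_mem_nhds hx)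
  have := sum_inner_le_of_isLocalMax (γ := fun j r => K j (x + r • w))
    (γ₁ := fun j r => fderiv ℝ (K j) (x + r • w) w)
    (γ₂ := fun j => fderiv ℝ (fderiv ℝ (K j)) x w w) (fun j => ?_) (fun j => ?_) ?_
  · simpa using this
  · filter_upwards [hev] with r hr
    exact ((hK j).differentiableAt hr).hasFDerivAt.comp_hasDerivAt r (hline r)
  · rw [← fderiv_fderiv_apply (hK j) hx]
    have h1 := (((hK j).fderiv_apply w).differentiableAt (x := x) hx).hasFDerivAt
    have h2 : HasFDerivAt (fun y => fderiv ℝ (K j) y w)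
        (fderiv ℝ (fun y => fderiv ℝ (K j) y w) x) (x + (0 : ℝ) • w) := by simpa using h1
    exact h2.comp_hasDerivAt 0 (hline 0)
  · filter_upwards [hev] with r hr
    simpa using hmax _ hr

end OT

namespace OT

open Complex

variable {s : ℕ}

/-! ### Cocompactness of the group action -/

/-- A basis of `E` can be chosen inside `Λ`; subtracting integral parts of coordinates moves every
vector into its fundamental parallelepiped. Discreteness of `Λ` plays no role. -/
theorem exists_norm_add_le_of_span_eq_top {E : Type*} [NormedAddCommGroup E] [NormedSpace ℝ E]
    [FiniteDimensional ℝ E] (Λ : AddSubgroup E) (h : Submodule.span ℝ (Λ : Set E) = ⊤) :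
    ∃ R, ∀ v, ∃ l ∈ Λ, ‖v + l‖ ≤ R := by
  obtain ⟨b, hb, hspan, hli⟩ := exists_linearIndependent ℝ (Λ : Set E)
  let B : Module.Basis b ℝ E := Module.Basis.mk hli (by
    rw [Subtype.range_coe, hspan, h])
  have : Finite b := hli.finite
  cases nonempty_fintype b
  refine ⟨∑ i, ‖B i‖, fun v => ⟨-(ZSpan.floor B v : E), ?_, ?_⟩⟩
  · refine Λ.neg_mem ?_
    have h1 : Submodule.span ℤ (Set.range B) ≤ AddSubgroup.toIntSubmodule Λ := by
      rw [Submodule.span_le]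
      rintro _ ⟨i, rfl⟩
      simpa [B] using hb i.2
    exact h1 (ZSpan.floor B v).2
  · rw [← sub_eq_add_neg]
    exact ZSpan.norm_fract_le B v

variable {K : Type*} [Field K] [NumberField K]

theorem Data.emb_add (X : Data s K) (a b : K) : X.emb (a + b) = X.emb a + X.emb b := by
  ext (i | i) <;> simp [Data.emb]

/-- Dedekind's independence of characters on the monoid `𝓞 K`; distinct embeddings of `K` remain
distinct there because `K` is the field of fractions. -/
theorem Data.linearIndependent (X : Data s K) {p : Fin s → ℂ} {q r : Fin s → ℂ}
    (h : ∀ a : 𝓞 K, ∑ k, p k * (X.σ k a : ℂ) + (∑ i, q i * X.τ i a + ∑ i, r i * conj (X.τ i a)) = 0) :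
    p = 0 ∧ q = 0 ∧ r = 0 := by
  let φ : Fin s ⊕ Fin s ⊕ Fin s → (𝓞 K →* ℂ) := fun i =>
    (((Sum.elim (fun k => ofRealHom.comp (X.σ k))
      (Sum.elim X.τ (fun i => (starRingEnd ℂ).comp (X.τ i))) i : K →+* ℂ).comp
        (algebraMap (𝓞 K) K) : 𝓞 K →+* ℂ) : 𝓞 K →* ℂ)
  have hφ : Function.Injective φ := by
    intro i j hij
    apply X.embeddings.1
    refine IsLocalization.ringHom_ext (nonZeroDivisors (𝓞 K)) ?_
    ext a
    exact DFunLike.congr_fun hij a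
  have hli := (linearIndependent_monoidHom (𝓞 K) ℂ).comp φ hφ
  rw [Fintype.linearIndependent_iff] at hli
  have h0 := hli (Sum.elim p (Sum.elim q r)) (by
    funext a
    simpa [φ] using h a)
  exact ⟨funext fun k => h0 (Sum.inl k), funext fun k => h0 (Sum.inr (Sum.inl k)),
    funext fun k => h0 (Sum.inr (Sum.inr k))⟩

/-- The part `(Re z, w)` of a point `(z, w)`. -/
noncomputable def realPart (x : Coord s) : (Fin s → ℝ) × (Fin s → ℂ) :=
  (fun k => (x (Sum.inl k)).re, fun i => x (Sum.inr i))

theorem realPart_add (x y : Coord s) : realPart (x + y) = realPart x + realPart y := by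
  ext <;> simp [realPart]

/-- A real functional vanishing on the image of `𝓞 K` is a linear relation between the embeddings
and must be zero. -/
theorem Data.span_realPart (X : Data s K) :
    Submodule.span ℝ (Set.range fun a : 𝓞 K => realPart (X.emb (a : K))) = ⊤ := by
  by_contra hne
  obtain ⟨f, hf, hle⟩ := Submodule.exists_le_ker_of_lt_top _ (lt_top_iff_ne_top.2 hne)
  let ρ : Coord s →ₗ[ℝ] (Fin s → ℝ) × (Fin s → ℂ) :=
    { toFun := realPart
      map_add' := realPart_add
      map_smul' := fun r x => by ext <;> simp [realPart] }
  let φ : Coord s →ₗ[ℝ] ℂ := (ofRealCLM : ℝ →ₗ[ℝ] ℂ) ∘ₗ f ∘ₗ ρ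
  have h0 : ∀ a : 𝓞 K, φ (X.emb (a : K)) = 0 := fun a => by
    have : f (realPart (X.emb (a : K))) = 0 := hle (Submodule.subset_span ⟨a, rfl⟩)
    simp [φ, ρ, this]
  obtain ⟨hp, hq, hr⟩ := X.linearIndependent
    -- The first `s` coordinates of the image are real, so `dzₖ` and `dz̄ₖ` both contribute to the
    -- coefficient of `σ k`.
    (p := fun k => holPart (Sum.inl k) φ + antiPart (Sum.inl k) φ)
    (q := fun k => holPart (Sum.inr k) φ) (r := fun k => antiPart (Sum.inr k) φ) fun a => by
      rw [← h0 a, apply_eq_sum_parts, Fintype.sum_sum_type, Finset.sum_add_distrib,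
        Finset.sum_add_distrib]
      simp [Data.emb, add_mul, Finset.sum_add_distrib]
  have hI : ∀ k, φ (Pi.single (Sum.inl k) I) = 0 := fun k => by
    have : realPart (Pi.single (Sum.inl k) I : Coord s) = 0 := by
      ext i
      · by_cases h : i = k
        · subst h; simp [realPart]
        · simp [realPart, Pi.single_apply, h]
      · simp [realPart]
    simp [φ, ρ, this]
  have h1 : ∀ k, φ (Pi.single (Sum.inl k) 1) = 0 := fun k => by
    have := congrFun hp k
    simp only [holPart, antiPart, Pi.zero_apply] at this
    linear_combination this
  have hφ : ∀ u, φ u = 0 := fun u => by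
    rw [apply_eq_sum_parts]
    refine Finset.sum_eq_zero fun k _ => ?_
    rcases k with k | k
    · simp [holPart, antiPart, h1, hI]
    · have a1 := congrFun hq k
      have a2 := congrFun hr k
      simp only [Pi.zero_apply] at a1 a2
      rw [a1, a2]; simp
  refine hf (LinearMap.ext fun v => ?_)
  have := hφ (Sum.elim (fun k => (v.1 k : ℂ)) v.2)
  have e : realPart (Sum.elim (fun k => (v.1 k : ℂ)) v.2) = v := by
    ext <;> simp [realPart]
  simpa [φ, ρ, e] using this

theorem Data.im_emb_mul (X : Data s K) (a b : K) (x : Coord s) (k : Fin s) :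
    ((X.emb a * x + X.emb b) (Sum.inl k)).im = X.σ k a * (x (Sum.inl k)).im := by
  simp [Data.emb]

theorem Data.mem_domain (X : Data s K) {u : (𝓞 K)ˣ} (hu : u ∈ X.U) (b : K) {x : Coord s}
    (hx : x ∈ domain s) : X.emb ((u : 𝓞 K) : K) * x + X.emb b ∈ domain s := fun k => by
  rw [X.im_emb_mul]
  exact mul_pos (X.pos u hu k) (hx k)

/-- The lattice of the logarithms of the units. -/
noncomputable def Data.logLattice (X : Data s K) : AddSubgroup (Fin s → ℝ) where
  carrier := {v | ∃ u ∈ X.U, v = fun k => Real.log (X.σ k ((u : 𝓞 K) : K))}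
  zero_mem' := ⟨1, X.U.one_mem, by ext k; simp⟩
  add_mem' := by
    rintro _ _ ⟨u, hu, rfl⟩ ⟨v, hv, rfl⟩
    refine ⟨u * v, X.U.mul_mem hu hv, ?_⟩
    ext k
    simp [Real.log_mul (X.pos u hu k).ne' (X.pos v hv k).ne']
  neg_mem' := by
    rintro _ ⟨u, hu, rfl⟩
    refine ⟨u⁻¹, X.U.inv_mem hu, ?_⟩
    ext k
    simp [← Real.log_inv]

/-- A unit first brings `log Im z` into a bounded region. A translation by `𝓞 K`, which leaves `Im
z` unchanged, then bounds `(Re z, w)`. -/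
theorem Data.exists_compact (X : Data s K) : ∃ D : Set (Coord s), IsCompact D ∧ D ⊆ domain s ∧
    ∀ x ∈ domain s, ∃ u ∈ X.U, ∃ a : 𝓞 K, X.emb ((u : 𝓞 K) : K) * x + X.emb (a : K) ∈ D := by
  obtain ⟨R, hR⟩ := exists_norm_add_le_of_span_eq_top X.logLattice X.log_span
  let Λ : AddSubgroup ((Fin s → ℝ) × (Fin s → ℂ)) := AddMonoidHom.range
    (AddMonoidHom.mk' (fun a : 𝓞 K => realPart (X.emb (a : K))) fun a b => by
      rw [← realPart_add, ← X.emb_add]; rfl)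
  obtain ⟨R', hR'⟩ := exists_norm_add_le_of_span_eq_top Λ X.span_realPart
  refine ⟨Set.pi Set.univ (Sum.elim
    (fun _ => Set.Icc (-R') R' ×ℂ Set.Icc (Real.exp (-R)) (Real.exp R))
    (fun _ => Metric.closedBall 0 R')), isCompact_univ_pi ?_, fun x hx k => ?_, fun x hx => ?_⟩
  · rintro (k | i)
    · exact isCompact_Icc.reProdIm isCompact_Icc
    · exact isCompact_closedBall _ _
  · exact (Real.exp_pos _).trans_le (hx (Sum.inl k) trivial).2.1
  · obtain ⟨l, ⟨u, hu, rfl⟩, hl⟩ := hR fun k => Real.log (x (Sum.inl k)).im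
    obtain ⟨l', ⟨a, rfl⟩, hl'⟩ := hR' (realPart (X.emb ((u : 𝓞 K) : K) * x))
    refine ⟨u, hu, a, ?_⟩
    have e : realPart (X.emb ((u : 𝓞 K) : K) * x) + realPart (X.emb (a : K))
        = realPart (X.emb ((u : 𝓞 K) : K) * x + X.emb (a : K)) := (realPart_add _ _).symm
    change ‖realPart (X.emb ((u : 𝓞 K) : K) * x) + realPart (X.emb (a : K))‖ ≤ R' at hl'
    rw [e] at hl'
    have hR0 : 0 ≤ R' := (norm_nonneg _).trans hl'
    have hl1 := (pi_norm_le_iff_of_nonneg hR0).1 ((norm_fst_le _).trans hl')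
    have hl2 := (pi_norm_le_iff_of_nonneg hR0).1 ((norm_snd_le _).trans hl')
    rintro (k | i) -
    · refine ⟨abs_le.1 (hl1 k), ?_⟩
      have h1 := (norm_le_pi_norm _ k).trans hl
      have hp := X.mem_domain hu (a : K) hx k
      have h2 : Real.log (x (Sum.inl k)).im + Real.log (X.σ k ((u : 𝓞 K) : K))
          = Real.log ((X.emb ((u : 𝓞 K) : K) * x + X.emb (a : K)) (Sum.inl k)).im := by
        rw [X.im_emb_mul, Real.log_mul (X.pos u hu k).ne' (hx k).ne', add_comm]
      rw [Pi.add_apply, h2, Real.norm_eq_abs] at h1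
      exact ⟨(Real.le_log_iff_exp_le hp).1 (abs_le.1 h1).1,
        (Real.log_le_iff_le_exp hp).1 (abs_le.1 h1).2⟩
    · simpa [realPart] using hl2 i

/-- The norms of the coordinate vector fields in the left-invariant coframe. -/
noncomputable def weight (x : Coord s) : Fin s ⊕ Fin s → ℝ :=
  Sum.elim (fun k => (x (Sum.inl k)).im) (fun i => (Real.sqrt (x (Sum.inl i)).im)⁻¹)

theorem weight_pos {x : Coord s} (hx : x ∈ domain s) : ∀ i, 0 < weight x i := by
  rintro (i | i)
  · exact hx i
  · exact inv_pos.2 (Real.sqrt_pos.2 (hx i))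

theorem smooth_im (k : Fin s) :
    ContDiffOn ℝ ∞ (fun x : Coord s => (x (Sum.inl k)).im) (domain s) := by
  have : ContDiff ℝ ∞ (fun x : Coord s => imCLM (x (Sum.inl k))) := by fun_prop
  exact this.contDiffOn

theorem contDiffOn_weight (i : Fin s ⊕ Fin s) :
    ContDiffOn ℝ ∞ (fun x : Coord s => weight x i) (domain s) := by
  rcases i with k | k
  · exact smooth_im k
  · exact ((smooth_im k).sqrt fun x hx => (hx k).ne').inv
      fun x hx => (Real.sqrt_pos.2 (hx k)).ne'

theorem Data.norm_tau (X : Data s K) {c : Fin s → Fin s → ℝ} (hc : X.Twist c) {u : (𝓞 K)ˣ}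
    (hu : u ∈ X.U) (i : Fin s) :
    ‖X.τ i ((u : 𝓞 K) : K)‖ = (Real.sqrt (X.σ i ((u : 𝓞 K) : K)))⁻¹ := by
  rw [hc u hu i, norm_mul, mul_comm Complex.I, norm_exp_ofReal_mul_I, mul_one, norm_real,
    Real.norm_of_nonneg (Real.rpow_nonneg (X.pos u hu i).le _), Real.rpow_neg (X.pos u hu i).le,
    Real.sqrt_eq_rpow]

theorem Data.weight_smul (X : Data s K) {c : Fin s → Fin s → ℝ} (hc : X.Twist c) {u : (𝓞 K)ˣ}
    (hu : u ∈ X.U) (b : K) {x : Coord s} (i : Fin s ⊕ Fin s) :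
    weight (X.emb ((u : 𝓞 K) : K) * x + X.emb b) i
      = ‖X.emb ((u : 𝓞 K) : K) i‖ * weight x i := by
  rcases i with i | i
  · simp only [weight, Sum.elim_inl, X.im_emb_mul]
    rw [show X.emb ((u : 𝓞 K) : K) (Sum.inl i) = (X.σ i ((u : 𝓞 K) : K) : ℂ) from rfl, norm_real,
      Real.norm_of_nonneg (X.pos u hu i).le]
  · simp only [weight, Sum.elim_inr, X.im_emb_mul]
    rw [show X.emb ((u : 𝓞 K) : K) (Sum.inr i) = X.τ i ((u : 𝓞 K) : K) from rfl, X.norm_tau hc hu, Real.sqrt_mul (X.pos u hu i).le, mul_inv]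

/-- Under a unit the weights acquire exactly the absolute values of the factors by which the entries
of an invariant form are divided. -/
theorem Data.Invariant.weight_mul_norm {X : Data s K} {h₁ h₂ : FormField s} (h₁i : X.Invariant h₁)
    (h₂i : X.Invariant h₂) {c : Fin s → Fin s → ℝ} (hc : X.Twist c) {u : (𝓞 K)ˣ}
    (hu : u ∈ X.U) (a : 𝓞 K) {x : Coord s} (hx : x ∈ domain s) (i j : Fin s ⊕ Fin s) :
    weight (X.emb ((u : 𝓞 K) : K) * x + X.emb (a : K)) i
      * weight (X.emb ((u : 𝓞 K) : K) * x + X.emb (a : K)) j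
      * ‖h₁ (X.emb ((u : 𝓞 K) : K) * x + X.emb (a : K)) i j
          - h₂ (X.emb ((u : 𝓞 K) : K) * x + X.emb (a : K)) i j‖
      = weight x i * weight x j * ‖h₁ x i j - h₂ x i j‖ := by
  have hm : X.emb ((u : 𝓞 K) : K) * x ∈ domain s := by
    have := X.mem_domain hu 0 hx
    have h0 : X.emb (0 : K) = 0 := by ext (i | i) <;> simp [Data.emb]
    rwa [h0, add_zero] at this
  rw [(h₁i _ hm).1 a, (h₂i _ hm).1 a, X.weight_smul hc hu, X.weight_smul hc hu,
    ← (h₁i x hx).2 u hu i j, ← (h₂i x hx).2 u hu i j, ← sub_mul, norm_mul, norm_mul, norm_conj]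
  ring

end OT

namespace OT

open Complex

variable {s : ℕ}

/-! ### Uniqueness of the pluriclosed flow -/

/-- Two-jets of matrix valued functions, grouped as one-jets and second derivatives. -/
abbrev Jet (s : ℕ) : Type :=
  ((Fin s ⊕ Fin s → Fin s ⊕ Fin s → ℂ) × (Fin s ⊕ Fin s → Fin s ⊕ Fin s → Coord s →L[ℝ] ℂ)) ×
    (Fin s ⊕ Fin s → Fin s ⊕ Fin s → Coord s →L[ℝ] Coord s →L[ℝ] ℂ)

/-- The metric and its first derivatives at a point. -/
noncomputable def jetOne (h : FormField s) (x : Coord s) :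
    (Fin s ⊕ Fin s → Fin s ⊕ Fin s → ℂ) × (Fin s ⊕ Fin s → Fin s ⊕ Fin s → Coord s →L[ℝ] ℂ) :=
  (fun k l => h x k l, fun k l => fderiv ℝ (fun y => h y k l) x)

/-- The second derivatives of the metric at a point. -/
noncomputable def jetTwo (h : FormField s) (x : Coord s) :
    Fin s ⊕ Fin s → Fin s ⊕ Fin s → Coord s →L[ℝ] Coord s →L[ℝ] ℂ :=
  fun k l => fderiv ℝ (fderiv ℝ fun y => h y k l) x

/-- The right hand side of the pluriclosed flow as a function of the two-jet of the metric. -/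
noncomputable def evolution (k l : Fin s ⊕ Fin s)
    (q : Jet s) : ℂ :=
  leviTrace (Matrix.of q.1.1) (q.2 k l)
    - (1 / 2) * (lowerOrder k l q.1.1 q.1.2 + conj (lowerOrder l k q.1.1 q.1.2))

/-- The leading part of the Ricci coefficients is Hermitian, so symmetrization in the flow equation
alters only the lower order terms. -/
theorem conj_leviTrace {H : Matrix (Fin s ⊕ Fin s) (Fin s ⊕ Fin s) ℂ} (hH : H.PosDef)
    {S S' : Coord s →L[ℝ] Coord s →L[ℝ] ℂ} (hS : ∀ u v, S u v = S v u)
    (h : ∀ u v, S' u v = conj (S u v)) : conj (leviTrace H S) = leviTrace H S' := by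
  simp only [leviTrace, map_sum, map_mul, levi_symm_conj hS h]
  rw [Finset.sum_comm]
  refine Finset.sum_congr rfl fun i _ => Finset.sum_congr rfl fun m _ => ?_
  rw [show conj (H⁻¹ i m) = H⁻¹ m i from hH.inv.1.apply m i]

theorem hasDerivWithinAt_evolution {h : ℝ → FormField s} {I : Set ℝ} {t : ℝ}
    {Γ : Christoffel s} (hh : IsMetric (h t)) (hp : IsPluriclosed (h t))
    (hΓ : IsBismutConnection (h t) Γ) {x : Coord s} (hx : x ∈ domain s)
    (hd : ∀ u v, HasDerivWithinAt (fun t' => fundForm (h t') x u v) (-ricciForm11 Γ x u v) I t)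
    (k l : Fin s ⊕ Fin s) :
    HasDerivWithinAt (fun t' => h t' x k l) (evolution k l (jetOne (h t) x, jetTwo (h t) x)) I t := by
  refine (hasDerivWithinAt_of_fundForm hh hΓ hx hd k l).congr_deriv ?_
  rw [hh.ricciCoeff_eq hp hx, hh.ricciCoeff_eq hp hx, map_sub,
    conj_leviTrace (hh.posDef x hx) (fderiv_fderiv_symm (hh.smooth l k) hx)
      (S' := fderiv ℝ (fderiv ℝ fun y => h t y k l) x) fun u v => ?_]
  · simp only [evolution, jetOne, jetTwo]
    change _ = leviTrace (h t x) _ - _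
    ring
  · rw [← fderiv_fderiv_apply (hh.smooth k l) hx, ← fderiv_fderiv_apply (hh.smooth l k) hx,
      ← fderiv_conj_apply]
    congr 1
    refine fderiv_congr (fun y hy => ?_) hx
    rw [← fderiv_conj_apply]
    congr 1
    exact fderiv_congr (fun z hz => (hh.conj_apply hz l k).symm) hy

theorem contDiffOn_evolution (k l : Fin s ⊕ Fin s) :
    ContDiffOn ℝ ∞ (evolution k l) {q | (Matrix.of q.1.1).det ≠ 0} := by
  have hinv : ∀ m i : Fin s ⊕ Fin s, ContDiffOn ℝ ∞
      (fun q : Jet s => invEntry m i q.1.1)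
      {q | (Matrix.of q.1.1).det ≠ 0} := fun m i =>
    (contDiffOn_invEntry m i).comp (by fun_prop) fun q hq => hq
  have hdinv : ∀ (m i : Fin s ⊕ Fin s) (u : Coord s), ContDiffOn ℝ ∞
      (fun q : Jet s =>
        fderiv ℝ (invEntry m i) q.1.1 fun a b => q.1.2 a b u)
      {q | (Matrix.of q.1.1).det ≠ 0} := fun m i u => by
    refine ContDiffOn.clm_apply ?_ (by fun_prop)
    exact ((contDiffOn_invEntry m i).fderiv_of_isOpen isOpen_det_ne_zero (m := ∞) (by simp)).comp
      (by fun_prop) fun q hq => hq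
  have hlo : ∀ k l : Fin s ⊕ Fin s, ContDiffOn ℝ ∞
      (fun q : Jet s =>
        lowerOrder k l q.1.1 q.1.2) {q | (Matrix.of q.1.1).det ≠ 0} := fun k l => by
    simp only [lowerOrder, holPart, antiPart]
    refine ContDiffOn.sum fun i _ => ContDiffOn.sum fun m _ => ?_
    have a1 := hdinv m i (Pi.single k 1)
    have a2 := hdinv m i (Pi.single k I)
    have a3 := hdinv m i (Pi.single l 1)
    have a4 := hdinv m i (Pi.single l I)
    fun_prop
  unfold evolution
  refine ContDiffOn.sub ?_ (contDiffOn_const.mul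
    ((hlo k l).add (conjCLE.contDiff.comp_contDiffOn (hlo l k))))
  simp only [leviTrace, levi, holPart, antiPart]
  refine ContDiffOn.sum fun i _ => ContDiffOn.sum fun m _ => (hinv m i).mul ?_
  fun_prop

theorem norm_jetOne_sub_le (h₁ h₂ : FormField s) (x : Coord s) :
    ‖jetOne h₁ x - jetOne h₂ x‖ ≤ ∑ j : (Fin s ⊕ Fin s) × (Fin s ⊕ Fin s),
      (‖h₁ x j.1 j.2 - h₂ x j.1 j.2‖
        + ‖fderiv ℝ (fun y => h₁ y j.1 j.2) x - fderiv ℝ (fun y => h₂ y j.1 j.2) x‖) := by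
  have h0 : ∀ j : (Fin s ⊕ Fin s) × (Fin s ⊕ Fin s), 0 ≤ ‖h₁ x j.1 j.2 - h₂ x j.1 j.2‖
        + ‖fderiv ℝ (fun y => h₁ y j.1 j.2) x - fderiv ℝ (fun y => h₂ y j.1 j.2) x‖ :=
    fun j => by positivity
  have hs := Finset.sum_nonneg fun j (_ : j ∈ Finset.univ) => h0 j
  refine max_le ?_ ?_ <;>
  · refine (pi_norm_le_iff_of_nonneg hs).2 fun k => (pi_norm_le_iff_of_nonneg hs).2 fun l => ?_
    refine le_trans ?_ (Finset.single_le_sum (fun j _ => h0 j) (Finset.mem_univ (k, l)))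
    simp [jetOne]

/-- The interval is convex, and has interior points because `T > 0`; derivatives within it are thus
unique also at the endpoint `0`. -/
theorem timeInterval_uniqueDiffOn {T : EReal} (hT : 0 < T) : UniqueDiffOn ℝ (timeInterval T) := by
  have hconv : (timeInterval T).OrdConnected := ⟨fun a ha b hb c hc =>
    ⟨ha.1.trans hc.1, (EReal.coe_le_coe_iff.2 hc.2).trans_lt hb.2⟩⟩
  refine uniqueDiffOn_convex hconv.convex ?_
  obtain ⟨r, h1, h2⟩ := EReal.lt_iff_exists_real_btwn.1 hT
  have hr : (0 : ℝ) < r := EReal.coe_pos.1 h1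
  refine ⟨r / 2, mem_interior.2 ⟨Set.Ioo 0 r, fun t ht => ⟨ht.1.le, ?_⟩, isOpen_Ioo, ?_⟩⟩
  · exact (EReal.coe_lt_coe_iff.2 ht.2).trans h2
  · constructor <;> linarith

theorem Icc_subset_timeInterval {T : EReal} {t₀ : ℝ} (ht₀ : t₀ ∈ timeInterval T) :
    Set.Icc 0 t₀ ⊆ timeInterval T := fun _ ht =>
  ⟨ht.1, (EReal.coe_le_coe_iff.2 ht.2).trans_lt ht₀.2⟩

theorem exists_bound_family {α J E : Type*} [TopologicalSpace α] [Fintype J]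
    [SeminormedAddCommGroup E] {Q : Set α} (hQ : IsCompact Q) {g : J → α → E}
    (hg : ∀ j, ContinuousOn (g j) Q) : ∃ C, 0 ≤ C ∧ ∀ j, ∀ q ∈ Q, ‖g j q‖ ≤ C := by
  choose C hC using fun j => hQ.exists_bound_of_continuousOn (hg j)
  refine ⟨∑ j, |C j|, Finset.sum_nonneg fun _ _ => abs_nonneg _, fun j q hq => ?_⟩
  exact ((hC j q hq).trans (le_abs_self _)).trans
    (Finset.single_le_sum (f := fun j => |C j|) (fun _ _ => abs_nonneg _) (Finset.mem_univ j))

section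
variable {h : ℝ → FormField s} {T : EReal}

theorem continuousOn_jetOne (hT : 0 < T)
    (hs : ∀ i j, ContDiffOn ℝ ∞ (fun q : ℝ × Coord s => h q.1 q.2 i j)
      (timeInterval T ×ˢ domain s)) :
    ContinuousOn (fun q : ℝ × Coord s => jetOne (h q.1) q.2) (timeInterval T ×ˢ domain s) := by
  refine ContinuousOn.prodMk ?_ ?_
  · exact continuousOn_pi.2 fun k => continuousOn_pi.2 fun l => (hs k l).continuousOn
  · exact continuousOn_pi.2 fun k => continuousOn_pi.2 fun l =>
      (contDiffOn_fderiv_snd (f := fun t y => h t y k l) (timeInterval_uniqueDiffOn hT)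
        isOpen_domain (hs k l)).continuousOn

theorem continuousOn_jetTwo (hT : 0 < T)
    (hs : ∀ i j, ContDiffOn ℝ ∞ (fun q : ℝ × Coord s => h q.1 q.2 i j)
      (timeInterval T ×ˢ domain s)) :
    ContinuousOn (fun q : ℝ × Coord s => jetTwo (h q.1) q.2) (timeInterval T ×ˢ domain s) :=
  continuousOn_pi.2 fun k => continuousOn_pi.2 fun l =>
    (contDiffOn_fderiv_snd (f := fun t => fderiv ℝ fun y => h t y k l)
      (timeInterval_uniqueDiffOn hT) isOpen_domain
      (contDiffOn_fderiv_snd (f := fun t y => h t y k l) (timeInterval_uniqueDiffOn hT)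
        isOpen_domain (hs k l))).continuousOn

end

variable {K : Type*} [Field K] [NumberField K]

theorem Data.IsHermitianMetric.isMetric {X : Data s K} {h : FormField s}
    (hh : X.IsHermitianMetric h) : IsMetric h := ⟨hh.1, hh.2.1⟩

theorem exists_lipschitz_of_contDiffOn {E F : Type*} [NormedAddCommGroup E] [NormedSpace ℝ E]
    [NormedAddCommGroup F] [NormedSpace ℝ F] {f : E → F} {U Q : Set E} (hU : IsOpen U)
    (hf : ContDiffOn ℝ ∞ f U) (hQ : IsCompact Q) (hQU : Q ⊆ U) :
    ∃ L, 0 ≤ L ∧ ∀ a ∈ Q, ∀ b ∈ Q, ‖f a - f b‖ ≤ L * ‖a - b‖ := by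
  obtain ⟨L, hL⟩ := LocallyLipschitzOn.exists_lipschitzOnWith_of_compact (f := f) hQ fun q hq => by
    obtain ⟨L, t, ht, hLt⟩ :=
      ((hf.contDiffAt (hU.mem_nhds (hQU hq))).of_le (by simp)).exists_lipschitzOnWith
    exact ⟨L, t, mem_nhdsWithin_of_mem_nhds ht, hLt⟩
  refine ⟨L, L.2, fun a ha b hb => ?_⟩
  rw [← dist_eq_norm, ← dist_eq_norm]
  exact hL.dist_le_mul a ha b hb

/-- Lipschitz dependence of the evolution on the one-jet, uniformly on compact sets. -/
theorem exists_lipschitz_evolution {h₁ h₂ : ℝ → FormField s} {Q : Set (ℝ × Coord s)}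
    (hQ : IsCompact Q)
    (c₁ : ContinuousOn (fun q : ℝ × Coord s => jetOne (h₁ q.1) q.2) Q)
    (c₂ : ContinuousOn (fun q : ℝ × Coord s => jetOne (h₂ q.1) q.2) Q)
    (c₃ : ContinuousOn (fun q : ℝ × Coord s => jetTwo (h₂ q.1) q.2) Q)
    (d₁ : ∀ q ∈ Q, (h₁ q.1 q.2).det ≠ 0) (d₂ : ∀ q ∈ Q, (h₂ q.1 q.2).det ≠ 0) :
    ∃ L, 0 ≤ L ∧ ∀ k l, ∀ q ∈ Q,
      ‖evolution k l (jetOne (h₁ q.1) q.2, jetTwo (h₂ q.1) q.2)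
        - evolution k l (jetOne (h₂ q.1) q.2, jetTwo (h₂ q.1) q.2)‖
      ≤ L * ‖jetOne (h₁ q.1) q.2 - jetOne (h₂ q.1) q.2‖ := by
  -- The one-jets of both solutions are paired with the two-jet of the second one only. The
  -- difference of the second derivatives belongs to the principal part and must not be estimated.
  set 𝒦 := (fun q : ℝ × Coord s => (jetOne (h₁ q.1) q.2, jetTwo (h₂ q.1) q.2)) '' Q
    ∪ (fun q : ℝ × Coord s => (jetOne (h₂ q.1) q.2, jetTwo (h₂ q.1) q.2)) '' Q with h𝒦
  have hc : IsCompact 𝒦 := (hQ.image_of_continuousOn (c₁.prodMk c₃)).union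
    (hQ.image_of_continuousOn (c₂.prodMk c₃))
  have hopen : IsOpen {q : Jet s |
        (Matrix.of q.1.1).det ≠ 0} :=
    isOpen_det_ne_zero.preimage (continuous_fst.comp continuous_fst)
  have hsub : 𝒦 ⊆ {q : Jet s | (Matrix.of q.1.1).det ≠ 0} := by
    rintro q (⟨a, ha, rfl⟩ | ⟨a, ha, rfl⟩)
    · exact d₁ a ha
    · exact d₂ a ha
  choose L hL0 hL using fun kl : (Fin s ⊕ Fin s) × (Fin s ⊕ Fin s) =>
    exists_lipschitz_of_contDiffOn (E := Jet s) hopen (contDiffOn_evolution kl.1 kl.2) hc hsub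
  refine ⟨∑ kl, L kl, Finset.sum_nonneg fun _ _ => hL0 _, fun k l q hq => ?_⟩
  have m₁ : (jetOne (h₁ q.1) q.2, jetTwo (h₂ q.1) q.2) ∈ 𝒦 := Or.inl ⟨q, hq, rfl⟩
  have m₂ : (jetOne (h₂ q.1) q.2, jetTwo (h₂ q.1) q.2) ∈ 𝒦 := Or.inr ⟨q, hq, rfl⟩
  refine (hL (k, l) _ m₁ _ m₂).trans ?_
  rw [Prod.mk_sub_mk, sub_self, Prod.norm_def, norm_zero, max_eq_left (norm_nonneg _)]
  exact mul_le_mul_of_nonneg_right (Finset.single_le_sum (f := L) (fun _ _ => hL0 _)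
    (Finset.mem_univ (k, l))) (norm_nonneg _)

end OT

/-! ### The invariant distance of two solutions. -/

namespace OT

open Complex

variable {s : ℕ}

/-- The factor that turns the coefficients of a form into invariant quantities. -/
noncomputable def weightPair (j : (Fin s ⊕ Fin s) × (Fin s ⊕ Fin s)) (x : Coord s) : ℂ :=
  ((weight x j.1 * weight x j.2 : ℝ) : ℂ)

theorem smooth_weightPair (j : (Fin s ⊕ Fin s) × (Fin s ⊕ Fin s)) : Smooth (weightPair j) :=
  ofRealCLM.contDiff.comp_contDiffOn ((contDiffOn_weight j.1).mul (contDiffOn_weight j.2))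

theorem weightPair_ne_zero (j : (Fin s ⊕ Fin s) × (Fin s ⊕ Fin s)) {x : Coord s}
    (hx : x ∈ domain s) : weightPair j x ≠ 0 :=
  ofReal_ne_zero.2 (mul_pos (weight_pos hx _) (weight_pos hx _)).ne'

theorem norm_weightPair (j : (Fin s ⊕ Fin s) × (Fin s ⊕ Fin s)) {x : Coord s}
    (hx : x ∈ domain s) : ‖weightPair j x‖ = weight x j.1 * weight x j.2 := by
  rw [weightPair, norm_real, Real.norm_of_nonneg
    (mul_pos (weight_pos hx _) (weight_pos hx _)).le]

/-- The invariant squared distance of two forms. -/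
noncomputable def distSq (h₁ h₂ : FormField s) (x : Coord s) : ℝ :=
  ∑ j : (Fin s ⊕ Fin s) × (Fin s ⊕ Fin s), ‖weightPair j x * (h₁ x j.1 j.2 - h₂ x j.1 j.2)‖ ^ 2

/-- At a spatial maximum of the squared distance of two solutions, its time derivative is bounded
by a multiple of the squared distance. -/
theorem exists_deriv_distSq_le {h₁ h₂ : ℝ → FormField s} {T : EReal} (hT : 0 < T)
    (hs₁ : ∀ i j, ContDiffOn ℝ ∞ (fun q : ℝ × Coord s => h₁ q.1 q.2 i j)
      (timeInterval T ×ˢ domain s))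
    (hs₂ : ∀ i j, ContDiffOn ℝ ∞ (fun q : ℝ × Coord s => h₂ q.1 q.2 i j)
      (timeInterval T ×ˢ domain s))
    (hm₁ : ∀ t ∈ timeInterval T, IsMetric (h₁ t)) (hm₂ : ∀ t ∈ timeInterval T, IsMetric (h₂ t))
    (he₁ : ∀ t ∈ timeInterval T, ∀ x ∈ domain s, ∀ k l, HasDerivWithinAt (fun t' => h₁ t' x k l)
      (evolution k l (jetOne (h₁ t) x, jetTwo (h₁ t) x)) (timeInterval T) t)
    (he₂ : ∀ t ∈ timeInterval T, ∀ x ∈ domain s, ∀ k l, HasDerivWithinAt (fun t' => h₂ t' x k l)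
      (evolution k l (jetOne (h₂ t) x, jetTwo (h₂ t) x)) (timeInterval T) t)
    {t₀ : ℝ} (ht₀ : t₀ ∈ timeInterval T) {D : Set (Coord s)} (hD : IsCompact D)
    (hDΩ : D ⊆ domain s) :
    ∃ C, ∀ t ∈ Set.Icc 0 t₀, ∀ x ∈ D,
      (∀ y ∈ domain s, distSq (h₁ t) (h₂ t) y ≤ distSq (h₁ t) (h₂ t) x) →
      ∃ f', HasDerivWithinAt (fun t => distSq (h₁ t) (h₂ t) x) f' (Set.Icc 0 t₀) t ∧
        f' ≤ C * distSq (h₁ t) (h₂ t) x := by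
  have hsub : Set.Icc 0 t₀ ⊆ timeInterval T := Icc_subset_timeInterval ht₀
  set Q : Set (ℝ × Coord s) := Set.Icc 0 t₀ ×ˢ D with hQdef
  have hQ : IsCompact Q := isCompact_Icc.prod hD
  have hQsub : Q ⊆ timeInterval T ×ˢ domain s := Set.prod_mono hsub hDΩ
  obtain ⟨C₁, hC₁0, hC₁⟩ := exists_bound_family hD
    (g := fun j : (Fin s ⊕ Fin s) × (Fin s ⊕ Fin s) => weightPair j)
    fun j => (ContDiffOn.continuousOn (smooth_weightPair j)).mono hDΩ
  obtain ⟨C₂, hC₂0, hC₂⟩ := exists_bound_family hD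
    (g := fun (j : (Fin s ⊕ Fin s) × (Fin s ⊕ Fin s)) x => (weightPair j x)⁻¹)
    fun j => ((ContDiffOn.continuousOn (smooth_weightPair j)).mono hDΩ).inv₀
      fun x hx => weightPair_ne_zero j (hDΩ hx)
  obtain ⟨C₃, hC₃0, hC₃⟩ := exists_bound_family hD
    (g := fun j : (Fin s ⊕ Fin s) × (Fin s ⊕ Fin s) => fderiv ℝ (weightPair j))
    fun j => (smooth_weightPair j).fderiv.continuousOn.mono hDΩ
  obtain ⟨C₄, hC₄0, hC₄⟩ := exists_bound_family hD
    (g := fun j : (Fin s ⊕ Fin s) × (Fin s ⊕ Fin s) => fderiv ℝ (fderiv ℝ (weightPair j)))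
    fun j => (((smooth_weightPair j).fderiv.fderiv_of_isOpen isOpen_domain
      (m := ∞) (by simp)).continuousOn).mono hDΩ
  obtain ⟨C₅, hC₅0, hC₅⟩ := exists_bound_family hQ
    (g := fun (i : Fin s ⊕ Fin s) (q : ℝ × Coord s) => h₁ q.1 q.2 i i)
    fun i => (hs₁ i i).continuousOn.mono hQsub
  obtain ⟨C₆, hC₆0, hC₆⟩ := exists_bound_family hQ
    (g := fun (i : Fin s ⊕ Fin s) (q : ℝ × Coord s) => (h₁ q.1 q.2)⁻¹ i i)
    fun i => ContinuousOn.comp (g := invEntry i i) (f := fun (q : ℝ × Coord s) a b => h₁ q.1 q.2 a b)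
      (contDiffOn_invEntry i i).continuousOn
      (continuousOn_pi.2 fun a => continuousOn_pi.2 fun b => (hs₁ a b).continuousOn.mono hQsub)
      fun q hq => (hm₁ q.1 (hsub hq.1)).det_ne_zero (hDΩ hq.2)
  obtain ⟨L, hL0, hL⟩ := exists_lipschitz_evolution hQ
    ((continuousOn_jetOne hT hs₁).mono hQsub) ((continuousOn_jetOne hT hs₂).mono hQsub)
    ((continuousOn_jetTwo hT hs₂).mono hQsub)
    (fun q hq => (hm₁ q.1 (hsub hq.1)).det_ne_zero (hDΩ hq.2))
    (fun q hq => (hm₂ q.1 (hsub hq.1)).det_ne_zero (hDΩ hq.2))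
  -- One constant dominates the weights, their inverses and two derivatives, the diagonals of the
  -- first metric and of its inverse, and the Lipschitz constant.
  set C₀ := 1 + C₁ + C₂ + C₃ + C₄ + C₅ + C₆ + L with hC₀
  obtain ⟨C, hC, hbound⟩ := exists_bound_of_frame s (C₀ := C₀) (by linarith)
    (J := (Fin s ⊕ Fin s) × (Fin s ⊕ Fin s))
  refine ⟨(2 * C + 2 * C ^ 2 * (Fintype.card (((Fin s ⊕ Fin s) ⊕ (Fin s ⊕ Fin s)) ×
    ((Fin s ⊕ Fin s) × (Fin s ⊕ Fin s))) + 1)) * Fintype.card ((Fin s ⊕ Fin s) × (Fin s ⊕ Fin s)),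
    fun t ht x hx hmax => ?_⟩
  have hxΩ := hDΩ hx
  have htT := hsub ht
  have m₁ := hm₁ t htT
  have m₂ := hm₂ t htT
  obtain ⟨b, hb1, hb2, hb3⟩ := exists_frame (M := C₀) (m₁.posDef x hxΩ)
    (fun i => (hC₅ i (t, x) ⟨ht, hx⟩).trans (by linarith))
    (fun i => (hC₆ i (t, x) ⟨ht, hx⟩).trans (by linarith)) (by linarith)
  have hd : ∀ j : (Fin s ⊕ Fin s) × (Fin s ⊕ Fin s),
      Smooth fun y => h₁ t y j.1 j.2 - h₂ t y j.1 j.2 := fun j =>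
    (m₁.smooth _ _).sub (m₂.smooth _ _)
  have hd₁ : ∀ j : (Fin s ⊕ Fin s) × (Fin s ⊕ Fin s),
      fderiv ℝ (fun y => h₁ t y j.1 j.2 - h₂ t y j.1 j.2) x
        = fderiv ℝ (fun y => h₁ t y j.1 j.2) x - fderiv ℝ (fun y => h₂ t y j.1 j.2) x := fun j =>
    fderiv_fun_sub ((m₁.smooth _ _).differentiableAt hxΩ) ((m₂.smooth _ _).differentiableAt hxΩ)
  have hd₂ : ∀ j : (Fin s ⊕ Fin s) × (Fin s ⊕ Fin s),
      leviTrace (h₁ t x) (fderiv ℝ (fderiv ℝ fun y => h₁ t y j.1 j.2 - h₂ t y j.1 j.2) x)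
        = leviTrace (h₁ t x) (fderiv ℝ (fderiv ℝ fun y => h₁ t y j.1 j.2) x)
          - leviTrace (h₁ t x) (fderiv ℝ (fderiv ℝ fun y => h₂ t y j.1 j.2) x) := fun j => by
    have e : fderiv ℝ (fderiv ℝ fun y => h₁ t y j.1 j.2 - h₂ t y j.1 j.2) x
        = fderiv ℝ (fderiv ℝ fun y => h₁ t y j.1 j.2) x
          - fderiv ℝ (fderiv ℝ fun y => h₂ t y j.1 j.2) x := by
      have : fderiv ℝ (fun y => h₁ t y j.1 j.2 - h₂ t y j.1 j.2) =ᶠ[nhds x]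
          fun y => fderiv ℝ (fun y => h₁ t y j.1 j.2) y - fderiv ℝ (fun y => h₂ t y j.1 j.2) y :=
        Filter.eventually_of_mem (domain_mem_nhds hxΩ) fun y hy =>
          fderiv_fun_sub ((m₁.smooth _ _).differentiableAt hy) ((m₂.smooth _ _).differentiableAt hy)
      rw [this.fderiv_eq]
      exact fderiv_fun_sub
        (((m₁.smooth j.1 j.2).fderiv.contDiffAt (domain_mem_nhds hxΩ)).differentiableAt (by simp))
        (((m₂.smooth j.1 j.2).fderiv.contDiffAt (domain_mem_nhds hxΩ)).differentiableAt (by simp))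
    rw [e]
    simp only [leviTrace, levi, holPart, antiPart, sub_apply, ← Finset.sum_sub_distrib]
    exact Finset.sum_congr rfl fun i _ => Finset.sum_congr rfl fun m _ => by ring
  have hK := fun j => (smooth_weightPair j).mul (hd j)
  refine ⟨∑ j, 2 * inner ℝ (weightPair j x * (h₁ t x j.1 j.2 - h₂ t x j.1 j.2))
      (weightPair j x * (evolution j.1 j.2 (jetOne (h₁ t) x, jetTwo (h₁ t) x)
        - evolution j.1 j.2 (jetOne (h₂ t) x, jetTwo (h₂ t) x))), ?_, ?_⟩
  · refine HasDerivWithinAt.fun_sum fun j _ => HasDerivWithinAt.norm_sq ?_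
    exact (((he₁ t htT x hxΩ j.1 j.2).sub (he₂ t htT x hxΩ j.1 j.2)).const_mul _).mono hsub
  · refine deriv_le_of_second_derivative_test hC
      (k₁ := fun a j => fderiv ℝ
        (fun y => weightPair j y * (h₁ t y j.1 j.2 - h₂ t y j.1 j.2)) x (b a))
      (k₂ := fun a j => fderiv ℝ (fderiv ℝ
        fun y => weightPair j y * (h₁ t y j.1 j.2 - h₂ t y j.1 j.2)) x (b a) (b a)) ?_ ?_
    · exact fun a => sum_inner_fderiv_le hK hxΩ hmax (b a)
    · intro j
      have key := hbound b (fun j => weightPair j x)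
        (fun j => h₁ t x j.1 j.2 - h₂ t x j.1 j.2)
        (fun j => evolution j.1 j.2 (jetOne (h₁ t) x, jetTwo (h₂ t) x)
          - evolution j.1 j.2 (jetOne (h₂ t) x, jetTwo (h₂ t) x))
        (fun j => fderiv ℝ (weightPair j) x)
        (fun j => fderiv ℝ (fun y => h₁ t y j.1 j.2 - h₂ t y j.1 j.2) x)
        (fun j => fderiv ℝ (fderiv ℝ (weightPair j)) x)
        (fun j => fderiv ℝ (fderiv ℝ fun y => h₁ t y j.1 j.2 - h₂ t y j.1 j.2) x)
        hb2 hb3 (fun j => weightPair_ne_zero j hxΩ)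
        (fun j => (hC₁ j x hx).trans (by linarith)) (fun j => (hC₂ j x hx).trans (by linarith))
        (fun j => (hC₃ j x hx).trans (by linarith)) (fun j => (hC₄ j x hx).trans (by linarith))
        (fun j => ?_) j
      · have e1 : ∀ a i, fderiv ℝ
            (fun y => weightPair i y * (h₁ t y i.1 i.2 - h₂ t y i.1 i.2)) x (b a)
            = fderiv ℝ (weightPair i) x (b a) * (h₁ t x i.1 i.2 - h₂ t x i.1 i.2)
              + weightPair i x
                * fderiv ℝ (fun y => h₁ t y i.1 i.2 - h₂ t y i.1 i.2) x (b a) := fun a i => by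
          rw [fderiv_fun_mul ((smooth_weightPair i).differentiableAt hxΩ)
            ((hd i).differentiableAt hxΩ)]
          simp only [add_apply, smul_apply, smul_eq_mul]
          ring
        -- The difference of the two equations splits into a term with equal two-jets, which is
        -- Lipschitz in the one-jet, and the Levi trace of the difference with respect to the first
        -- metric, which is the frame Laplacian.
        have e2 : evolution j.1 j.2 (jetOne (h₁ t) x, jetTwo (h₂ t) x)
            - evolution j.1 j.2 (jetOne (h₂ t) x, jetTwo (h₂ t) x)
            + (1 / 4) * ∑ a, fderiv ℝ (fderiv ℝ fun y => h₁ t y j.1 j.2 - h₂ t y j.1 j.2) x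
              (b a) (b a)
            = evolution j.1 j.2 (jetOne (h₁ t) x, jetTwo (h₁ t) x)
              - evolution j.1 j.2 (jetOne (h₂ t) x, jetTwo (h₂ t) x) := by
          rw [← hb1 _ (fderiv_fderiv_symm (hd j) hxΩ), hd₂]
          change leviTrace (h₁ t x) _ - _ - _ + _ = leviTrace (h₁ t x) _ - _ - _
          simp only [jetTwo]
          ring
        simp only [e1, fderiv_mul_apply_apply (smooth_weightPair _) (hd _) hxΩ]
        simp only [e2] at key
        exact key
      · refine (hL j.1 j.2 (t, x) ⟨ht, hx⟩).trans ?_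
        refine mul_le_mul (by linarith) ?_ (norm_nonneg _) (by linarith)
        refine (norm_jetOne_sub_le _ _ _).trans (le_of_eq ?_)
        exact Finset.sum_congr rfl fun i _ => by rw [hd₁]

variable {K : Type*} [Field K] [NumberField K]

theorem Data.distSq_orbit {X : Data s K} {h₁ h₂ : FormField s} (h₁i : X.Invariant h₁)
    (h₂i : X.Invariant h₂) {c : Fin s → Fin s → ℝ} (hc : X.Twist c) {u : (𝓞 K)ˣ}
    (hu : u ∈ X.U) (a : 𝓞 K) {x : Coord s} (hx : x ∈ domain s) :
    distSq h₁ h₂ (X.emb ((u : 𝓞 K) : K) * x + X.emb (a : K)) = distSq h₁ h₂ x := by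
  refine Finset.sum_congr rfl fun j _ => ?_
  rw [norm_mul, norm_mul, norm_weightPair j hx, norm_weightPair j (X.mem_domain hu _ hx),
    h₁i.weight_mul_norm h₂i hc hu a hx]

theorem eq_of_distSq_le_zero {h₁ h₂ : FormField s} {x : Coord s} (hx : x ∈ domain s)
    (h : distSq h₁ h₂ x ≤ 0) : h₁ x = h₂ x := by
  ext k l
  have h0 : distSq h₁ h₂ x = 0 := le_antisymm h (Finset.sum_nonneg fun _ _ => sq_nonneg _)
  have h1 := (Finset.sum_eq_zero_iff_of_nonneg fun _ _ => sq_nonneg _).1 h0 (k, l)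
    (Finset.mem_univ _)
  have h2 := norm_eq_zero.1 (pow_eq_zero_iff (two_ne_zero)|>.1 h1)
  exact sub_eq_zero.1 ((mul_eq_zero.1 h2).resolve_left (weightPair_ne_zero _ hx))

/-- Uniqueness of the pluriclosed flow on an Oeljeklaus-Toma manifold. -/
theorem Data.IsPluriclosedFlow.unique {X : Data s K} {c : Fin s → Fin s → ℝ} (hc : X.Twist c)
    {T : EReal} (hT : 0 < T) {h₀ : FormField s} {h₁ h₂ : ℝ → FormField s}
    (f₁ : X.IsPluriclosedFlow T h₀ h₁) (f₂ : X.IsPluriclosedFlow T h₀ h₂) :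
    ∀ t ∈ timeInterval T, ∀ x ∈ domain s, h₁ t x = h₂ t x := by
  intro t₀ ht₀ x hx
  obtain ⟨D, hD, hDΩ, horb⟩ := X.exists_compact
  have ev : ∀ {h : ℝ → FormField s}, X.IsPluriclosedFlow T h₀ h → ∀ t ∈ timeInterval T,
      ∀ x ∈ domain s, ∀ k l, HasDerivWithinAt (fun t' => h t' x k l)
        (evolution k l (jetOne (h t) x, jetTwo (h t) x)) (timeInterval T) t := by
    intro h f t ht x hx k l
    obtain ⟨Γ, hΓ, hd⟩ := f.equation t ht
    exact hasDerivWithinAt_evolution (f.isHermitianMetric t ht).isMetric (f.isPluriclosed t ht) hΓ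
      hx (hd x hx) k l
  obtain ⟨C, hC⟩ := exists_deriv_distSq_le hT f₁.smooth f₂.smooth
    (fun t ht => (f₁.isHermitianMetric t ht).isMetric)
    (fun t ht => (f₂.isHermitianMetric t ht).isMetric) (ev f₁) (ev f₂) ht₀ hD hDΩ
  have hsub : Set.Icc 0 t₀ ⊆ timeInterval T := Icc_subset_timeInterval ht₀
  refine eq_of_distSq_le_zero hx (le_zero_of_deriv_le_at_max hD
    (f := fun t x => distSq (h₁ t) (h₂ t) x) (Ω := domain s) (t₀ := t₀) ?_ ?_ ?_ C
    (fun t ht => hC t (Set.Ioc_subset_Icc_self ht)) t₀ ⟨ht₀.1, le_rfl⟩ x hx)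
  · intro t ht x hx
    obtain ⟨u, hu, a, hua⟩ := horb x hx
    exact ⟨_, hua, Data.distSq_orbit (f₁.isHermitianMetric t (hsub ht)).2.2
      (f₂.isHermitianMetric t (hsub ht)).2.2 hc hu a hx⟩
  · have hQ : Set.Icc 0 t₀ ×ˢ D ⊆ timeInterval T ×ˢ domain s := Set.prod_mono hsub hDΩ
    refine continuousOn_finsetSum _ fun j _ => ContinuousOn.pow (ContinuousOn.norm ?_) 2
    refine ContinuousOn.mul ?_ (((f₁.smooth j.1 j.2).continuousOn.mono hQ).sub
      ((f₂.smooth j.1 j.2).continuousOn.mono hQ))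
    exact ((ContDiffOn.continuousOn (smooth_weightPair j)).mono hDΩ).comp continuousOn_snd
      fun q hq => hq.2
  · intro x hx
    refine Finset.sum_eq_zero fun j _ => ?_
    rw [f₁.initial x (hDΩ hx), f₂.initial x (hDΩ hx)]
    simp

end OT

namespace OT

open Complex

variable {s : ℕ}

/-! ### The system of ordinary differential equations -/

/-- The conserved potential of the system of ordinary differential equations. -/
noncomputable def potential (a n μ l : ℝ) : ℝ := a * Real.exp l + n * Real.exp (-μ * l) / μ

/-- With `a = A₀ B` and `n = |C₀|²`, the derivative is the determinant `AB - |C|²` of the block at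
parameter `l`. -/
theorem hasDerivAt_potential {a n μ : ℝ} (hμ : 0 < μ) (l : ℝ) :
    HasDerivAt (potential a n μ) (a * Real.exp l - n * Real.exp (-μ * l)) l := by
  have h1 := ((Real.hasDerivAt_exp l).const_mul a).add
    (((((hasDerivAt_id l).const_mul (-μ)).exp).const_mul n).div_const μ)
  refine (h1.congr_deriv ?_).congr_of_eventuallyEq (Filter.Eventually.of_forall fun t => ?_)
  · simp only [id]; field_simp; ring
  · simp [potential]

theorem contDiff_potential (a n μ : ℝ) : ContDiff ℝ ∞ (potential a n μ) := by
  unfold potential; fun_prop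

/-- The set is where the derivative is positive. It is closed upwards, hence an interval, because
`eˡ` grows and `e^(-μ l)` decreases. -/
theorem potential_strictMonoOn {a n μ : ℝ} (ha : 0 < a) (hn : 0 ≤ n) (hμ : 0 < μ) :
    StrictMonoOn (potential a n μ) {l | n * Real.exp (-μ * l) < a * Real.exp l} := by
  have hup : ∀ l ∈ {l | n * Real.exp (-μ * l) < a * Real.exp l}, ∀ l', l ≤ l' →
      l' ∈ {l | n * Real.exp (-μ * l) < a * Real.exp l} := by
    intro l hl l' hll
    have h1 : Real.exp (-μ * l') ≤ Real.exp (-μ * l) := Real.exp_le_exp.2 (by nlinarith)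
    have h2 : Real.exp l ≤ Real.exp l' := Real.exp_le_exp.2 hll
    exact (mul_le_mul_of_nonneg_left h1 hn).trans_lt
      (lt_of_lt_of_le hl (mul_le_mul_of_nonneg_left h2 ha.le))
  refine strictMonoOn_of_deriv_pos ?_ (contDiff_potential a n μ).continuous.continuousOn
    fun l hl => ?_
  · rw [convex_iff_ordConnected]
    exact ⟨fun x hx y _ z hz => hup x hx z hz.1⟩
  · rw [(hasDerivAt_potential hμ l).deriv]
    have := interior_subset hl
    exact sub_pos.2 this

theorem mem_potential_set {a n μ l : ℝ} (hn : 0 ≤ n) (hna : n < a) (hμ : 0 < μ) (hl : 0 ≤ l) :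
    n * Real.exp (-μ * l) < a * Real.exp l := by
  have h1 : Real.exp (-μ * l) ≤ 1 := Real.exp_le_one_iff.2 (by nlinarith)
  have h2 : 1 ≤ Real.exp l := Real.one_le_exp hl
  nlinarith

theorem exists_potential_eq {a n μ v : ℝ} (hn : 0 ≤ n) (hna : n < a) (hμ : 0 < μ) (hv : 0 < v)
    {t : ℝ} (ht : 0 ≤ t) : ∃ l, 0 ≤ l ∧ potential a n μ l = potential a n μ 0 + v * t := by
  have ha : 0 < a := hn.trans_lt hna
  set y := potential a n μ 0 + v * t with hy
  have hR : 0 ≤ y / a := by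
    have : 0 ≤ potential a n μ 0 := by unfold potential; positivity
    positivity
  have h1 : y ≤ potential a n μ (y / a) := by
    have h2 := Real.add_one_le_exp (y / a)
    have h3 : 0 ≤ n * Real.exp (-μ * (y / a)) / μ := by positivity
    have h4 : a * (y / a) = y := by field_simp
    unfold potential
    nlinarith
  obtain ⟨l, hl, e⟩ := intermediate_value_Icc hR
    (contDiff_potential a n μ).continuous.continuousOn
    -- The endpoint `y / a` is large enough because `a e^(y/a) ≥ a (y/a + 1) ≥ y`.
    (show y ∈ Set.Icc (potential a n μ 0) (potential a n μ (y / a)) from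
      ⟨by rw [hy]; nlinarith, h1⟩)
  exact ⟨l, hl.1, e⟩

/-- The intermediate value theorem gives `l` at every time, injectivity fixes `l 0`, and the inverse
function theorem gives smoothness up to the endpoint. -/
theorem exists_potential_inverse {a n μ v : ℝ} (hn : 0 ≤ n) (hna : n < a) (hμ : 0 < μ)
    (hv : 0 < v) : ∃ l : ℝ → ℝ, l 0 = 0 ∧ (∀ t, 0 ≤ t → 0 ≤ l t) ∧
      (∀ t, 0 ≤ t → potential a n μ (l t) = potential a n μ 0 + v * t) ∧
      ContDiffOn ℝ ∞ l (Set.Ici 0) := by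
  have ha : 0 < a := hn.trans_lt hna
  have hmono := potential_strictMonoOn (a := a) (n := n) ha hn hμ
  have hex : ∀ t : ℝ, ∃ l, 0 ≤ t → 0 ≤ l ∧ potential a n μ l = potential a n μ 0 + v * t := by
    intro t
    by_cases ht : 0 ≤ t
    · obtain ⟨l, h1⟩ := exists_potential_eq hn hna hμ hv ht
      exact ⟨l, fun _ => h1⟩
    · exact ⟨0, fun h => absurd h ht⟩
  choose l hl using hex
  have hS : ∀ t, 0 ≤ t → l t ∈ {l | n * Real.exp (-μ * l) < a * Real.exp l} := fun t ht =>
    mem_potential_set hn hna hμ (hl t ht).1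
  refine ⟨l, ?_, fun t ht => (hl t ht).1, fun t ht => (hl t ht).2, ?_⟩
  · refine hmono.injOn (hS 0 le_rfl) (mem_potential_set hn hna hμ le_rfl) ?_
    rw [(hl 0 le_rfl).2]; ring
  · intro t₀ ht₀
    have hd : a * Real.exp (l t₀) - n * Real.exp (-μ * l t₀) ≠ 0 := (sub_pos.2 (hS t₀ ht₀)).ne'
    have hcd : ContDiffAt ℝ ∞ (potential a n μ) (l t₀) := (contDiff_potential a n μ).contDiffAt
    have hf : HasFDerivAt (potential a n μ)
        ((ContinuousLinearEquiv.unitsEquivAut ℝ (Units.mk0 _ hd) : ℝ ≃L[ℝ] ℝ) : ℝ →L[ℝ] ℝ)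
        (l t₀) := by
      refine (hasDerivAt_potential (a := a) (n := n) hμ (l t₀)).hasFDerivAt.congr_fderiv ?_
      ext; simp
    have hst := hcd.hasStrictFDerivAt' hf (by simp)
    have hr := hst.eventually_right_inverse
    have hg := hcd.to_localInverse hf (by simp)
    have hg0 := hst.localInverse_apply_image
    have hcont : Filter.Tendsto (fun t => potential a n μ 0 + v * t) (nhdsWithin t₀ (Set.Ici 0))
        (nhds (potential a n μ (l t₀))) := by
      rw [(hl t₀ ht₀).2]
      exact ((by fun_prop : Continuous fun t : ℝ => potential a n μ 0 + v * t).tendsto t₀).mono_left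
        nhdsWithin_le_nhds
    have hopen : IsOpen {l | n * Real.exp (-μ * l) < a * Real.exp l} :=
      isOpen_lt (by fun_prop) (by fun_prop)
    -- The local inverse need not be nonnegative near `t₀ = 0`, so it is compared with `l` on the
    -- open set where the potential is injective.
    have hg1 : ∀ᶠ y in nhds (potential a n μ (l t₀)),
        hst.localInverse (potential a n μ) _ _ y ∈ {l | n * Real.exp (-μ * l) < a * Real.exp l} := by
      have hc : ContinuousAt (hst.localInverse (potential a n μ) _ _) (potential a n μ (l t₀)) :=
        hst.localInverse_continuousAt
      apply hc.eventually_mem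
      rw [hg0]
      exact hopen.mem_nhds (hS t₀ ht₀)
    have heq : l =ᶠ[nhdsWithin t₀ (Set.Ici 0)]
        fun t => hst.localInverse (potential a n μ) _ _ (potential a n μ 0 + v * t) := by
      filter_upwards [hcont.eventually hr, hcont.eventually hg1, self_mem_nhdsWithin]
        with t h1 h2 h3
      exact hmono.injOn (hS t h3) h2 (by rw [h1, (hl t h3).2])
    refine ContDiffWithinAt.congr_of_eventuallyEq ?_ heq (by
      rw [← (hl t₀ ht₀).2]; exact hg0.symm)
    have hg' : ContDiffAt ℝ ∞ (hst.localInverse (potential a n μ) _ _)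
        (potential a n μ 0 + v * t₀) := by
      rw [← (hl t₀ ht₀).2]; exact hg
    exact hg'.comp_contDiffWithinAt t₀ (by fun_prop)

/-- The complex rate of decay in the equation for `C`. -/
noncomputable def rate (c : ℝ) : ℂ := 3 / 16 + (c : ℂ) ^ 2 / 4 + I * (c : ℂ) / 4

theorem rate_re (c : ℝ) : (rate c).re = 3 / 16 + c ^ 2 / 4 := by
  have : rate c = ((3 / 16 + c ^ 2 / 4 : ℝ) : ℂ) + ((c / 4 : ℝ) : ℂ) * I := by
    unfold rate; push_cast; ring
  rw [this]; simp [-ofReal_add, -ofReal_div, -ofReal_mul, -ofReal_pow]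

theorem rate_re_pos (c : ℝ) : 0 < (rate c).re := by rw [rate_re]; positivity

/-- Explains the exponent `μ = (8/3) Re κ` of the potential: only the real part of the rate affects
the modulus, and squaring doubles `4/3`. -/
theorem norm_sq_mul_exp_rate (b : ℂ) (c l : ℝ) :
    ‖b * exp (-(4 / 3) * rate c * (l : ℂ))‖ ^ 2
      = ‖b‖ ^ 2 * Real.exp (-(8 / 3 * (rate c).re) * l) := by
  have : (-(4 / 3) * rate c * (l : ℂ)).re = -(4 / 3) * (rate c).re * l := by
    have : -(4 / 3) * rate c * (l : ℂ) = ((-(4 / 3) * l : ℝ) : ℂ) * rate c := by push_cast; ring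
    rw [this, re_ofReal_mul]; ring
  rw [norm_mul, norm_exp, this, mul_pow, ← Real.exp_nat_mul]
  congr 2; push_cast; ring

/-- The function in terms of which the solution of the system is explicit. -/
structure IsClock (A B : ℝ) (b : ℂ) (c : ℝ) (l : ℝ → ℝ) : Prop where
  zero : l 0 = 0
  nonneg : ∀ t, 0 ≤ t → 0 ≤ l t
  potential_eq : ∀ t, 0 ≤ t → potential (A * B) (‖b‖ ^ 2) (8 / 3 * (rate c).re) (l t)
    = potential (A * B) (‖b‖ ^ 2) (8 / 3 * (rate c).re) 0 + 3 / 4 * B * t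
  smooth : ContDiffOn ℝ ∞ l (Set.Ici 0)

section
variable {A B c : ℝ} {b : ℂ} {l : ℝ → ℝ}

theorem exists_isClock (c : ℝ) (hB : 0 < B) (hδ : 0 < A * B - ‖b‖ ^ 2) :
    ∃ l, IsClock A B b c l := by
  obtain ⟨l, h1, h2, h3, h4⟩ := exists_potential_inverse (a := A * B) (n := ‖b‖ ^ 2)
    (μ := 8 / 3 * (rate c).re) (v := 3 / 4 * B) (by positivity) (by linarith)
    (by have := rate_re_pos c; positivity) (by positivity)
  exact ⟨l, h1, h2, h3, h4⟩

theorem IsClock.det_pos (hl : IsClock A B b c l) (hδ : 0 < A * B - ‖b‖ ^ 2) {t : ℝ} (ht : 0 ≤ t) :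
    0 < A * Real.exp (l t) * B - ‖b * exp (-(4 / 3) * rate c * (l t : ℂ))‖ ^ 2 := by
  rw [norm_sq_mul_exp_rate]
  have := mem_potential_set (a := A * B) (n := ‖b‖ ^ 2) (μ := 8 / 3 * (rate c).re) (by positivity)
    (by linarith) (by have := rate_re_pos c; positivity) (hl.nonneg t ht)
  linarith

/-- Differentiation of the implicit equation gives `δ l' = (3/4) B`, since the derivative of the
potential is `δ`. -/
theorem IsClock.hasDerivWithinAt (hl : IsClock A B b c l) (hδ : 0 < A * B - ‖b‖ ^ 2) {t : ℝ}
    (ht : 0 ≤ t) :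
    HasDerivWithinAt l (3 / 4 * B /
      (A * Real.exp (l t) * B - ‖b * exp (-(4 / 3) * rate c * (l t : ℂ))‖ ^ 2)) (Set.Ici 0) t := by
  have h0 := hl.det_pos hδ ht
  have hμ : 0 < 8 / 3 * (rate c).re := by have := rate_re_pos c; positivity
  have h1 := ((hl.smooth t ht).differentiableWithinAt (by simp)).hasDerivWithinAt
  have h2 := (hasDerivAt_potential (a := A * B) (n := ‖b‖ ^ 2) hμ (l t)).comp_hasDerivWithinAt t h1
  have h3 : HasDerivWithinAt (fun t => potential (A * B) (‖b‖ ^ 2) (8 / 3 * (rate c).re) 0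
      + 3 / 4 * B * t) (3 / 4 * B) (Set.Ici 0) t := by
    simpa using (((hasDerivAt_id t).const_mul (3 / 4 * B)).const_add
      (potential (A * B) (‖b‖ ^ 2) (8 / 3 * (rate c).re) 0)).hasDerivWithinAt
  have h4 := ((uniqueDiffOn_Ici (0 : ℝ)) t ht).eq_deriv _ h2
    (h3.congr (fun y hy => hl.potential_eq y hy) (hl.potential_eq t ht))
  refine h1.congr_deriv ?_
  rw [norm_sq_mul_exp_rate] at h0 ⊢
  rw [eq_div_iff h0.ne', ← h4]; ring

theorem IsClock.hasDerivWithinAt_fst (hl : IsClock A B b c l) (hδ : 0 < A * B - ‖b‖ ^ 2) {t : ℝ}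
    (ht : 0 ≤ t) :
    HasDerivWithinAt (fun t => A * Real.exp (l t)) (3 / 4 *
      (1 + ‖b * exp (-(4 / 3) * rate c * (l t : ℂ))‖ ^ 2 /
      (A * Real.exp (l t) * B - ‖b * exp (-(4 / 3) * rate c * (l t : ℂ))‖ ^ 2))) (Set.Ici 0) t := by
  have h0 := hl.det_pos hδ ht
  refine (((hl.hasDerivWithinAt hδ ht).exp).const_mul A).congr_deriv ?_
  rw [one_add_div h0.ne']
  ring

theorem IsClock.hasDerivWithinAt_snd (hl : IsClock A B b c l) (hδ : 0 < A * B - ‖b‖ ^ 2) {t : ℝ}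
    (ht : 0 ≤ t) :
    HasDerivWithinAt (fun t => b * exp (-(4 / 3) * rate c * (l t : ℂ))) (-rate c *
      ((B : ℂ) * (b * exp (-(4 / 3) * rate c * (l t : ℂ))) /
      ((A * Real.exp (l t) * B - ‖b * exp (-(4 / 3) * rate c * (l t : ℂ))‖ ^ 2 : ℝ) : ℂ)))
      (Set.Ici 0) t := by
  have h0 := hl.det_pos hδ ht
  refine ((((hl.hasDerivWithinAt hδ ht).ofReal_comp.const_mul
    (-(4 / 3) * rate c)).cexp).const_mul b).congr_deriv ?_
  set δ := A * Real.exp (l t) * B - ‖b * exp (-(4 / 3) * rate c * (l t : ℂ))‖ ^ 2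
  rw [ofReal_div]
  push_cast
  ring

/-- The parameter `l` is nondecreasing because its potential increases linearly in time, and the
modulus decays with `l` at the positive rate `Re κ`. -/
theorem IsClock.antitoneOn (hl : IsClock A B b c l) (hB : 0 < B) (hδ : 0 < A * B - ‖b‖ ^ 2) :
    AntitoneOn (fun t => ‖b * exp (-(4 / 3) * rate c * (l t : ℂ))‖) (Set.Ici 0) := by
  have hμ : 0 < 8 / 3 * (rate c).re := by have := rate_re_pos c; positivity
  have hm : MonotoneOn l (Set.Ici 0) := by
    intro t₁ h1 t₂ h2 h12
    by_contra! hlt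
    have := potential_strictMonoOn (a := A * B) (n := ‖b‖ ^ 2) (by nlinarith [sq_nonneg ‖b‖])
      (by positivity) hμ
      (mem_potential_set (by positivity) (by linarith) hμ (hl.nonneg t₂ h2))
      (mem_potential_set (by positivity) (by linarith) hμ (hl.nonneg t₁ h1)) hlt
    rw [hl.potential_eq t₁ h1, hl.potential_eq t₂ h2] at this
    nlinarith
  intro t₁ h1 t₂ h2 h12
  have := hm h1 h2 h12
  refine (pow_le_pow_iff_left₀ (norm_nonneg _) (norm_nonneg _) two_ne_zero).1 ?_
  simp only [norm_sq_mul_exp_rate]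
  exact mul_le_mul_of_nonneg_left (Real.exp_le_exp.2 (by nlinarith)) (by positivity)

/-- `AB + |C|²/μ - (3/4) B t` is conserved and `|C|²` is bounded, so `A - (3/4) t` is bounded. -/
theorem IsClock.isEquivalent (hl : IsClock A B b c l) (hB : 0 < B) :
    Asymptotics.IsEquivalent Filter.atTop (fun t => A * Real.exp (l t)) (fun t => 3 / 4 * t) := by
  have hμ : 0 < 8 / 3 * (rate c).re := by have := rate_re_pos c; positivity
  set μ := 8 / 3 * (rate c).re
  have hP : ∀ t, 0 ≤ t → A * Real.exp (l t) - 3 / 4 * t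
      = (potential (A * B) (‖b‖ ^ 2) μ 0 - ‖b‖ ^ 2 * Real.exp (-μ * l t) / μ) / B := by
    intro t ht
    have := hl.potential_eq t ht
    rw [potential] at this
    rw [eq_div_iff hB.ne']
    linarith
  unfold Asymptotics.IsEquivalent
  have h1 : ((fun t => A * Real.exp (l t)) - fun t => 3 / 4 * t) =O[Filter.atTop]
      (fun _ => (1 : ℝ)) := by
    refine Asymptotics.IsBigO.of_bound
      ((|potential (A * B) (‖b‖ ^ 2) μ 0| + ‖b‖ ^ 2 / μ) / B) ?_
    filter_upwards [Filter.eventually_ge_atTop 0] with t ht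
    rw [Pi.sub_apply, hP t ht, norm_one, mul_one, norm_div, Real.norm_of_nonneg hB.le]
    refine div_le_div_of_nonneg_right ((norm_sub_le _ _).trans (add_le_add le_rfl ?_)) hB.le
    rw [Real.norm_of_nonneg (by positivity)]
    have : Real.exp (-μ * l t) ≤ 1 := Real.exp_le_one_iff.2 (by nlinarith [hl.nonneg t ht])
    exact div_le_div_of_nonneg_right (mul_le_of_le_one_right (by positivity) this) hμ.le
  refine h1.trans_isLittleO ?_
  rw [Asymptotics.isLittleO_const_left]
  right
  exact tendsto_norm_atTop_atTop.comp (Filter.tendsto_id.const_mul_atTop (by norm_num))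

/-- Positivity of the determinant is not part of the system and is proved to persist. Afterwards `L
= log (A'/A)` serves as parameter, and conservation of the potential identifies it with `l`. -/
theorem IsClock.eq_of_solves (hl : IsClock A B b c l) (hB : 0 < B) (hδ : 0 < A * B - ‖b‖ ^ 2)
    {T : EReal} {A' : ℝ → ℝ} {b' : ℝ → ℂ} (hA0 : A' 0 = A) (hb0 : b' 0 = b)
    (hA : ∀ t ∈ timeInterval T, HasDerivWithinAt A'
      (3 / 4 * (1 + ‖b' t‖ ^ 2 / (A' t * B - ‖b' t‖ ^ 2))) (timeInterval T) t)
    (hb : ∀ t ∈ timeInterval T, HasDerivWithinAt b'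
      (-rate c * ((B : ℂ) * b' t / ((A' t * B - ‖b' t‖ ^ 2 : ℝ) : ℂ))) (timeInterval T) t)
    {t₀ : ℝ} (ht₀ : t₀ ∈ timeInterval T) :
    A' t₀ = A * Real.exp (l t₀) ∧ b' t₀ = b * exp (-(4 / 3) * rate c * (l t₀ : ℂ)) := by
  have hsub := Icc_subset_timeInterval ht₀
  have hμ : 0 < 8 / 3 * (rate c).re := by have := rate_re_pos c; positivity
  have hκ := rate_re_pos c
  have hright : ∀ t ∈ Set.Ico (0 : ℝ) t₀, timeInterval T ∈ nhdsWithin t (Set.Ici t) := by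
    intro t ht
    filter_upwards [Icc_mem_nhdsGE ht.2] with y hy
    exact hsub ⟨ht.1.trans hy.1, hy.2⟩
  have hAI : ∀ t ∈ Set.Ico (0 : ℝ) t₀, HasDerivWithinAt A'
      (3 / 4 * (1 + ‖b' t‖ ^ 2 / (A' t * B - ‖b' t‖ ^ 2))) (Set.Ici t) t := fun t ht =>
    (hA t (hsub ⟨ht.1, ht.2.le⟩)).mono_of_mem_nhdsWithin (hright t ht)
  have hbI : ∀ t ∈ Set.Ico (0 : ℝ) t₀, HasDerivWithinAt b'
      (-rate c * ((B : ℂ) * b' t / ((A' t * B - ‖b' t‖ ^ 2 : ℝ) : ℂ))) (Set.Ici t) t :=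
    fun t ht => (hb t (hsub ⟨ht.1, ht.2.le⟩)).mono_of_mem_nhdsWithin (hright t ht)
  have hAc : ContinuousOn A' (Set.Icc 0 t₀) := fun t ht =>
    (hA t (hsub ht)).continuousWithinAt.mono hsub
  have hbc : ContinuousOn b' (Set.Icc 0 t₀) := fun t ht =>
    (hb t (hsub ht)).continuousWithinAt.mono hsub
  have hn : ∀ t ∈ Set.Ico (0 : ℝ) t₀, HasDerivWithinAt (fun t => ‖b' t‖ ^ 2)
      (-(2 * (rate c).re * B * ‖b' t‖ ^ 2 / (A' t * B - ‖b' t‖ ^ 2))) (Set.Ici t) t := by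
    intro t ht
    refine (hbI t ht).norm_sq.congr_deriv ?_
    rw [Complex.inner]
    have : -rate c * (↑B * b' t / ↑(A' t * B - ‖b' t‖ ^ 2)) * conj (b' t)
        = ((-(B * ‖b' t‖ ^ 2 / (A' t * B - ‖b' t‖ ^ 2)) : ℝ) : ℂ) * rate c := by
      have h1 := mul_conj' (b' t)
      push_cast
      linear_combination (-rate c * B / (A' t * B - ‖b' t‖ ^ 2)) * h1
    rw [this, re_ofReal_mul]
    ring
  -- Whenever the determinant equals its initial value its derivative is positive, as both `A' B`
  -- and `-‖b'‖²` contribute with favourable sign; it can therefore never drop below that value.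
  -- This also keeps the divisions in the system away from zero denominators.
  have hpos : ∀ t ∈ Set.Icc (0 : ℝ) t₀, A * B - ‖b‖ ^ 2 ≤ A' t * B - ‖b' t‖ ^ 2 := by
    have := image_le_of_deriv_right_lt_deriv_boundary (a := 0) (b := t₀)
      (f := fun t => -(A' t * B - ‖b' t‖ ^ 2))
      (f' := fun t => -(3 / 4 * (1 + ‖b' t‖ ^ 2 / (A' t * B - ‖b' t‖ ^ 2)) * B
        - -(2 * (rate c).re * B * ‖b' t‖ ^ 2 / (A' t * B - ‖b' t‖ ^ 2))))
      (B := fun _ => -(A * B - ‖b‖ ^ 2)) (B' := fun _ => 0)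
      (((hAc.mul continuousOn_const).sub (hbc.norm.pow 2)).neg)
      (fun t ht => (((hAI t ht).mul_const B).sub (hn t ht)).neg)
      (by simp [hA0, hb0]) (fun t => hasDerivAt_const _ _) ?_
    · intro t ht
      linarith [this ht]
    · intro t ht h
      rw [neg_inj] at h
      rw [h]
      have : 0 ≤ 2 * (rate c).re * B * ‖b' t‖ ^ 2 / (A * B - ‖b‖ ^ 2) := by positivity
      have : 0 ≤ ‖b' t‖ ^ 2 / (A * B - ‖b‖ ^ 2) := by positivity
      nlinarith
  have hδp : ∀ t ∈ Set.Icc (0 : ℝ) t₀, 0 < A' t * B - ‖b' t‖ ^ 2 := fun t ht =>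
    hδ.trans_le (hpos t ht)
  have hAp : ∀ t ∈ Set.Icc (0 : ℝ) t₀, 0 < A' t := by
    intro t ht
    have := hδp t ht
    by_contra! h
    nlinarith [sq_nonneg ‖b' t‖]
  have h0m : (0 : ℝ) ∈ Set.Icc 0 t₀ := ⟨le_rfl, ht₀.1⟩
  have hA0' : 0 < A := hA0 ▸ hAp 0 h0m
  set L : ℝ → ℝ := fun t => Real.log (A' t / A) with hL
  have hLc : ContinuousOn L (Set.Icc 0 t₀) :=
    ContinuousOn.log (hAc.div_const A) fun t ht => (div_pos (hAp t ht) hA0').ne'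
  have hexpL : ∀ t ∈ Set.Icc (0 : ℝ) t₀, A' t = A * Real.exp (L t) := by
    intro t ht
    rw [hL, Real.exp_log (div_pos (hAp t ht) hA0')]
    field_simp
  have hLd : ∀ t ∈ Set.Ico (0 : ℝ) t₀, HasDerivWithinAt L
      (3 / 4 * B / (A' t * B - ‖b' t‖ ^ 2)) (Set.Ici t) t := by
    intro t ht
    have ht' : t ∈ Set.Icc 0 t₀ := ⟨ht.1, ht.2.le⟩
    have h1 := hAp t ht'
    have h2 := hδp t ht'
    refine (((hAI t ht).div_const A).log (div_pos h1 hA0').ne').congr_deriv ?_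
    rw [one_add_div h2.ne']
    field_simp
    ring
  have hL0 : L 0 = 0 := by simp [hL, hA0, hA0'.ne']
  have hbL : ∀ t ∈ Set.Icc (0 : ℝ) t₀, b' t = b * exp (-(4 / 3) * rate c * (L t : ℂ)) := by
    -- The integrating factor `exp((4/3) κ L)` undoes the decay of `b'`, since `(4/3) L' = B/δ`.
    have := constant_of_has_deriv_right_zero (a := 0) (b := t₀)
      (f := fun t => b' t * exp (4 / 3 * rate c * (L t : ℂ))) (by fun_prop) ?_
    · intro t ht
      have h1 := this t ht
      simp only [hL0, hb0, ofReal_zero, mul_zero, exp_zero, mul_one] at h1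
      rw [← h1, mul_assoc, ← exp_add]
      ring_nf
      simp
    · intro t ht
      refine ((hbI t ht).mul (((hLd t ht).ofReal_comp.const_mul
        (4 / 3 * rate c)).cexp)).congr_deriv ?_
      rw [ofReal_div]
      push_cast
      ring
  have hΨ : ∀ t ∈ Set.Icc (0 : ℝ) t₀, potential (A * B) (‖b‖ ^ 2) (8 / 3 * (rate c).re) (L t)
      - 3 / 4 * B * t = potential (A * B) (‖b‖ ^ 2) (8 / 3 * (rate c).re) (L 0)
      - 3 / 4 * B * 0 := by
    refine constant_of_has_deriv_right_zero
      (((contDiff_potential _ _ _).continuous.comp_continuousOn hLc).sub (by fun_prop)) ?_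
    intro t ht
    have ht' : t ∈ Set.Icc 0 t₀ := ⟨ht.1, ht.2.le⟩
    have h2 := hδp t ht'
    refine (((hasDerivAt_potential hμ (L t)).comp_hasDerivWithinAt t (hLd t ht)).sub
      (((hasDerivAt_id t).const_mul (3 / 4 * B)).hasDerivWithinAt)).congr_deriv ?_
    rw [← norm_sq_mul_exp_rate, ← hbL t ht']
    have h3 : A * B * Real.exp (L t) = A' t * B := by rw [hexpL t ht']; ring
    rw [h3]
    field_simp
    ring
  have ht' : t₀ ∈ Set.Icc 0 t₀ := ⟨ht₀.1, le_rfl⟩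
  -- Both parameters have the same potential and lie where the determinant is positive, hence where
  -- the potential is injective.
  have hfin : L t₀ = l t₀ := by
    refine (potential_strictMonoOn (a := A * B) (n := ‖b‖ ^ 2) (by positivity)
      (by positivity) hμ).injOn ?_
      (mem_potential_set (by positivity) (by linarith) hμ (hl.nonneg t₀ ht₀.1)) ?_
    · have h2 := hδp t₀ ht'
      rw [hbL t₀ ht', norm_sq_mul_exp_rate, hexpL t₀ ht'] at h2
      rw [Set.mem_ofPred_eq]
      linarith
    · have := hΨ t₀ ht'
      rw [hL0] at this
      rw [hl.potential_eq t₀ ht₀.1]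
      linarith
  exact ⟨by rw [hexpL t₀ ht', hfin], by rw [hbL t₀ ht', hfin]⟩

end


/-- The coefficients `C`, indexed by all `i` (and `0` for `i` outside the range of `p`). -/
def offDiag {k : ℕ} (p : Fin k → Fin s) (C : Fin k → ℂ) (i : Fin s) : ℂ :=
  ∑ r, if p r = i then C r else 0

theorem offDiag_apply {k : ℕ} {p : Fin k → Fin s} (hp : Function.Injective p) (C : Fin k → ℂ)
    (r : Fin k) : offDiag p C (p r) = C r := by
  simp [offDiag, hp.eq_iff]

theorem offDiag_of_notMem {k : ℕ} {p : Fin k → Fin s} (C : Fin k → ℂ) {i : Fin s}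
    (hi : i ∉ Set.range p) : offDiag p C i = 0 :=
  Finset.sum_eq_zero fun r _ => if_neg fun h => hi ⟨r, h⟩

/-! ### The explicit solution of the full system. -/

section
variable {k : ℕ} {p : Fin k → Fin s} {c : Fin s → Fin s → ℝ} {A B : Fin s → ℝ} {C : Fin k → ℂ}
  {l : Fin s → ℝ → ℝ}

/-- The coefficients `A` of the explicit solution. -/
noncomputable def solA (A : Fin s → ℝ) (l : Fin s → ℝ → ℝ) (t : ℝ) (i : Fin s) : ℝ :=
  A i * Real.exp (l i t)

/-- The coefficients `C` of the explicit solution. -/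
noncomputable def solC (c : Fin s → Fin s → ℝ) (p : Fin k → Fin s) (C : Fin k → ℂ)
    (l : Fin s → ℝ → ℝ) (t : ℝ) (r : Fin k) : ℂ :=
  C r * exp (-(4 / 3) * rate (c (p r) (p r)) * (l (p r) t : ℂ))

theorem offDiag_solC (hp : Function.Injective p) (t : ℝ) (i : Fin s) :
    offDiag p (solC c p C l t) i
      = offDiag p C i * exp (-(4 / 3) * rate (c i i) * (l i t : ℂ)) := by
  by_cases hi : i ∈ Set.range p
  · obtain ⟨r, rfl⟩ := hi
    rw [offDiag_apply hp, offDiag_apply hp, solC]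
  · rw [offDiag_of_notMem _ hi, offDiag_of_notMem _ hi, zero_mul]

/-- Indices outside the range of `p` are treated as blocks with zero off-diagonal coefficient, for
which the coupled equation reduces to `A' = 3/4`. -/
theorem solvesODE_sol (hp : Function.Injective p)
    (hl : ∀ i, IsClock (A i) (B i) (offDiag p C i) (c i i) (l i))
    (hδ : ∀ i, 0 < A i * B i - ‖offDiag p C i‖ ^ 2) (T : EReal) :
    SolvesODE c p T (solA A l) (fun _ => B) (solC c p C l) := by
  have hsub : timeInterval T ⊆ Set.Ici 0 := fun t ht => ht.1
  refine ⟨fun t ht i hi => ?_, fun t ht r => ?_, fun t ht j => hasDerivWithinAt_const _ _ _,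
    fun t ht r => ?_⟩
  · have := ((hl i).hasDerivWithinAt_fst (hδ i) ht.1).mono hsub
    simpa [offDiag_of_notMem C hi, solA] using this
  · have := ((hl (p r)).hasDerivWithinAt_fst (hδ (p r)) ht.1).mono hsub
    rwa [offDiag_apply hp] at this
  · have := ((hl (p r)).hasDerivWithinAt_snd (hδ (p r)) ht.1).mono hsub
    rwa [offDiag_apply hp] at this

theorem SolvesODE.eq_sol (hp : Function.Injective p)
    (hl : ∀ i, IsClock (A i) (B i) (offDiag p C i) (c i i) (l i))
    (hB : ∀ i, 0 < B i) (hδ : ∀ i, 0 < A i * B i - ‖offDiag p C i‖ ^ 2) {T : EReal}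
    {A' B' : ℝ → Fin s → ℝ} {C' : ℝ → Fin k → ℂ} (hA0 : A' 0 = A) (hB0 : B' 0 = B)
    (hC0 : C' 0 = C) (h : SolvesODE c p T A' B' C') {t : ℝ} (ht : t ∈ timeInterval T) :
    A' t = solA A l t ∧ B' t = B ∧ C' t = solC c p C l t := by
  have hBc : ∀ t ∈ timeInterval T, B' t = B := by
    intro t ht
    have hsub := Icc_subset_timeInterval ht
    funext i
    have := constant_of_has_deriv_right_zero (a := 0) (b := t) (f := fun t => B' t i)
      (fun y hy => (h.eq_B y (hsub hy) i).continuousWithinAt.mono hsub) (fun y hy => by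
        refine (h.eq_B y (hsub ⟨hy.1, hy.2.le⟩) i).mono_of_mem_nhdsWithin ?_
        filter_upwards [Icc_mem_nhdsGE hy.2] with z hz
        exact hsub ⟨hy.1.trans hz.1, hz.2⟩) t ⟨ht.1, le_rfl⟩
    rw [this, hB0]
  have key : ∀ i, A' t i = A i * Real.exp (l i t) ∧ offDiag p (C' t) i
      = offDiag p C i * exp (-(4 / 3) * rate (c i i) * (l i t : ℂ)) := by
    intro i
    refine (hl i).eq_of_solves (hB i) (hδ i) (A' := fun t => A' t i)
      (b' := fun t => offDiag p (C' t) i) (by rw [hA0]) (by rw [hC0]) ?_ ?_ ht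
    · intro t ht
      by_cases hi : i ∈ Set.range p
      · obtain ⟨r, rfl⟩ := hi
        have := h.eq_Ap t ht r
        rw [hBc t ht] at this
        simpa only [offDiag_apply hp] using this
      · simpa [offDiag_of_notMem _ hi] using h.eq_A t ht i hi
    · intro t ht
      by_cases hi : i ∈ Set.range p
      · obtain ⟨r, rfl⟩ := hi
        have := h.eq_C t ht r
        rw [hBc t ht] at this
        simpa only [offDiag_apply hp, rate] using this
      · simpa [offDiag_of_notMem _ hi] using hasDerivWithinAt_const t (timeInterval T) (0 : ℂ)
  refine ⟨funext fun i => (key i).1, hBc t ht, funext fun r => ?_⟩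
  have := (key (p r)).2
  rwa [offDiag_apply hp, offDiag_apply hp] at this

end

end OT

namespace OT

open Complex

variable {s : ℕ}

/-! ### Metrics that split into blocks depending on one imaginary part -/

theorem hasFDerivAt_comp_im {g : ℝ → ℂ} {g' : ℂ} {x : Coord s} {i : Fin s}
    (hg : HasDerivAt g g' (x (Sum.inl i)).im) :
    HasFDerivAt (fun y : Coord s => g (y (Sum.inl i)).im)
      ((imCLM.comp (ContinuousLinearMap.proj (R := ℝ) (φ := fun _ : Fin s ⊕ Fin s => ℂ)
        (Sum.inl i))).smulRight g') x := by
  have h1 : HasFDerivAt (fun y : Coord s => (y (Sum.inl i)).im)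
      (imCLM.comp (ContinuousLinearMap.proj (R := ℝ) (φ := fun _ : Fin s ⊕ Fin s => ℂ)
        (Sum.inl i))) x :=
    (imCLM.comp (ContinuousLinearMap.proj (R := ℝ) (φ := fun _ : Fin s ⊕ Fin s => ℂ)
        (Sum.inl i))).hasFDerivAt
  exact (hg.hasFDerivAt.comp x h1).congr_fderiv (by ext v; simp)

theorem dz_comp_im {g : ℝ → ℂ} {g' : ℂ} {x : Coord s} {i : Fin s}
    (hg : HasDerivAt g g' (x (Sum.inl i)).im) (k : Fin s ⊕ Fin s) :
    dz k (fun y => g (y (Sum.inl i)).im) x = if k = Sum.inl i then -(I / 2) * g' else 0 := by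
  rw [dz, (hasFDerivAt_comp_im hg).fderiv]
  by_cases h : k = Sum.inl i
  · subst h; simp; ring
  · simp [h, Ne.symm h]

theorem dzbar_comp_im {g : ℝ → ℂ} {g' : ℂ} {x : Coord s} {i : Fin s}
    (hg : HasDerivAt g g' (x (Sum.inl i)).im) (k : Fin s ⊕ Fin s) :
    dzbar k (fun y => g (y (Sum.inl i)).im) x = if k = Sum.inl i then I / 2 * g' else 0 := by
  rw [dzbar, (hasFDerivAt_comp_im hg).fderiv]
  by_cases h : k = Sum.inl i
  · subst h; simp; ring
  · simp [h, Ne.symm h]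

/-- A matrix with four diagonal blocks. -/
def blockMat (a b c d : Fin s → ℂ) : Matrix (Fin s ⊕ Fin s) (Fin s ⊕ Fin s) ℂ :=
  Matrix.fromBlocks (Matrix.diagonal a) (Matrix.diagonal b) (Matrix.diagonal c) (Matrix.diagonal d)

section
variable (a b c d : Fin s → ℂ) (i j : Fin s)

theorem blockMat_inl_inl : blockMat a b c d (Sum.inl i) (Sum.inl j) = if i = j then a i else 0 := by
  simp [blockMat, Matrix.diagonal_apply]

theorem blockMat_inl_inr : blockMat a b c d (Sum.inl i) (Sum.inr j) = if i = j then b i else 0 := by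
  simp [blockMat, Matrix.diagonal_apply]

theorem blockMat_inr_inl : blockMat a b c d (Sum.inr i) (Sum.inl j) = if i = j then c i else 0 := by
  simp [blockMat, Matrix.diagonal_apply]

theorem blockMat_inr_inr : blockMat a b c d (Sum.inr i) (Sum.inr j) = if i = j then d i else 0 := by
  simp [blockMat, Matrix.diagonal_apply]

end

theorem blockMat_mul_inv {a b c d : Fin s → ℂ} (h : ∀ i, a i * d i - b i * c i ≠ 0) :
    blockMat a b c d * blockMat (fun i => d i / (a i * d i - b i * c i))
      (fun i => -b i / (a i * d i - b i * c i)) (fun i => -c i / (a i * d i - b i * c i))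
      (fun i => a i / (a i * d i - b i * c i)) = 1 := by
  rw [blockMat, blockMat, Matrix.fromBlocks_multiply, ← Matrix.fromBlocks_one]
  simp only [Matrix.diagonal_mul_diagonal, Matrix.diagonal_add]
  congr 1
  · rw [← Matrix.diagonal_one]; congr 1; ext i; have := h i; field_simp; ring
  · rw [← Matrix.diagonal_zero]; congr 1; ext i; have := h i; field_simp; simp
  · rw [← Matrix.diagonal_zero]; congr 1; ext i; have := h i; field_simp; simp
  · rw [← Matrix.diagonal_one]; congr 1; ext i; have := mul_inv_cancel₀ (h i)
    simp only [div_eq_mul_inv]; linear_combination this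

theorem blockMat_inv {a b c d : Fin s → ℂ} (h : ∀ i, a i * d i - b i * c i ≠ 0) :
    (blockMat a b c d)⁻¹ = blockMat (fun i => d i / (a i * d i - b i * c i))
      (fun i => -b i / (a i * d i - b i * c i)) (fun i => -c i / (a i * d i - b i * c i))
      (fun i => a i / (a i * d i - b i * c i)) :=
  Matrix.inv_eq_right_inv (blockMat_mul_inv h)

/-- A field of matrices with four diagonal blocks, whose `i`-th entries depend on `Im zᵢ`. -/
def blockField (f₁ f₂ f₃ f₄ : Fin s → ℝ → ℂ) : FormField s := fun x =>
  blockMat (fun i => f₁ i (x (Sum.inl i)).im) (fun i => f₂ i (x (Sum.inl i)).im)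
    (fun i => f₃ i (x (Sum.inl i)).im) (fun i => f₄ i (x (Sum.inl i)).im)

section
variable {f₁ f₂ f₃ f₄ g₁ g₂ g₃ g₄ : Fin s → ℝ → ℂ}

/-- The derivatives of the entries of a block field. -/
structure HasBlockDeriv (f₁ f₂ f₃ f₄ g₁ g₂ g₃ g₄ : Fin s → ℝ → ℂ) : Prop where
  one : ∀ i Y, 0 < Y → HasDerivAt (f₁ i) (g₁ i Y) Y
  two : ∀ i Y, 0 < Y → HasDerivAt (f₂ i) (g₂ i Y) Y
  three : ∀ i Y, 0 < Y → HasDerivAt (f₃ i) (g₃ i Y) Y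
  four : ∀ i Y, 0 < Y → HasDerivAt (f₄ i) (g₄ i Y) Y

/-- The pair of blocks to which a coordinate belongs. -/
def blockIdx : Fin s ⊕ Fin s → Fin s := Sum.elim id id

theorem HasBlockDeriv.exists_entry (hf : HasBlockDeriv f₁ f₂ f₃ f₄ g₁ g₂ g₃ g₄)
    (i j : Fin s ⊕ Fin s) : ∃ f g : ℝ → ℂ,
      (∀ y, blockField f₁ f₂ f₃ f₄ y i j = f (y (Sum.inl (blockIdx i))).im) ∧
      (∀ y, blockField g₁ g₂ g₃ g₄ y i j = g (y (Sum.inl (blockIdx i))).im) ∧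
      ∀ Y, 0 < Y → HasDerivAt f (g Y) Y := by
  have key : ∀ (f g : Fin s → ℝ → ℂ) (i j : Fin s), (∀ i Y, 0 < Y → HasDerivAt (f i) (g i Y) Y) →
      ∀ Y, 0 < Y → HasDerivAt (fun Y => if i = j then f i Y else 0) (if i = j then g i Y else 0) Y := by
    intro f g i j h Y hY
    split_ifs with e
    · exact h i Y hY
    · exact hasDerivAt_const _ _
  rcases i with i | i <;> rcases j with j | j
  · exact ⟨fun Y => if i = j then f₁ i Y else 0, fun Y => if i = j then g₁ i Y else 0,
      fun y => blockMat_inl_inl .., fun y => blockMat_inl_inl .., key f₁ g₁ i j hf.one⟩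
  · exact ⟨fun Y => if i = j then f₂ i Y else 0, fun Y => if i = j then g₂ i Y else 0,
      fun y => blockMat_inl_inr .., fun y => blockMat_inl_inr .., key f₂ g₂ i j hf.two⟩
  · exact ⟨fun Y => if i = j then f₃ i Y else 0, fun Y => if i = j then g₃ i Y else 0,
      fun y => blockMat_inr_inl .., fun y => blockMat_inr_inl .., key f₃ g₃ i j hf.three⟩
  · exact ⟨fun Y => if i = j then f₄ i Y else 0, fun Y => if i = j then g₄ i Y else 0,
      fun y => blockMat_inr_inr .., fun y => blockMat_inr_inr .., key f₄ g₄ i j hf.four⟩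

theorem HasBlockDeriv.dz (hf : HasBlockDeriv f₁ f₂ f₃ f₄ g₁ g₂ g₃ g₄) {x : Coord s}
    (hx : x ∈ domain s) (k i j : Fin s ⊕ Fin s) :
    dz k (fun y => blockField f₁ f₂ f₃ f₄ y i j) x
      = if k = Sum.inl (blockIdx i) then -(I / 2) * blockField g₁ g₂ g₃ g₄ x i j else 0 := by
  obtain ⟨f, g, h1, h2, h3⟩ := hf.exists_entry i j
  simp only [h1, h2]
  exact dz_comp_im (h3 _ (hx _)) k

theorem HasBlockDeriv.dzbar (hf : HasBlockDeriv f₁ f₂ f₃ f₄ g₁ g₂ g₃ g₄) {x : Coord s}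
    (hx : x ∈ domain s) (k i j : Fin s ⊕ Fin s) :
    dzbar k (fun y => blockField f₁ f₂ f₃ f₄ y i j) x
      = if k = Sum.inl (blockIdx i) then I / 2 * blockField g₁ g₂ g₃ g₄ x i j else 0 := by
  obtain ⟨f, g, h1, h2, h3⟩ := hf.exists_entry i j
  simp only [h1, h2]
  exact dzbar_comp_im (h3 _ (hx _)) k

/-- Second derivatives occur only in `zᵢ, z̄ᵢ`, so antisymmetrization leaves nothing but the second
derivative of the `dwᵢ ∧ dw̄ᵢ` entry. This is why only the fourth second derivative is required to
vanish. -/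
theorem HasBlockDeriv.isPluriclosed (hf : HasBlockDeriv f₁ f₂ f₃ f₄ g₁ g₂ g₃ g₄)
    {e₁ e₂ e₃ : Fin s → ℝ → ℂ} (hg : HasBlockDeriv g₁ g₂ g₃ g₄ e₁ e₂ e₃ 0) :
    IsPluriclosed (blockField f₁ f₂ f₃ f₄) := by
  intro x hx
  have key : ∀ i j k l : Fin s ⊕ Fin s,
      OT.dz k (OT.dzbar l (fun y => blockField f₁ f₂ f₃ f₄ y i j)) x
        = if k = Sum.inl (blockIdx i) ∧ l = Sum.inl (blockIdx i) then
          1 / 4 * blockField e₁ e₂ e₃ 0 x i j else 0 := by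
    intro i j k l
    rw [dz_congr (fun y hy => hf.dzbar hy l i j) hx]
    by_cases h : l = Sum.inl (blockIdx i)
    · simp only [h, if_true, and_true]
      have h1 : (fun y => I / 2 * blockField g₁ g₂ g₃ g₄ y i j) = fun y =>
          blockField (fun a Y => I / 2 * g₁ a Y) (fun a Y => I / 2 * g₂ a Y)
          (fun a Y => I / 2 * g₃ a Y) (fun a Y => I / 2 * g₄ a Y) y i j := by
        funext y
        rcases i with i | i <;> rcases j with j | j <;>
        simp [blockField, blockMat_inl_inl, blockMat_inl_inr, blockMat_inr_inl, blockMat_inr_inr]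
      have h2 : HasBlockDeriv (fun a Y => I / 2 * g₁ a Y) (fun a Y => I / 2 * g₂ a Y)
          (fun a Y => I / 2 * g₃ a Y) (fun a Y => I / 2 * g₄ a Y) (fun a Y => I / 2 * e₁ a Y)
          (fun a Y => I / 2 * e₂ a Y) (fun a Y => I / 2 * e₃ a Y)
          (fun a Y => I / 2 * (0 : Fin s → ℝ → ℂ) a Y) :=
        ⟨fun i Y h => (hg.one i Y h).const_mul _, fun i Y h => (hg.two i Y h).const_mul _,
          fun i Y h => (hg.three i Y h).const_mul _, fun i Y h => (hg.four i Y h).const_mul _⟩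
      rw [h1, h2.dz hx]
      have hI : ∀ e : ℂ, -(I / 2 * (I / 2 * e)) = 4⁻¹ * e := fun e => by
        linear_combination (-(1 / 4) * e) * I_sq
      congr 1
      rcases i with i | i <;> rcases j with j | j <;>
      simp [blockField, blockMat_inl_inl, blockMat_inl_inr, blockMat_inr_inl, blockMat_inr_inr, hI]
    · simp [h, OT.dz]
  intro i j k l
  simp only [key]
  rcases i with i | i <;> rcases j with j | j <;> rcases k with k | k <;> rcases l with l | l <;>
  simp [blockField, blockMat_inl_inl, blockMat_inl_inr, blockMat_inr_inl, blockMat_inr_inr,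
    blockIdx] <;> grind

theorem HasBlockDeriv.traceHol_inl (hf : HasBlockDeriv f₁ f₂ f₃ f₄ g₁ g₂ g₃ g₄)
    (hΔ : ∀ i Y, 0 < Y → f₁ i Y * f₄ i Y - f₂ i Y * f₃ i Y ≠ 0) {x : Coord s}
    (hx : x ∈ domain s) (a : Fin s) {Y : ℝ} (hY : (x (Sum.inl a)).im = Y) :
    traceHol (blockField f₁ f₂ f₃ f₄) (Sum.inl a) x
      = -(I / 2) * (f₄ a Y * g₁ a Y - f₃ a Y * g₂ a Y) / (f₁ a Y * f₄ a Y - f₂ a Y * f₃ a Y) := by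
  subst hY
  have hinv : (blockField f₁ f₂ f₃ f₄ x)⁻¹ = _ := blockMat_inv fun i => hΔ i _ (hx i)
  simp only [traceHol, hf.dz hx, hinv]
  simp [blockField, blockMat_inl_inl, blockMat_inl_inr, blockMat_inr_inl, blockIdx]
  ring

theorem HasBlockDeriv.traceHol_inr (hf : HasBlockDeriv f₁ f₂ f₃ f₄ g₁ g₂ g₃ g₄)
    (hΔ : ∀ i Y, 0 < Y → f₁ i Y * f₄ i Y - f₂ i Y * f₃ i Y ≠ 0) {x : Coord s}
    (hx : x ∈ domain s) (a : Fin s) {Y : ℝ} (hY : (x (Sum.inl a)).im = Y) :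
    traceHol (blockField f₁ f₂ f₃ f₄) (Sum.inr a) x
      = -(I / 2) * (f₄ a Y * g₃ a Y - f₃ a Y * g₄ a Y) / (f₁ a Y * f₄ a Y - f₂ a Y * f₃ a Y) := by
  subst hY
  have hinv : (blockField f₁ f₂ f₃ f₄ x)⁻¹ = _ := blockMat_inv fun i => hΔ i _ (hx i)
  simp only [traceHol, hf.dz hx, hinv]
  simp [blockField, blockMat_inl_inl, blockMat_inr_inl, blockMat_inr_inr, blockIdx]
  ring

theorem HasBlockDeriv.traceAnti_inl (hf : HasBlockDeriv f₁ f₂ f₃ f₄ g₁ g₂ g₃ g₄)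
    (hΔ : ∀ i Y, 0 < Y → f₁ i Y * f₄ i Y - f₂ i Y * f₃ i Y ≠ 0) {x : Coord s}
    (hx : x ∈ domain s) (a : Fin s) {Y : ℝ} (hY : (x (Sum.inl a)).im = Y) :
    traceAnti (blockField f₁ f₂ f₃ f₄) (Sum.inl a) x
      = I / 2 * (f₁ a Y * g₄ a Y - f₃ a Y * g₂ a Y) / (f₁ a Y * f₄ a Y - f₂ a Y * f₃ a Y) := by
  subst hY
  have hinv : (blockField f₁ f₂ f₃ f₄ x)⁻¹ = _ := blockMat_inv fun i => hΔ i _ (hx i)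
  simp only [traceAnti, hf.dzbar hx, hinv]
  simp [blockField, blockMat_inl_inl, blockMat_inl_inr, blockMat_inr_inl, blockMat_inr_inr,
    blockIdx, mul_sub]
  ring

theorem HasBlockDeriv.traceAnti_inr (hf : HasBlockDeriv f₁ f₂ f₃ f₄ g₁ g₂ g₃ g₄)
    (hΔ : ∀ i Y, 0 < Y → f₁ i Y * f₄ i Y - f₂ i Y * f₃ i Y ≠ 0) {x : Coord s}
    (hx : x ∈ domain s) (a : Fin s) {Y : ℝ} (hY : (x (Sum.inl a)).im = Y) :
    traceAnti (blockField f₁ f₂ f₃ f₄) (Sum.inr a) x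
      = -(I / 2) * (f₄ a Y * g₂ a Y - f₂ a Y * g₄ a Y)
        / (f₁ a Y * f₄ a Y - f₂ a Y * f₃ a Y) := by
  subst hY
  have hinv : (blockField f₁ f₂ f₃ f₄ x)⁻¹ = _ := blockMat_inv fun i => hΔ i _ (hx i)
  simp only [traceAnti, hf.dzbar hx, hinv]
  simp [blockField, blockMat_inl_inl, blockMat_inl_inr, blockMat_inr_inr,
    blockIdx, mul_sub]
  ring

/-- The traces do not depend on `w`, so the `dw ∧ dw̄` block is zero; this is what makes `B`
constant along the flow. -/
theorem ricciCoeff_block {h : FormField s} {α₁ α₂ β₁ β₂ α₁' α₂' β₁' β₂' : Fin s → ℝ → ℂ}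
    (hα₁ : ∀ y ∈ domain s, ∀ a, traceHol h (Sum.inl a) y = α₁ a (y (Sum.inl a)).im)
    (hα₂ : ∀ y ∈ domain s, ∀ a, traceHol h (Sum.inr a) y = α₂ a (y (Sum.inl a)).im)
    (hβ₁ : ∀ y ∈ domain s, ∀ a, traceAnti h (Sum.inl a) y = β₁ a (y (Sum.inl a)).im)
    (hβ₂ : ∀ y ∈ domain s, ∀ a, traceAnti h (Sum.inr a) y = β₂ a (y (Sum.inl a)).im)
    (dα₁ : ∀ a Y, 0 < Y → HasDerivAt (α₁ a) (α₁' a Y) Y)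
    (dα₂ : ∀ a Y, 0 < Y → HasDerivAt (α₂ a) (α₂' a Y) Y)
    (dβ₁ : ∀ a Y, 0 < Y → HasDerivAt (β₁ a) (β₁' a Y) Y)
    (dβ₂ : ∀ a Y, 0 < Y → HasDerivAt (β₂ a) (β₂' a Y) Y) {x : Coord s} (hx : x ∈ domain s)
    (l k : Fin s ⊕ Fin s) :
    ricciCoeff h l k x = blockField (fun a Y => -(I / 2) * (α₁' a Y + β₁' a Y))
      (fun a Y => -(I / 2) * β₂' a Y) (fun a Y => -(I / 2) * α₂' a Y) 0 x l k := by
  have e1 := fun a k => (dz_congr (fun y hy => hβ₁ y hy a) hx k).trans (dz_comp_im (dβ₁ a _ (hx a)) k)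
  have e2 := fun a k => (dz_congr (fun y hy => hβ₂ y hy a) hx k).trans (dz_comp_im (dβ₂ a _ (hx a)) k)
  have e3 := fun a k =>
    (dzbar_congr (fun y hy => hα₁ y hy a) hx k).trans (dzbar_comp_im (dα₁ a _ (hx a)) k)
  have e4 := fun a k =>
    (dzbar_congr (fun y hy => hα₂ y hy a) hx k).trans (dzbar_comp_im (dα₂ a _ (hx a)) k)
  rw [ricciCoeff]
  rcases l with l | l <;> rcases k with k | k
  · rw [e1, e3, blockField, blockMat_inl_inl]
    by_cases h : l = k
    · subst h; simp; ring
    · simp [h, Ne.symm h]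
  · rw [e2, e3, blockField, blockMat_inl_inr]
    by_cases h : l = k
    · subst h; simp
    · simp [h]
  · rw [e1, e4, blockField, blockMat_inr_inl]
    by_cases h : l = k
    · subst h; simp
    · simp [h, Ne.symm h]
  · rw [e2, e4, blockField, blockMat_inr_inr]
    simp

end

end OT

namespace OT

open Complex

variable {s : ℕ} {K : Type*} [Field K] [NumberField K]

/-! ### Left-invariant metrics -/

theorem coeffs_eq {k : ℕ} (p : Fin k → Fin s) (A B : Fin s → ℝ) (C : Fin k → ℂ) :
    coeffs p A B C = blockMat (fun i => (A i : ℂ)) (offDiag p C) (fun i => conj (offDiag p C i))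
      (fun i => (B i : ℂ)) := by
  unfold coeffs blockMat
  congr 1
  · ext i j
    rw [Matrix.of_apply, Matrix.diagonal_apply, offDiag]
    split_ifs with h
    · subst h; simp
    · exact Finset.sum_eq_zero fun r _ => if_neg fun h' => h (h'.1.symm.trans h'.2)
  · ext i j
    rw [Matrix.of_apply, Matrix.diagonal_apply, offDiag, map_sum]
    split_ifs with h
    · subst h
      exact Finset.sum_congr rfl fun r _ => by simp [apply_ite conj]
    · exact Finset.sum_eq_zero fun r _ => if_neg fun h' => h (h'.1.symm.trans h'.2)

/-- Necessity comes from a diagonal entry and a principal 2 × 2 minor, sufficiency from a triangular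
factorization. -/
theorem blockMat_posDef_iff (A B : Fin s → ℝ) (b : Fin s → ℂ) :
    (blockMat (fun i => (A i : ℂ)) b (fun i => conj (b i)) (fun i => (B i : ℂ))).PosDef ↔
      ∀ i, 0 < B i ∧ 0 < A i * B i - ‖b i‖ ^ 2 := by
  constructor
  · intro h i
    refine ⟨?_, ?_⟩
    · have := h.diag_pos (i := Sum.inr i)
      rw [blockMat_inr_inr, if_pos rfl] at this
      exact_mod_cast this
    · have h1 := (h.submatrix (e := ![Sum.inl i, Sum.inr i]) (by
        intro a b; fin_cases a <;> fin_cases b <;> simp)).det_pos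
      rw [Matrix.det_fin_two] at h1
      simp only [Matrix.submatrix_apply, Matrix.cons_val_zero, Matrix.cons_val_one,
        blockMat_inr_inr, blockMat_inl_inl, blockMat_inl_inr, blockMat_inr_inl, if_true,
        mul_conj'] at h1
      exact_mod_cast h1
  · intro h
    have h1 : ∀ i, (Real.sqrt ((A i * B i - ‖b i‖ ^ 2) / B i) : ℂ) ≠ 0 := fun i =>
      ofReal_ne_zero.2 (Real.sqrt_pos.2 (div_pos (h i).2 (h i).1)).ne'
    have h2 : ∀ i, (Real.sqrt (B i) : ℂ) ≠ 0 := fun i =>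
      ofReal_ne_zero.2 (Real.sqrt_pos.2 (h i).1).ne'
    -- A Cholesky factor in each block, with the square root of the Schur complement in the upper
    -- left corner.
    set L := blockMat (fun i => (Real.sqrt ((A i * B i - ‖b i‖ ^ 2) / B i) : ℂ)) (fun _ => 0)
      (fun i => conj (b i) / (Real.sqrt (B i) : ℂ)) (fun i => (Real.sqrt (B i) : ℂ)) with hL
    have hU : IsUnit L := IsUnit.of_mul_eq_one _ (blockMat_mul_inv fun i => by simp [h1 i, h2 i])
    have h3 := Matrix.PosDef.conjTranspose_mul_self L (Matrix.mulVec_injective_iff_isUnit.2 hU)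
    convert h3 using 1
    rw [hL, blockMat, blockMat, Matrix.fromBlocks_conjTranspose, Matrix.fromBlocks_multiply]
    simp only [Matrix.diagonal_conjTranspose, Matrix.diagonal_mul_diagonal, Matrix.diagonal_add]
    have h4 : ∀ i, (Real.sqrt (B i) : ℂ) * (Real.sqrt (B i) : ℂ) = B i := fun i => by
      rw [← ofReal_mul, Real.mul_self_sqrt (h i).1.le]
    have h5 : ∀ i, (Real.sqrt ((A i * B i - ‖b i‖ ^ 2) / B i) : ℂ)
        * (Real.sqrt ((A i * B i - ‖b i‖ ^ 2) / B i) : ℂ)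
        = ((A i * B i - ‖b i‖ ^ 2) / B i : ℝ) := fun i => by
      rw [← ofReal_mul, Real.mul_self_sqrt (div_pos (h i).2 (h i).1).le]
    congr 2 <;> ext i
    · have h6 : (B i : ℂ) ≠ 0 := ofReal_ne_zero.2 (h i).1.ne'
      have h7 := mul_conj' (b i)
      simp only [Pi.star_apply, RCLike.star_def, map_div₀, conj_conj, conj_ofReal]
      rw [h5, div_mul_div_comm, h4, h7]
      push_cast
      field_simp
      ring
    · simp [h2 i]
    · have := h2 i
      simp only [Pi.star_apply, star_zero, zero_mul, zero_add, RCLike.star_def, conj_ofReal]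
      field_simp
    · simp [h4]

/-- The exponential `Y ^ σ` of a positive real number. -/
noncomputable def twist (σ : ℂ) (Y : ℝ) : ℂ := exp (σ * (Real.log Y : ℂ))

theorem hasDerivAt_twist (σ : ℂ) {Y : ℝ} (hY : 0 < Y) :
    HasDerivAt (twist σ) (σ * twist σ Y * (Y : ℂ)⁻¹) Y := by
  refine ((((Real.hasDerivAt_log hY.ne').ofReal_comp).const_mul σ).cexp).congr_deriv ?_
  rw [twist]; push_cast; ring

theorem conj_twist (σ : ℂ) (Y : ℝ) : conj (twist σ Y) = twist (conj σ) Y := by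
  rw [twist, twist, ← exp_conj, map_mul, conj_ofReal]

/-- The exponent of the off-diagonal coefficients. -/
noncomputable def twistExp (c : ℝ) : ℂ := -(1 / 2) + I * (c : ℂ)

theorem conj_twistExp (c : ℝ) : conj (twistExp c) = -(1 / 2) - I * (c : ℂ) := by
  simp [twistExp, conj_ofNat]; ring

/-- The modulus of `Y ^ σ` is `Y^(-1/2)`, which makes the block determinant a constant divided by
`Y`. -/
theorem twist_mul_conj (c : ℝ) {Y : ℝ} (hY : 0 < Y) :
    twist (twistExp c) Y * twist (conj (twistExp c)) Y = (Y : ℂ)⁻¹ := by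
  rw [twist, twist, ← exp_add, conj_twistExp, twistExp]
  have : (-(1 / 2) + I * (c : ℂ)) * (Real.log Y : ℂ) + (-(1 / 2) - I * (c : ℂ)) * (Real.log Y : ℂ)
      = ((-Real.log Y : ℝ) : ℂ) := by push_cast; ring
  rw [this, ← ofReal_exp, Real.exp_neg, Real.exp_log hY, ofReal_inv]

theorem sqrt_mul_twist (c : ℝ) {Y : ℝ} (hY : 0 < Y) :
    (Y : ℂ)⁻¹ * ((Real.sqrt Y : ℂ) * exp (I * ((c * Real.log Y : ℝ) : ℂ))) = twist (twistExp c) Y := by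
  have h1 : (Y : ℂ)⁻¹ * (Real.sqrt Y : ℂ) = ((Real.exp (-(1 / 2) * Real.log Y) : ℝ) : ℂ) := by
    rw [← ofReal_inv, ← ofReal_mul]
    congr 1
    rw [Real.sqrt_eq_rpow, Real.rpow_def_of_pos hY, mul_comm, ← Real.exp_log (inv_pos.2 hY),
      ← Real.exp_add, Real.log_inv]
    congr 1; ring
  rw [← mul_assoc, h1, ofReal_exp, ← exp_add, twist, twistExp]
  congr 1; push_cast; ring

section
variable {k : ℕ} {p : Fin k → Fin s} {c : Fin s → Fin s → ℝ}

/-- The phase of `γⁱ` cancels in the diagonal entries. In the off-diagonal entry at `p r` it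
survives, and `hcp` reduces it to a function of the single variable `Im z` at `p r`. -/
theorem leftInvariant_eq (hcp : ∀ r : Fin k, ∀ j : Fin s, j ≠ p r → c j (p r) = 0)
    (A B : Fin s → ℝ) (C : Fin k → ℂ) {x : Coord s} (hx : x ∈ domain s) :
    leftInvariant c (coeffs p A B C) x
      = blockField (fun i Y => (A i : ℂ) * ((Y : ℂ)⁻¹) ^ 2)
        (fun i Y => offDiag p C i * twist (twistExp (c i i)) Y)
        (fun i Y => conj (offDiag p C i) * twist (conj (twistExp (c i i))) Y)
        (fun i Y => (B i : ℂ) * (Y : ℂ)) x := by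
  have h12 : ∀ i, offDiag p C i * (coframe c x (Sum.inl i) * conj (coframe c x (Sum.inr i)))
      = offDiag p C i * twist (twistExp (c i i)) (x (Sum.inl i)).im := by
    intro i
    by_cases hi : i ∈ Set.range p
    · obtain ⟨r, rfl⟩ := hi
      rw [← sqrt_mul_twist _ (hx (p r))]
      congr 1
      simp only [coframe, Sum.elim_inl, Sum.elim_inr, map_mul, conj_ofReal, ← exp_conj, map_neg,
        conj_I, neg_neg, ofReal_inv]
      rw [Finset.sum_eq_single (p r) (fun j _ hj => by rw [hcp r j hj, zero_mul]) (by simp)]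
    · rw [offDiag_of_notMem _ hi, zero_mul, zero_mul]
  ext i j
  rw [leftInvariant, Matrix.of_apply, coeffs_eq, blockField]
  rcases i with i | i <;> rcases j with j | j
  · rw [blockMat_inl_inl, blockMat_inl_inl]
    split_ifs with h
    · subst h
      simp [coframe, pow_two]
    · simp
  · rw [blockMat_inl_inr, blockMat_inl_inr]
    split_ifs with h
    · subst h
      exact h12 i
    · simp
  · rw [blockMat_inr_inl, blockMat_inr_inl]
    split_ifs with h
    · subst h
      rw [← conj_twist, ← map_mul, ← h12]
      simp [mul_comm]
    · simp
  · rw [blockMat_inr_inr, blockMat_inr_inr]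
    split_ifs with h
    · subst h
      rw [mul_conj']
      congr 1
      have h1 := hx i
      simp only [coframe, Sum.elim_inr]
      rw [norm_mul, norm_real, neg_mul, ← mul_neg, ← ofReal_neg, mul_comm I, norm_exp_ofReal_mul_I,
        mul_one, Real.norm_of_nonneg (Real.sqrt_nonneg _), ← ofReal_pow, Real.sq_sqrt h1.le]
    · simp

theorem smooth_coframe (c : Fin s → Fin s → ℝ) (i : Fin s ⊕ Fin s) :
    Smooth fun x => coframe c x i := by
  rcases i with i | i
  · exact ofRealCLM.contDiff.comp_contDiffOn ((smooth_im i).inv fun x hx => (hx i).ne')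
  · have h1 : ContDiffOn ℝ ∞ (fun x : Coord s => ∑ k, c k i * Real.log (x (Sum.inl k)).im)
        (domain s) := ContDiffOn.sum fun k _ => contDiffOn_const.mul
          ((smooth_im k).log fun x hx => (hx k).ne')
    exact (ofRealCLM.contDiff.comp_contDiffOn
      ((smooth_im i).sqrt fun x hx => (hx i).ne')).mul (ContDiffOn.cexp (contDiffOn_const.mul
        (ofRealCLM.contDiff.comp_contDiffOn h1)))

theorem smooth_coframe_mul (c : Fin s → Fin s → ℝ) (i j : Fin s ⊕ Fin s) :
    Smooth fun x => coframe c x i * conj (coframe c x j) :=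
  (smooth_coframe c i).mul (smooth_coframe c j).conj

theorem coframe_ne_zero (c : Fin s → Fin s → ℝ) {x : Coord s} (hx : x ∈ domain s)
    (i : Fin s ⊕ Fin s) : coframe c x i ≠ 0 := by
  rcases i with i | i
  · simp [coframe, (hx i).ne']
  · simp [coframe, (Real.sqrt_pos.2 (hx i)).ne']

theorem leftInvariant_posDef (c : Fin s → Fin s → ℝ)
    {H : Matrix (Fin s ⊕ Fin s) (Fin s ⊕ Fin s) ℂ} (hH : H.PosDef) {x : Coord s}
    (hx : x ∈ domain s) : (leftInvariant c H x).PosDef := by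
  have h1 := hH.mul_mul_conjTranspose_same (B := Matrix.diagonal (coframe c x)) (by
    rw [Matrix.vecMul_injective_iff_isUnit, Matrix.isUnit_iff_isUnit_det, Matrix.det_diagonal,
      isUnit_iff_ne_zero]
    exact Finset.prod_ne_zero_iff.2 fun i _ => coframe_ne_zero c hx i)
  convert h1 using 1
  ext i j
  rw [Matrix.diagonal_conjTranspose, Matrix.mul_diagonal, Matrix.diagonal_mul]
  simp only [leftInvariant, Matrix.of_apply, Pi.star_apply, RCLike.star_def]
  ring

theorem Data.coframe_add (X : Data s K) (c : Fin s → Fin s → ℝ) (x : Coord s) (a : K) :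
    coframe c (x + X.emb a) = coframe c x := by
  have h : ∀ k, ((x + X.emb a) (Sum.inl k)).im = (x (Sum.inl k)).im := fun k => by simp [Data.emb]
  ext (i | i) <;> simp only [coframe, Sum.elim_inl, Sum.elim_inr, h]

/-- The twist condition says precisely that the modulus and phase by which `τ i u` multiplies `dwᵢ`
are compensated by the change of the coefficient of `γⁱ`. -/
theorem Data.coframe_mul (X : Data s K) (hc : X.Twist c) {u : (𝓞 K)ˣ} (hu : u ∈ X.U)
    {x : Coord s} (hx : x ∈ domain s) (i : Fin s ⊕ Fin s) :
    coframe c (X.emb ((u : 𝓞 K) : K) * x) i * X.emb ((u : 𝓞 K) : K) i = coframe c x i := by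
  have h : ∀ k, ((X.emb ((u : 𝓞 K) : K) * x) (Sum.inl k)).im
      = X.σ k ((u : 𝓞 K) : K) * (x (Sum.inl k)).im := fun k => by simp [Data.emb]
  rcases i with i | i
  · have h1 := (X.pos u hu i).ne'
    have h2 := (hx i).ne'
    have h3 : X.emb ((u : 𝓞 K) : K) (Sum.inl i) = (X.σ i ((u : 𝓞 K) : K) : ℂ) := rfl
    simp only [coframe, Sum.elim_inl, h]
    rw [h3, ← ofReal_mul]
    congr 1
    field_simp
  · have h1 := X.pos u hu i
    have h5 : X.emb ((u : 𝓞 K) : K) (Sum.inr i) = X.τ i ((u : 𝓞 K) : K) := rfl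
    simp only [coframe, Sum.elim_inr, h]
    rw [h5, hc u hu i, Real.sqrt_mul h1.le, Real.rpow_neg h1.le, ← Real.sqrt_eq_rpow]
    have h2 : ∀ k, Real.log (X.σ k ((u : 𝓞 K) : K) * (x (Sum.inl k)).im)
        = Real.log (X.σ k ((u : 𝓞 K) : K)) + Real.log (x (Sum.inl k)).im := fun k =>
      Real.log_mul (X.pos u hu k).ne' (hx k).ne'
    simp only [h2, mul_add, Finset.sum_add_distrib, ofReal_add]
    have h3 : ((Real.sqrt (X.σ i ((u : 𝓞 K) : K)) : ℝ) : ℂ) ≠ 0 :=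
      ofReal_ne_zero.2 (Real.sqrt_pos.2 h1).ne'
    set S := ((∑ k, c k i * Real.log (X.σ k ((u : 𝓞 K) : K)) : ℝ) : ℂ)
    have h4 : exp (-I * S) * exp (I * S) = 1 := by rw [← exp_add]; simp
    set S' := ((∑ k, c k i * Real.log (x (Sum.inl k)).im : ℝ) : ℂ)
    have h6 := mul_inv_cancel₀ h3
    rw [ofReal_mul, ofReal_inv, exp_add]
    linear_combination (Real.sqrt (x (Sum.inl i)).im : ℂ) * exp (-I * S') * h4
      + (Real.sqrt (x (Sum.inl i)).im : ℂ) * exp (-I * S') * exp (-I * S) * exp (I * S) * h6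

theorem Data.isHermitianMetric_leftInvariant (X : Data s K) (hc : X.Twist c)
    {H : Matrix (Fin s ⊕ Fin s) (Fin s ⊕ Fin s) ℂ} (hH : H.PosDef) :
    X.IsHermitianMetric (leftInvariant c H) := by
  refine ⟨fun i j => (Smooth.const _).mul (smooth_coframe_mul c i j),
    fun x hx => leftInvariant_posDef c hH hx, fun x hx => ⟨fun a => ?_, fun u hu i j => ?_⟩⟩
  · rw [leftInvariant, leftInvariant, X.coframe_add]
  · simp only [leftInvariant, Matrix.of_apply]
    rw [← X.coframe_mul hc hu hx i, ← X.coframe_mul hc hu hx j, map_mul]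
    ring

end

end OT

namespace OT

open Complex

variable {s : ℕ} {K : Type*} [Field K] [NumberField K]

/-! ### Congruence on the domain -/

section
variable {h h' : FormField s}

theorem traceHol_congr (hh : ∀ x ∈ domain s, h x = h' x) (k : Fin s ⊕ Fin s) {x : Coord s}
    (hx : x ∈ domain s) : traceHol h k x = traceHol h' k x := by
  simp only [traceHol, hh x hx]
  refine Finset.sum_congr rfl fun i _ => Finset.sum_congr rfl fun m _ => ?_
  rw [dz_congr (fun y hy => by rw [hh y hy]) hx]

theorem traceAnti_congr (hh : ∀ x ∈ domain s, h x = h' x) (k : Fin s ⊕ Fin s) {x : Coord s}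
    (hx : x ∈ domain s) : traceAnti h k x = traceAnti h' k x := by
  simp only [traceAnti, hh x hx]
  refine Finset.sum_congr rfl fun i _ => Finset.sum_congr rfl fun m _ => ?_
  rw [dzbar_congr (f := fun y => h y i m) (fun y hy => by rw [hh y hy]) hx,
    dzbar_congr (f := fun y => h y i k) (fun y hy => by rw [hh y hy]) hx]

theorem ricciCoeff_congr (hh : ∀ x ∈ domain s, h x = h' x) (l k : Fin s ⊕ Fin s) {x : Coord s}
    (hx : x ∈ domain s) : ricciCoeff h l k x = ricciCoeff h' l k x := by
  rw [ricciCoeff, ricciCoeff, dz_congr (fun y hy => traceAnti_congr hh k hy) hx,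
    dzbar_congr (fun y hy => traceHol_congr hh l hy) hx]

theorem IsPluriclosed.congr (hh : ∀ x ∈ domain s, h x = h' x) (hp : IsPluriclosed h) :
    IsPluriclosed h' := by
  intro x hx i j k l
  have key : ∀ i j k l : Fin s ⊕ Fin s, dz k (dzbar l (fun y => h' y i j)) x
      = dz k (dzbar l (fun y => h y i j)) x := fun i j k l =>
    dz_congr (fun y hy => dzbar_congr (fun z hz => by rw [hh z hz]) hy l) hx k
  rw [key, key, key, key]
  exact hp x hx i j k l

theorem IsBismutConnection.congr {Γ : Christoffel s} (hh : ∀ x ∈ domain s, h x = h' x)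
    (hΓ : IsBismutConnection h Γ) : IsBismutConnection h' Γ := by
  have h1 : ∀ x ∈ domain s, ∀ u v, fundForm h' x u v = fundForm h x u v := fun x hx u v => by
    rw [fundForm, fundForm, hh x hx]
  have h2 : ∀ x ∈ domain s, ∀ u v, metric h' x u v = metric h x u v := fun x hx u v => h1 x hx _ _
  refine ⟨hΓ.smooth, fun x hx u v w => ?_, hΓ.preserves_J, fun x hx u v w => ?_⟩
  · rw [h2 x hx, h2 x hx, ← hΓ.preserves_metric x hx]
    congr 1
    exact Filter.EventuallyEq.fderiv_eq
      (Filter.eventually_of_mem (domain_mem_nhds hx) fun y hy => h2 y hy v w)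
  · rw [h1 x hx, h1 x hx]
    exact hΓ.torsion_alternating x hx u v w

theorem Data.IsHermitianMetric.congr {X : Data s K} (hh : ∀ x ∈ domain s, h x = h' x)
    (hm : X.IsHermitianMetric h) : X.IsHermitianMetric h' := by
  refine ⟨fun i j => (hm.1 i j).congr fun x hx => by rw [hh x hx],
    fun x hx => hh x hx ▸ hm.2.1 x hx, fun x hx => ⟨fun a => ?_, fun u hu i j => ?_⟩⟩
  · have h0 : x + X.emb (a : K) ∈ domain s := by
      simpa [show X.emb (1 : K) * x = x by ext (i | i) <;> simp [Data.emb]] using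
        X.mem_domain X.U.one_mem (a : K) hx
    rw [← hh x hx, ← hh _ h0]
    exact (hm.2.2 x hx).1 a
  · have h0 : X.emb ((u : 𝓞 K) : K) * x ∈ domain s := by
      simpa [show X.emb (0 : K) = 0 by ext (i | i) <;> simp [Data.emb]] using X.mem_domain hu 0 hx
    rw [← hh x hx, ← hh _ h0]
    exact (hm.2.2 x hx).2 u hu i j

theorem Data.IsPluriclosedFlow.congr {X : Data s K} {T : EReal} {h₀ : FormField s}
    {h h' : ℝ → FormField s} (hT : 0 < T)
    (hh : ∀ t ∈ timeInterval T, ∀ x ∈ domain s, h t x = h' t x)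
    (hf : X.IsPluriclosedFlow T h₀ h) : X.IsPluriclosedFlow T h₀ h' where
  smooth i j := (hf.smooth i j).congr fun q hq => by rw [hh q.1 hq.1 q.2 hq.2]
  isHermitianMetric t ht := (hf.isHermitianMetric t ht).congr (hh t ht)
  isPluriclosed t ht := (hf.isPluriclosed t ht).congr (hh t ht)
  initial x hx := by
    rw [← hh 0 ⟨le_rfl, by exact_mod_cast hT⟩ x hx]
    exact hf.initial x hx
  equation t ht := by
    obtain ⟨Γ, h1, h2⟩ := hf.equation t ht
    refine ⟨Γ, h1.congr (hh t ht), fun x hx u v => ?_⟩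
    refine (h2 x hx u v).congr (fun y hy => ?_) ?_
    · rw [fundForm, fundForm, hh y hy x hx]
    · rw [fundForm, fundForm, hh t ht x hx]

end

/-! ### The Ricci form of a left-invariant metric -/

theorem hasDerivAt_inv_ofReal {Y : ℝ} (hY : 0 < Y) :
    HasDerivAt (fun Y : ℝ => (Y : ℂ)⁻¹) (-((Y : ℂ)⁻¹) ^ 2) Y := by
  have := (hasDerivAt_inv (𝕜 := ℂ) (ofReal_ne_zero.2 hY.ne')).comp_ofReal
  simpa using this

theorem hasDerivAt_coe (Y : ℝ) : HasDerivAt (fun Y : ℝ => (Y : ℂ)) 1 Y := ofRealCLM.hasDerivAt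

/-- The blocks of a left-invariant metric. -/
noncomputable def leftBlocks (c A B : Fin s → ℝ) (b : Fin s → ℂ) : FormField s :=
  blockField (fun i Y => (A i : ℂ) * ((Y : ℂ)⁻¹) ^ 2)
    (fun i Y => b i * twist (twistExp (c i)) Y)
    (fun i Y => conj (b i) * twist (conj (twistExp (c i))) Y)
    (fun i Y => (B i : ℂ) * (Y : ℂ))

section
variable (c A B : Fin s → ℝ) (b : Fin s → ℂ)

theorem hasBlockDeriv_left : HasBlockDeriv
    (fun i Y => (A i : ℂ) * ((Y : ℂ)⁻¹) ^ 2)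
    (fun i Y => b i * twist (twistExp (c i)) Y)
    (fun i Y => conj (b i) * twist (conj (twistExp (c i))) Y)
    (fun i Y => (B i : ℂ) * (Y : ℂ))
    (fun i Y => -2 * (A i : ℂ) * ((Y : ℂ)⁻¹) ^ 3)
    (fun i Y => b i * (twistExp (c i) * twist (twistExp (c i)) Y * (Y : ℂ)⁻¹))
    (fun i Y => conj (b i) * (conj (twistExp (c i)) * twist (conj (twistExp (c i))) Y * (Y : ℂ)⁻¹))
    (fun i _ => (B i : ℂ)) where
  one i Y hY := (((hasDerivAt_inv_ofReal hY).pow 2).const_mul _).congr_deriv (by push_cast; ring)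
  two i Y hY := (hasDerivAt_twist _ hY).const_mul _
  three i Y hY := (hasDerivAt_twist _ hY).const_mul _
  four i Y hY := ((hasDerivAt_coe Y).const_mul _).congr_deriv (mul_one _)

theorem isPluriclosed_leftBlocks : IsPluriclosed (leftBlocks c A B b) := by
  refine (hasBlockDeriv_left c A B b).isPluriclosed (e₁ := fun i Y => 6 * (A i : ℂ) * ((Y : ℂ)⁻¹) ^ 4)
    (e₂ := fun i Y => b i * (twistExp (c i) * (twistExp (c i) * twist (twistExp (c i)) Y * (Y : ℂ)⁻¹)
      * (Y : ℂ)⁻¹ + twistExp (c i) * twist (twistExp (c i)) Y * -((Y : ℂ)⁻¹) ^ 2))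
    (e₃ := fun i Y => conj (b i) * (conj (twistExp (c i)) * (conj (twistExp (c i))
      * twist (conj (twistExp (c i))) Y * (Y : ℂ)⁻¹) * (Y : ℂ)⁻¹
      + conj (twistExp (c i)) * twist (conj (twistExp (c i))) Y * -((Y : ℂ)⁻¹) ^ 2))
    ⟨fun i Y hY => ?_, fun i Y hY => ?_, fun i Y hY => ?_, fun i Y _ => hasDerivAt_const _ _⟩
  · exact (((hasDerivAt_inv_ofReal hY).pow 3).const_mul _).congr_deriv (by push_cast; ring)
  · exact (((hasDerivAt_twist _ hY).const_mul _).mul (hasDerivAt_inv_ofReal hY)).const_mul _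
  · exact (((hasDerivAt_twist _ hY).const_mul _).mul (hasDerivAt_inv_ofReal hY)).const_mul _

theorem det_leftBlocks (i : Fin s) {Y : ℝ} (hY : 0 < Y) :
    (A i : ℂ) * ((Y : ℂ)⁻¹) ^ 2 * ((B i : ℂ) * (Y : ℂ)) - b i * twist (twistExp (c i)) Y
      * (conj (b i) * twist (conj (twistExp (c i))) Y)
      = ((A i * B i - ‖b i‖ ^ 2 : ℝ) : ℂ) * (Y : ℂ)⁻¹ := by
  have h1 := twist_mul_conj (c i) hY
  have h2 := mul_conj' (b i)
  have h3 := mul_inv_cancel₀ (ofReal_ne_zero.2 hY.ne')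
  push_cast
  linear_combination (-(b i) * conj (b i)) * h1 - (Y : ℂ)⁻¹ * h2 + A i * B i * (Y : ℂ)⁻¹ * h3

variable {A B b}

/-- After division by the block determinant `δ/Y`, the traces are multiples of `Y⁻¹` and `Y · Y ^
σ`. Their derivatives are again multiples of the corresponding entries of a left-invariant form. -/
theorem ricciCoeff_leftBlocks (hδ : ∀ i, 0 < A i * B i - ‖b i‖ ^ 2) {x : Coord s}
    (hx : x ∈ domain s) (l k : Fin s ⊕ Fin s) :
    ricciCoeff (leftBlocks c A B b) l k x = blockField
      (fun i Y => -(3 / 4) * ((A i : ℂ) * B i / ((A i * B i - ‖b i‖ ^ 2 : ℝ) : ℂ)) * ((Y : ℂ)⁻¹) ^ 2)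
      (fun i Y => rate (c i) * (B i * b i / ((A i * B i - ‖b i‖ ^ 2 : ℝ) : ℂ))
        * twist (twistExp (c i)) Y)
      (fun i Y => conj (rate (c i) * (B i * b i / ((A i * B i - ‖b i‖ ^ 2 : ℝ) : ℂ)))
        * twist (conj (twistExp (c i))) Y) 0 x l k := by
  have hd := hasBlockDeriv_left c A B b
  have hδ' : ∀ i, ((A i * B i - ‖b i‖ ^ 2 : ℝ) : ℂ) ≠ 0 := fun i => ofReal_ne_zero.2 (hδ i).ne'
  have hΔ : ∀ i (Y : ℝ), 0 < Y → (A i : ℂ) * ((Y : ℂ)⁻¹) ^ 2 * ((B i : ℂ) * (Y : ℂ))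
      - b i * twist (twistExp (c i)) Y * (conj (b i) * twist (conj (twistExp (c i))) Y) ≠ 0 := by
    intro i Y hY
    rw [det_leftBlocks c A B b i hY]
    exact mul_ne_zero (hδ' i) (inv_ne_zero (ofReal_ne_zero.2 hY.ne'))
  set δ : Fin s → ℂ := fun i => ((A i * B i - ‖b i‖ ^ 2 : ℝ) : ℂ) with hδdef
  have hdiv : ∀ (i : Fin s) (Y : ℝ), 0 < Y → ∀ w z : ℂ, w = z * (Y : ℂ)⁻¹ →
      w / (δ i * (Y : ℂ)⁻¹) = z / δ i := by
    intro i Y hY w z h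
    have h1 : (Y : ℂ)⁻¹ ≠ 0 := inv_ne_zero (ofReal_ne_zero.2 hY.ne')
    rw [h, mul_div_mul_right _ _ h1]
  have key := ricciCoeff_block (h := leftBlocks c A B b)
    (α₁ := fun i Y => I / 2 * (2 * A i * B i + twistExp (c i) * (b i * conj (b i))) * (Y : ℂ)⁻¹ / δ i)
    (β₁ := fun i Y => I / 2 * (A i * B i - twistExp (c i) * (b i * conj (b i))) * (Y : ℂ)⁻¹ / δ i)
    (α₂ := fun i Y => -(I / 2) * (B i * conj (b i) * (conj (twistExp (c i)) - 1))
      * (Y * twist (conj (twistExp (c i))) Y) / δ i)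
    (β₂ := fun i Y => -(I / 2) * (B i * b i * (twistExp (c i) - 1))
      * (Y * twist (twistExp (c i)) Y) / δ i)
    (fun y hy a => by
      rw [leftBlocks, hd.traceHol_inl hΔ hy a rfl, det_leftBlocks c A B b a (hy a)]
      apply hdiv a _ (hy a)
      have t1 := twist_mul_conj (c a) (hy a)
      have t3 := mul_inv_cancel₀ (ofReal_ne_zero.2 (hy a).ne')
      linear_combination I * A a * B a * (((y (Sum.inl a)).im : ℂ)⁻¹) ^ 2 * t3
        + I / 2 * twistExp (c a) * (b a * conj (b a)) * ((y (Sum.inl a)).im : ℂ)⁻¹ * t1)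
    (fun y hy a => by
      rw [leftBlocks, hd.traceHol_inr hΔ hy a rfl, det_leftBlocks c A B b a (hy a)]
      apply hdiv a _ (hy a)
      have t3 := mul_inv_cancel₀ (ofReal_ne_zero.2 (hy a).ne')
      linear_combination -(I / 2) * B a * conj (b a)
        * twist (conj (twistExp (c a))) (y (Sum.inl a)).im * t3)
    (fun y hy a => by
      rw [leftBlocks, hd.traceAnti_inl hΔ hy a rfl, det_leftBlocks c A B b a (hy a)]
      apply hdiv a _ (hy a)
      have t1 := twist_mul_conj (c a) (hy a)
      linear_combination -(I / 2) * twistExp (c a) * (b a * conj (b a))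
        * ((y (Sum.inl a)).im : ℂ)⁻¹ * t1)
    (fun y hy a => by
      rw [leftBlocks, hd.traceAnti_inr hΔ hy a rfl, det_leftBlocks c A B b a (hy a)]
      apply hdiv a _ (hy a)
      have t3 := mul_inv_cancel₀ (ofReal_ne_zero.2 (hy a).ne')
      linear_combination -(I / 2) * B a * b a
        * twist (twistExp (c a)) (y (Sum.inl a)).im * t3)
    (fun a Y hY => ((hasDerivAt_inv_ofReal hY).const_mul _).div_const _)
    (fun a Y hY => (((hasDerivAt_coe Y).mul (hasDerivAt_twist _ hY)).const_mul _).div_const _)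
    (fun a Y hY => ((hasDerivAt_inv_ofReal hY).const_mul _).div_const _)
    (fun a Y hY => (((hasDerivAt_coe Y).mul (hasDerivAt_twist _ hY)).const_mul _).div_const _)
    hx l k
  rw [key]
  -- The factor `σ - 1` stems from the trace and `σ + 1` from differentiating `Y · Y ^ σ`; their
  -- product produces the rate.
  have hσ : ∀ a, (twistExp (c a) - 1) * (twistExp (c a) + 1) = -4 * rate (c a) := fun a => by
    rw [twistExp, rate]; linear_combination (c a : ℂ) ^ 2 * I_sq
  have hσ' : ∀ a, (conj (twistExp (c a)) - 1) * (conj (twistExp (c a)) + 1)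
      = -4 * conj (rate (c a)) := fun a => by
    simpa [conj_ofNat] using congrArg conj (hσ a)
  rcases l with l | l <;> rcases k with k | k
  · simp only [blockField, blockMat_inl_inl]
    split_ifs with h
    -- The terms with `σ` in the two traces cancel, leaving `3 A B`, whence the constant `3/4`.
    · linear_combination (3 / 4 * A l * B l / δ l * (((x (Sum.inl l)).im : ℂ)⁻¹) ^ 2) * I_sq
    · rfl
  · simp only [blockField, blockMat_inl_inr]
    split_ifs with h
    · have t3 := mul_inv_cancel₀ (ofReal_ne_zero.2 (hx l).ne')
      set E := B l * b l / δ l * twist (twistExp (c l)) (x (Sum.inl l)).im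
      linear_combination I ^ 2 / 4 * E * (twistExp (c l) - 1) * twistExp (c l) * t3
        + I ^ 2 / 4 * E * hσ l - E * rate (c l) * I_sq
    · rfl
  · simp only [blockField, blockMat_inr_inl]
    split_ifs with h
    · have hδc : conj (δ l) = δ l := conj_ofReal _
      rw [map_mul, map_div₀, map_mul, hδc, conj_ofReal]
      have t3 := mul_inv_cancel₀ (ofReal_ne_zero.2 (hx l).ne')
      set E := B l * conj (b l) / δ l * twist (conj (twistExp (c l))) (x (Sum.inl l)).im
      linear_combination I ^ 2 / 4 * E * (conj (twistExp (c l)) - 1) * conj (twistExp (c l)) * t3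
        + I ^ 2 / 4 * E * hσ' l - E * conj (rate (c l)) * I_sq
    · rfl
  · simp [blockField, blockMat_inr_inr]

theorem conj_ricciCoeff_leftBlocks (hδ : ∀ i, 0 < A i * B i - ‖b i‖ ^ 2) {x : Coord s}
    (hx : x ∈ domain s) (l k : Fin s ⊕ Fin s) :
    conj (ricciCoeff (leftBlocks c A B b) l k x) = ricciCoeff (leftBlocks c A B b) k l x := by
  rw [ricciCoeff_leftBlocks c hδ hx, ricciCoeff_leftBlocks c hδ hx]
  rcases l with l | l <;> rcases k with k | k
  · simp only [blockField, blockMat_inl_inl]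
    by_cases h : l = k
    · subst h; simp [conj_ofNat]
    · simp [h, Ne.symm h]
  · simp only [blockField, blockMat_inl_inr, blockMat_inr_inl]
    by_cases h : l = k
    · subst h; rw [if_pos rfl, if_pos rfl, map_mul, conj_twist]
    · simp [h, Ne.symm h]
  · simp only [blockField, blockMat_inl_inr, blockMat_inr_inl]
    by_cases h : l = k
    · subst h; rw [if_pos rfl, if_pos rfl, map_mul, conj_twist, conj_conj, conj_conj]
    · simp [h, Ne.symm h]
  · simp [blockField, blockMat_inr_inr]

end

/-! ### The flow of a left-invariant metric -/

section
variable {k : ℕ} {p : Fin k → Fin s} {c : Fin s → Fin s → ℝ} {A B : Fin s → ℝ} {C : Fin k → ℂ}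
  {l : Fin s → ℝ → ℝ}

theorem leftInvariant_eq_leftBlocks
    (hcp : ∀ r : Fin k, ∀ j : Fin s, j ≠ p r → c j (p r) = 0)
    (A B : Fin s → ℝ) (C : Fin k → ℂ) {x : Coord s} (hx : x ∈ domain s) :
    leftInvariant c (coeffs p A B C) x = leftBlocks (fun i => c i i) A B (offDiag p C) x :=
  leftInvariant_eq hcp A B C hx

theorem coeffs_sol_posDef (hp : Function.Injective p)
    (hl : ∀ i, IsClock (A i) (B i) (offDiag p C i) (c i i) (l i)) (hB : ∀ i, 0 < B i)
    (hδ : ∀ i, 0 < A i * B i - ‖offDiag p C i‖ ^ 2) {t : ℝ} (ht : 0 ≤ t) :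
    (coeffs p (solA A l t) B (solC c p C l t)).PosDef := by
  rw [coeffs_eq, blockMat_posDef_iff]
  intro i
  rw [offDiag_solC hp]
  exact ⟨hB i, (hl i).det_pos (hδ i) ht⟩

theorem contDiffOn_coeffs_sol (hp : Function.Injective p)
    (hl : ∀ i, IsClock (A i) (B i) (offDiag p C i) (c i i) (l i)) (i j : Fin s ⊕ Fin s) :
    ContDiffOn ℝ ∞ (fun t => coeffs p (solA A l t) B (solC c p C l t) i j) (Set.Ici 0) := by
  have h2 : ∀ i, ContDiffOn ℝ ∞ (fun t => offDiag p (solC c p C l t) i) (Set.Ici 0) := by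
    intro i
    simp only [offDiag_solC hp]
    exact contDiffOn_const.mul (ContDiffOn.cexp (contDiffOn_const.mul
      (ofRealCLM.contDiff.comp_contDiffOn (hl i).smooth)))
  simp only [coeffs_eq]
  rcases i with i | i <;> rcases j with j | j
  · simp only [blockMat_inl_inl]
    split_ifs
    · exact ofRealCLM.contDiff.comp_contDiffOn (contDiffOn_const.mul (hl i).smooth.exp)
    · exact contDiffOn_const
  · simp only [blockMat_inl_inr]
    split_ifs
    · exact h2 i
    · exact contDiffOn_const
  · simp only [blockMat_inr_inl]
    split_ifs
    · exact conjCLE.contDiff.comp_contDiffOn (h2 i)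
    · exact contDiffOn_const
  · exact contDiffOn_const

theorem hasDerivWithinAt_leftBlocks_sol (hp : Function.Injective p)
    (hl : ∀ i, IsClock (A i) (B i) (offDiag p C i) (c i i) (l i))
    (hδ : ∀ i, 0 < A i * B i - ‖offDiag p C i‖ ^ 2) {t : ℝ} (ht : 0 ≤ t) {x : Coord s}
    (hx : x ∈ domain s) (i j : Fin s ⊕ Fin s) :
    HasDerivWithinAt (fun t' => leftBlocks (fun i => c i i) (solA A l t') B
        (offDiag p (solC c p C l t')) x i j)
      (-ricciCoeff (leftBlocks (fun i => c i i) (solA A l t) B (offDiag p (solC c p C l t))) i j x)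
      (Set.Ici 0) t := by
  have hδt : ∀ i, 0 < solA A l t i * B i - ‖offDiag p (solC c p C l t) i‖ ^ 2 := fun i => by
    rw [offDiag_solC hp]
    exact (hl i).det_pos (hδ i) ht
  rw [ricciCoeff_leftBlocks _ hδt hx]
  have hA : ∀ i, HasDerivWithinAt (fun t => (solA A l t i : ℂ))
      (3 / 4 * ((solA A l t i : ℂ) * B i
        / ((solA A l t i * B i - ‖offDiag p (solC c p C l t) i‖ ^ 2 : ℝ) : ℂ))) (Set.Ici 0) t := by
    intro i
    have h1 := ((hl i).hasDerivWithinAt_fst (hδ i) ht).ofReal_comp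
    rw [← offDiag_solC hp, one_add_div (by have := hδt i; rw [solA] at this; exact this.ne')] at h1
    refine h1.congr_deriv ?_
    simp only [solA]
    push_cast
    ring
  have hb : ∀ i, HasDerivWithinAt (fun t => offDiag p (solC c p C l t) i)
      (-rate (c i i) * (B i * offDiag p (solC c p C l t) i
        / ((solA A l t i * B i - ‖offDiag p (solC c p C l t) i‖ ^ 2 : ℝ) : ℂ))) (Set.Ici 0) t := by
    intro i
    have h1 := (hl i).hasDerivWithinAt_snd (hδ i) ht
    simp only [← offDiag_solC (c := c) (l := l) (C := C) hp] at h1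
    exact h1
  simp only [leftBlocks, blockField]
  rcases i with i | i <;> rcases j with j | j
  · simp only [blockMat_inl_inl]
    split_ifs
    · exact ((hA i).mul_const _).congr_deriv (by ring)
    · simpa using hasDerivWithinAt_const t (Set.Ici (0 : ℝ)) (0 : ℂ)
  · simp only [blockMat_inl_inr]
    split_ifs
    · exact ((hb i).mul_const _).congr_deriv (by ring)
    · simpa using hasDerivWithinAt_const t (Set.Ici (0 : ℝ)) (0 : ℂ)
  · simp only [blockMat_inr_inl]
    split_ifs
    · have h2 : HasDerivWithinAt (fun t => conj (offDiag p (solC c p C l t) i)) _ (Set.Ici 0) t :=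
        (conjCLE : ℂ →L[ℝ] ℂ).hasFDerivAt.comp_hasDerivWithinAt t (hb i)
      refine (h2.mul_const _).congr_deriv ?_
      simp
    · simpa using hasDerivWithinAt_const t (Set.Ici (0 : ℝ)) (0 : ℂ)
  · simp only [blockMat_inr_inr]
    simpa using hasDerivWithinAt_const t (Set.Ici (0 : ℝ)) _

/-- The explicit coefficients obey the entrywise equation `∂ₜ h = -ricciCoeff`, whose right side is
Hermitian here; the Bismut connection is the one constructed in `bismut`. -/
theorem Data.isPluriclosedFlow_sol {X : Data s K} (hc : X.Twist c) (hp : Function.Injective p)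
    (hcp : ∀ r : Fin k, ∀ j : Fin s, j ≠ p r → c j (p r) = 0)
    (hl : ∀ i, IsClock (A i) (B i) (offDiag p C i) (c i i) (l i)) (hB : ∀ i, 0 < B i)
    (hδ : ∀ i, 0 < A i * B i - ‖offDiag p C i‖ ^ 2) (T : EReal) :
    X.IsPluriclosedFlow T (leftInvariant c (coeffs p A B C))
      fun t => leftInvariant c (coeffs p (solA A l t) B (solC c p C l t)) where
  smooth i j := by
    have h1 := ((contDiffOn_coeffs_sol (B := B) hp hl i j).mono
      (fun t (ht : t ∈ timeInterval T) => ht.1)).comp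
      (contDiff_fst.contDiffOn (s := timeInterval T ×ˢ domain s)) fun q hq => hq.1
    have h2 := ContDiffOn.comp (smooth_coframe_mul c i j)
      (contDiff_snd.contDiffOn (s := timeInterval T ×ˢ domain s)) fun q hq => hq.2
    exact h1.mul h2
  isHermitianMetric t ht :=
    X.isHermitianMetric_leftInvariant hc (coeffs_sol_posDef hp hl hB hδ ht.1)
  isPluriclosed t _ := (isPluriclosed_leftBlocks (fun i => c i i) (solA A l t) B
    (offDiag p (solC c p C l t))).congr fun x hx => (leftInvariant_eq_leftBlocks hcp _ _ _ hx).symm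
  initial x _ := by
    have h1 : solA A l 0 = A := funext fun i => by simp [solA, (hl i).zero]
    have h2 : solC c p C l 0 = C := funext fun r => by simp [solC, (hl (p r)).zero]
    rw [h1, h2]
  equation t ht := by
    have hm := (X.isHermitianMetric_leftInvariant hc
      (coeffs_sol_posDef hp hl hB hδ ht.1)).isMetric
    have hδt : ∀ i, 0 < solA A l t i * B i - ‖offDiag p (solC c p C l t) i‖ ^ 2 := fun i => by
      rw [offDiag_solC hp]
      exact (hl i).det_pos (hδ i) ht.1
    refine ⟨_, hm.isBismutConnection, fun x hx u v => ?_⟩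
    have hR := fun i j => ricciCoeff_congr (fun y hy => leftInvariant_eq_leftBlocks hcp
      (solA A l t) B (solC c p C l t) hy) i j hx
    refine fundForm_hasDerivWithinAt (h := fun t => leftInvariant c
      (coeffs p (solA A l t) B (solC c p C l t))) hm hm.isBismutConnection hx
      (fun i j => ?_) (fun i j => ?_) u v
    · rw [hR, hR]
      exact conj_ricciCoeff_leftBlocks _ hδt hx i j
    · rw [hR]
      simp only [leftInvariant_eq_leftBlocks hcp _ _ _ hx]
      exact (hasDerivWithinAt_leftBlocks_sol hp hl hδ ht.1 hx i j).mono fun t ht => ht.1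

end

end OT

namespace OT

open Complex

variable {s : ℕ} {K : Type*} [Field K] [NumberField K]

/-! ### Long-time behaviour -/

theorem tendsto_div_one_add_of_bounded {f : ℝ → ℂ} {M : ℝ}
    (hf : ∀ᶠ t in Filter.atTop, ‖f t‖ ≤ M) :
    Filter.Tendsto (fun t : ℝ => f t / (1 + (t : ℂ))) Filter.atTop (nhds 0) := by
  have h1 : Filter.Tendsto (fun t : ℝ => M * (1 + t)⁻¹) Filter.atTop (nhds 0) := by
    simpa using (tendsto_inv_atTop_zero.comp
      (Filter.tendsto_atTop_add_const_left Filter.atTop (1 : ℝ) Filter.tendsto_id)).const_mul M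
  refine squeeze_zero_norm' ?_ h1
  filter_upwards [hf, Filter.eventually_ge_atTop 0] with t ht h0
  have h2 : ‖(1 + (t : ℂ))‖ = 1 + t := by
    rw [← ofReal_one, ← ofReal_add, norm_real, Real.norm_of_nonneg (by positivity)]
  rw [norm_div, h2, div_eq_mul_inv]
  gcongr

theorem tendsto_div_one_add_of_isEquivalent {f : ℝ → ℝ}
    (hf : Asymptotics.IsEquivalent Filter.atTop f fun t => 3 / 4 * t) :
    Filter.Tendsto (fun t : ℝ => (f t : ℂ) / (1 + (t : ℂ))) Filter.atTop (nhds (3 / 4)) := by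
  have h1 : Filter.Tendsto (fun t : ℝ => (1 + t)⁻¹) Filter.atTop (nhds 0) :=
    tendsto_inv_atTop_zero.comp
      (Filter.tendsto_atTop_add_const_left Filter.atTop (1 : ℝ) Filter.tendsto_id)
  have h2 : Filter.Tendsto (fun t : ℝ => 3 / 4 * t / (1 + t)) Filter.atTop (nhds (3 / 4)) := by
    have h3 : Filter.Tendsto (fun t : ℝ => 3 / 4 * (1 - (1 + t)⁻¹)) Filter.atTop (nhds (3 / 4)) := by
      simpa using (h1.const_sub 1).const_mul (3 / 4)
    refine h3.congr' ?_
    filter_upwards [Filter.eventually_ge_atTop 0] with t ht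
    have : 1 + t ≠ 0 := by positivity
    field_simp
    ring
  have h4 : Filter.Tendsto (fun t : ℝ => f t / (1 + t)) Filter.atTop (nhds (3 / 4)) :=
    (hf.div Asymptotics.IsEquivalent.refl).symm.tendsto_nhds h2
  have h5 := (continuous_ofReal.tendsto (3 / 4 : ℝ)).comp h4
  push_cast at h5
  refine h5.congr fun t => ?_
  simp

/-- Spatial derivatives do not touch the factor `a t`, and the derivatives of `φ` are locally
bounded. -/
theorem tendstoLocallyUniformlyOn_iteratedFDeriv {φ : Coord s → ℂ} (hφ : Smooth φ) {a : ℝ → ℂ}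
    {b : ℂ} (ha : Filter.Tendsto a Filter.atTop (nhds b)) (n : ℕ) :
    TendstoLocallyUniformlyOn (fun (t : ℝ) (x : Coord s) => iteratedFDeriv ℝ n (fun y => a t * φ y) x)
      (fun x => iteratedFDeriv ℝ n (fun y => b * φ y) x) Filter.atTop (domain s) := by
  have h1 : ∀ (z : ℂ), ∀ x ∈ domain s, iteratedFDeriv ℝ n (fun y => z * φ y) x
      = z • iteratedFDeriv ℝ n φ x := fun z x hx =>
    iteratedFDeriv_const_smul_apply (a := z) ((hφ.contDiffAt hx).of_le (by exact_mod_cast le_top))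
  have hc : ContinuousOn (fun x => ‖iteratedFDeriv ℝ n φ x‖) (domain s) := fun x hx =>
    ((hφ.contDiffAt hx).continuousAt_iteratedFDeriv
      (by exact_mod_cast le_top)).norm.continuousWithinAt
  rw [Metric.tendstoLocallyUniformlyOn_iff]
  intro ε hε x hx
  have hM : 0 < ‖iteratedFDeriv ℝ n φ x‖ + 1 := by positivity
  refine ⟨{y | ‖iteratedFDeriv ℝ n φ y‖ < ‖iteratedFDeriv ℝ n φ x‖ + 1} ∩ domain s,
    Filter.inter_mem ((hc x hx).eventually_lt_const (lt_add_one _)) self_mem_nhdsWithin, ?_⟩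
  filter_upwards [(Metric.tendsto_nhds.1 ha) (ε / (‖iteratedFDeriv ℝ n φ x‖ + 1)) (by positivity)]
    with t ht y hy
  rw [h1 _ y hy.2, h1 _ y hy.2, dist_eq_norm, ← sub_smul, norm_smul]
  rw [dist_comm, dist_eq_norm, lt_div_iff₀ hM] at ht
  exact (mul_le_mul_of_nonneg_left hy.1.le (norm_nonneg _)).trans_lt ht

theorem three_mul_omegaInfty (c : Fin s → Fin s → ℝ) (y : Coord s) (i j : Fin s ⊕ Fin s) :
    3 * omegaInfty s y i j = blockMat (fun _ => 3 / 4) 0 0 0 i j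
      * (coframe c y i * conj (coframe c y j)) := by
  rcases i with i | i <;> rcases j with j | j
  · rw [blockMat_inl_inl, omegaInfty, Matrix.diagonal_apply]
    by_cases h : i = j
    · subst h
      simp [coframe]
      ring
    · simp [h]
  · simp [blockMat_inl_inr, omegaInfty]
  · simp [blockMat_inr_inl, omegaInfty]
  · simp [blockMat_inr_inr, omegaInfty, Matrix.diagonal_apply]

section
variable {k : ℕ} {p : Fin k → Fin s} {c : Fin s → Fin s → ℝ} {A B : Fin s → ℝ} {C : Fin k → ℂ}
  {l : Fin s → ℝ → ℝ}

theorem antitoneOn_norm_solC (hp : Function.Injective p)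
    (hl : ∀ i, IsClock (A i) (B i) (offDiag p C i) (c i i) (l i)) (hB : ∀ i, 0 < B i)
    (hδ : ∀ i, 0 < A i * B i - ‖offDiag p C i‖ ^ 2) (r : Fin k) :
    AntitoneOn (fun t => ‖solC c p C l t r‖) (Set.Ici 0) := by
  have := (hl (p r)).antitoneOn (hB _) (hδ _)
  rwa [offDiag_apply hp] at this

theorem norm_offDiag_solC_le (hp : Function.Injective p)
    (hl : ∀ i, IsClock (A i) (B i) (offDiag p C i) (c i i) (l i)) (hB : ∀ i, 0 < B i)
    (hδ : ∀ i, 0 < A i * B i - ‖offDiag p C i‖ ^ 2) (i : Fin s) {t : ℝ} (ht : 0 ≤ t) :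
    ‖offDiag p (solC c p C l t) i‖ ≤ ‖offDiag p C i‖ := by
  have := (hl i).antitoneOn (hB _) (hδ _) (Set.self_mem_Ici) ht ht
  simpa [offDiag_solC hp, (hl i).zero] using this

/-- Only the coefficients `A` grow linearly; `B` and `C` are bounded and disappear in the limit. -/
theorem tendsto_coeffs_sol (hp : Function.Injective p)
    (hl : ∀ i, IsClock (A i) (B i) (offDiag p C i) (c i i) (l i)) (hB : ∀ i, 0 < B i)
    (hδ : ∀ i, 0 < A i * B i - ‖offDiag p C i‖ ^ 2) (i j : Fin s ⊕ Fin s) :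
    Filter.Tendsto (fun t : ℝ => coeffs p (solA A l t) B (solC c p C l t) i j / (1 + (t : ℂ)))
      Filter.atTop (nhds (blockMat (fun _ => 3 / 4) 0 0 0 i j)) := by
  simp only [coeffs_eq]
  rcases i with i | i <;> rcases j with j | j
  · simp only [blockMat_inl_inl]
    split_ifs
    · exact tendsto_div_one_add_of_isEquivalent ((hl i).isEquivalent (hB i))
    · simp
  · simp only [blockMat_inl_inr, Pi.zero_apply, ite_self]
    split_ifs
    · exact tendsto_div_one_add_of_bounded (M := ‖offDiag p C i‖)
        ((Filter.eventually_ge_atTop 0).mono fun t ht => norm_offDiag_solC_le hp hl hB hδ i ht)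
    · simp
  · simp only [blockMat_inr_inl, Pi.zero_apply, ite_self]
    split_ifs
    · exact tendsto_div_one_add_of_bounded (M := ‖offDiag p C i‖)
        ((Filter.eventually_ge_atTop 0).mono fun t ht => by
          rw [norm_conj]; exact norm_offDiag_solC_le hp hl hB hδ i ht)
    · simp
  · simp only [blockMat_inr_inr, Pi.zero_apply, ite_self]
    exact tendsto_div_one_add_of_bounded (M := ‖if i = j then (B i : ℂ) else 0‖)
      (Filter.Eventually.of_forall fun t => le_rfl)

end

end OT

/-! ### The main theorem. -/

open Filter Topology in
theorem corollary4p5 {s : ℕ} {K : Type*} [Field K] [NumberField K] (X : OT.Data s K)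
    (c : Fin s → Fin s → ℝ) (hc : X.Twist c)
    {k : ℕ} (p : Fin k → Fin s) (hp : Function.Injective p)
    (hcp : ∀ r : Fin k, ∀ j : Fin s, j ≠ p r → c j (p r) = 0)
    (A₀ B₀ : Fin s → ℝ) (C₀ : Fin k → ℂ) (hpos : (OT.coeffs p A₀ B₀ C₀).PosDef) :
    -- the pluriclosed flow from the given metric is equivalent to the system of ODEs
    (∀ T : EReal, 0 < T → ∀ h : ℝ → OT.FormField s,
      X.IsPluriclosedFlow T (OT.leftInvariant c (OT.coeffs p A₀ B₀ C₀)) h ↔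
        ∃ (A B : ℝ → Fin s → ℝ) (C : ℝ → Fin k → ℂ),
          A 0 = A₀ ∧ B 0 = B₀ ∧ C 0 = C₀ ∧ OT.SolvesODE c p T A B C ∧
          ∀ t ∈ OT.timeInterval T, ∀ x ∈ OT.domain s,
            h t x = OT.leftInvariant c (OT.coeffs p (A t) (B t) (C t)) x) ∧
    -- long-time existence, uniqueness and asymptotics
    (∃ (A B : ℝ → Fin s → ℝ) (C : ℝ → Fin k → ℂ),
      A 0 = A₀ ∧ B 0 = B₀ ∧ C 0 = C₀ ∧ OT.SolvesODE c p ⊤ A B C ∧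
      (∀ T : EReal, 0 < T → ∀ h : ℝ → OT.FormField s,
        X.IsPluriclosedFlow T (OT.leftInvariant c (OT.coeffs p A₀ B₀ C₀)) h ↔
          ∀ t ∈ OT.timeInterval T, ∀ x ∈ OT.domain s,
            h t x = OT.leftInvariant c (OT.coeffs p (A t) (B t) (C t)) x) ∧
      (∀ t, 0 ≤ t → B t = B₀) ∧
      (∀ r, AntitoneOn (fun t => ‖C t r‖) (Set.Ici 0)) ∧
      (∀ i, Asymptotics.IsEquivalent atTop (fun t => A t i) (fun t => 3 / 4 * t)) ∧
      -- smooth convergence of `ω_t / (1 + t)` to `3 ω_∞`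
      (∀ (n : ℕ) (i j : Fin s ⊕ Fin s),
        TendstoLocallyUniformlyOn
          (fun (t : ℝ) (x : OT.Coord s) => iteratedFDeriv ℝ n
            (fun y => OT.leftInvariant c (OT.coeffs p (A t) (B t) (C t)) y i j / (1 + (t : ℂ))) x)
          (fun x : OT.Coord s => iteratedFDeriv ℝ n (fun y => 3 * OT.omegaInfty s y i j) x)
          atTop (OT.domain s))) := by
  have hpd := hpos
  rw [OT.coeffs_eq, OT.blockMat_posDef_iff] at hpd
  have hB := fun i => (hpd i).1
  have hδ := fun i => (hpd i).2
  choose l hl using fun i => OT.exists_isClock (c i i) (hB i) (hδ i)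
  have hA0 : OT.solA A₀ l 0 = A₀ := funext fun i => by simp [OT.solA, (hl i).zero]
  have hC0 : OT.solC c p C₀ l 0 = C₀ := funext fun r => by simp [OT.solC, (hl (p r)).zero]
  -- The explicit family is a solution on every interval, and by uniqueness the only one; both
  -- equivalences of the theorem follow from this.
  have key : ∀ T : EReal, 0 < T → ∀ h : ℝ → OT.FormField s,
      X.IsPluriclosedFlow T (OT.leftInvariant c (OT.coeffs p A₀ B₀ C₀)) h ↔
        ∀ t ∈ OT.timeInterval T, ∀ x ∈ OT.domain s, h t x = OT.leftInvariant c
          (OT.coeffs p (OT.solA A₀ l t) B₀ (OT.solC c p C₀ l t)) x := by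
    intro T hT h
    have hs := OT.Data.isPluriclosedFlow_sol (X := X) hc hp hcp hl hB hδ T
    exact ⟨fun hf => OT.Data.IsPluriclosedFlow.unique hc hT hf hs,
      fun hf => hs.congr hT fun t ht x hx => (hf t ht x hx).symm⟩
  refine ⟨fun T hT h => ?_, OT.solA A₀ l, fun _ => B₀, OT.solC c p C₀ l, hA0, rfl, hC0,
    OT.solvesODE_sol hp hl hδ ⊤, key, fun _ _ => rfl,
    OT.antitoneOn_norm_solC hp hl hB hδ, fun i => (hl i).isEquivalent (hB i), fun n i j => ?_⟩
  · rw [key T hT h]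
    constructor
    · intro hf
      exact ⟨OT.solA A₀ l, fun _ => B₀, OT.solC c p C₀ l, hA0, rfl, hC0,
        OT.solvesODE_sol hp hl hδ T, hf⟩
    · rintro ⟨A, B, C, hA, hB', hC, hsol, hf⟩ t ht x hx
      -- Any solution of the system with these initial values coincides with the explicit one, so
      -- the metric it defines solves the flow.
      obtain ⟨e1, e2, e3⟩ := hsol.eq_sol hp hl hB hδ hA hB' hC ht
      rw [hf t ht x hx, e1, e2, e3]
  · have h1 := OT.tendstoLocallyUniformlyOn_iteratedFDeriv (OT.smooth_coframe_mul c i j)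
      (OT.tendsto_coeffs_sol hp hl hB hδ i j) n
    simp only [← OT.three_mul_omegaInfty] at h1
    convert h1 using 5
    simp only [OT.leftInvariant, Matrix.of_apply]
    ring
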